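/- Let $\Omega\subset\mathbb R^n$ be a bounded domain, let $m_1,m_2\in\mathbb N$ and let $k_1,k_2\ge 2$ be real. Write $z=(z_1,z_2)$ with $z_a=(z_a^1,\dots,z_a^{m_a})$ and $p=(p_1,p_2)$ with $p_a=(p_{a\beta}^i)$, $1\le i\le m_a$, $1\le\beta\le n$. Let $q=(q_{ai}^\alpha(x,z,p))$ and $w=(w_{ai}(x,z,p))$ ($a=1,2$, $1\le i\le m_a$, $1\le\alpha\le n$) be real coefficients that are locally Lipschitz in $(x,z,p)$ for $x\in\Omega$. Let $|\cdot|$ denote the maximum norm, $V_a=(1+|p_a|^2)^{1/2}$, and let subscripts $x,z,p$ denote partial derivatives, with blocks $(q_z)_{ab}=\partial_{z_b}q_a$, $(q_p)_{ab}=\partial_{p_b}q_a$, $(w_p^T)_{ab}=\partial_{p_a}w_b$. Suppose that for every $R>0$ there are constants $0<\lambda(R)<\Lambda(R)$ such that for almost every $x\in\Omega$ and all $(z,p)$ with $|x|^2+|z|^2\le R^2$, the coefficients are differentiable at $(x,z,p)$ and satisfy there the following weakly coupled conditions: \begin{align*} &|w_1|+|w_{1x}|\le\Lambda(R)\big(V_1^{k_1}+V_2^{k_2-1}\big),\qquad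 |w_2|+|w_{2x}|\le\Lambda(R)V_2^{k_2},\\ &\pi\cdot w_z\cdot\pi\ge-\Lambda(R)\Big(\sum_{a=1}^2V_a^{k_a}|\pi_a|^2+V_2^{k_2-1}|\pi_1|^2\Big)\quad\text{for all }\pi=(\pi_1,\pi_2),\ \pi_a\in\mathbb R^{m_a},\\ &|q_a|+|q_{ax}|\le\Lambda(R)V_a^{k_a-1},\qquad a=1,2,\\ &|q_z|+|w_p^T|\le\Lambda(R)\begin{pmatrix}V_1^{k_1-1}&0\\V_2^{k_2-2}&V_2^{k_2-1}\end{pmatrix},\qquad |q_p|\le\Lambda(R)\,\mathrm{diag}\big(V_1^{k_1-2},V_2^{k_2-2}\big)\quad\text{(blockwise)},\\ &\pi\cdot q_p\cdot\pi\ge\lambda(R)\sum_{a=1}^2V_a^{k_a-2}|\pi_a|^2\quad\text{for all }\pi=(\pi_1,\pi_2),\ \pi_a\in\mathbb R^{m_a\times n}. \end{align*} Let $z=(z_1,z_2)$ with $z_a^i\in L_1^{k_a}(\Omega)\cap C^0(\Omega)$ be a weak solution of the 2-coupled system $$\int_\Omega\sum_{a,i}\Big(\sum_\alpha\partial_\alpha\xi_a^i\,q_{ai}^\alpha(x,z,\nabla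 z)+\xi_a^i\,w_{ai}(x,z,\nabla z)\Big)dx=0$$ for all compactly supported $\xi$ with $\xi_a^i\in L_1^{k_a}(\Omega)\cap C^0(\Omega)$. Here $L_s^r$ denotes the Sobolev space of functions with weak derivatives up to order $s$ in $L^r$. If $z_1\in L_1^{2k_2}(\Omega)$, then $z\in L^2_{2,\mathrm{loc}}(\Omega)\cap C^0(\Omega)$, that is, $z$ is continuous on $\Omega$ and $z\in L_2^2(\Omega')$ for every open $\Omega'\subset\subset\Omega$. -/

import Mathlib

open MeasureTheory Set
open scoped ENNReal ContDiff

noncomputable section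

/-! ### Sobolev spaces on open subsets of `ℝⁿ`

Points of `ℝⁿ` are functions `Fin n → ℝ`; `|·|` is the maximum norm throughout. -/

/-- `v` is the weak partial derivative `∂u/∂x^γ` on `Ω`. -/
structure IsWeakPartial {n : ℕ} (Ω : Set (Fin n → ℝ)) (γ : Fin n)
    (u v : (Fin n → ℝ) → ℝ) : Prop where
  locInt : LocallyIntegrableOn u Ω
  locInt' : LocallyIntegrableOn v Ω
  eq : ∀ φ : (Fin n → ℝ) → ℝ, ContDiff ℝ ∞ φ → HasCompactSupport φ → tsupport φ ⊆ Ω →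
    ∫ x in Ω, u x * fderiv ℝ φ x (Pi.single γ 1) = - ∫ x in Ω, v x * φ x

/-- The Sobolev space `L_s^r(Ω)`: functions in `L^r(Ω)` whose weak partial derivatives of
order at most `s` exist and belong to `L^r(Ω)`. -/
def MemSobolev {n : ℕ} (Ω : Set (Fin n → ℝ)) : ℕ → ℝ≥0∞ → ((Fin n → ℝ) → ℝ) → Prop
  | 0, r, u => MemLp u r (volume.restrict Ω)
  | s + 1, r, u => MemLp u r (volume.restrict Ω) ∧
      ∀ γ, ∃ v, IsWeakPartial Ω γ u v ∧ MemSobolev Ω s r v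

/-- The local Sobolev space: `u ∈ L_s^r(Ω')` for all open `Ω' ⊂⊂ Ω`. -/
def MemSobolevLoc {n : ℕ} (Ω : Set (Fin n → ℝ)) (s : ℕ) (r : ℝ≥0∞)
    (u : (Fin n → ℝ) → ℝ) : Prop :=
  ∀ Ω' : Set (Fin n → ℝ), IsOpen Ω' → IsCompact (closure Ω') → closure Ω' ⊆ Ω →
    MemSobolev Ω' s r u

/-! ### 2-coupled systems

The two blocks of unknowns `z = (z₁, z₂)` are indexed by `a : Fin 2`: block `0` is `z₁`,
block `1` is `z₂`. -/

/-- Values of `z`: `z a i` is the component `z_a^i`. -/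
abbrev ZVar (m : Fin 2 → ℕ) := (a : Fin 2) → Fin (m a) → ℝ

/-- Values of `p = ∇z`: `p a i β` is `∂_β z_a^i`. -/
abbrev PVar (n : ℕ) (m : Fin 2 → ℕ) := (a : Fin 2) → Fin (m a) → Fin n → ℝ

/-- Arguments `(x, z, p)` of the coefficients. -/
abbrev CoeffArg (n : ℕ) (m : Fin 2 → ℕ) := (Fin n → ℝ) × ZVar m × PVar n m

section Partials

variable {n : ℕ} {m : Fin 2 → ℕ} {F : Fin 2 → Type}
  [∀ a, NormedAddCommGroup (F a)] [∀ a, NormedSpace ℝ (F a)]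

/-- The array `c_{a,x}` of the derivatives `∂_{x^γ} c_a`. -/
def dx (c : CoeffArg n m → (a : Fin 2) → F a) (y : CoeffArg n m) (a : Fin 2) :
    Fin n → F a :=
  fun γ => fderiv ℝ c y (Pi.single γ 1, 0, 0) a

/-- The block `∂_{z_b} c_a`, with entries `∂_{z_b^j} c_a`. -/
def dz (c : CoeffArg n m → (a : Fin 2) → F a) (y : CoeffArg n m) (a b : Fin 2) :
    Fin (m b) → F a :=
  fun j => fderiv ℝ c y (0, Pi.single b (Pi.single j 1), 0) a

/-- The block `∂_{p_b} c_a`, with entries `∂_{p_{bβ}^j} c_a`. -/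
def dp (c : CoeffArg n m → (a : Fin 2) → F a) (y : CoeffArg n m) (a b : Fin 2) :
    Fin (m b) → Fin n → F a :=
  fun j β => fderiv ℝ c y (0, 0, Pi.single b (Pi.single j (Pi.single β 1))) a

end Partials

/-- `V_a = (1 + |p_a|²)^{1/2}` at the point `y = (x, z, p)`. -/
def V {n : ℕ} {m : Fin 2 → ℕ} (y : CoeffArg n m) (a : Fin 2) : ℝ :=
  Real.sqrt (1 + ‖y.2.2 a‖ ^ 2)

/-- The weakly coupled structure conditions at one point `y = (x, z, p)`, with constants
`lam` (ellipticity) and `Lam` (growth). Norms of arrays are maximum norms. -/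
structure WeaklyCoupledAt {n : ℕ} {m : Fin 2 → ℕ} (k : Fin 2 → ℝ)
    (q : CoeffArg n m → PVar n m) (w : CoeffArg n m → ZVar m) (lam Lam : ℝ)
    (y : CoeffArg n m) : Prop where
  diff_q : DifferentiableAt ℝ q y
  diff_w : DifferentiableAt ℝ w y
  w_one : ‖w y 0‖ + ‖dx w y 0‖ ≤ Lam * (V y 0 ^ k 0 + V y 1 ^ (k 1 - 1))
  w_two : ‖w y 1‖ + ‖dx w y 1‖ ≤ Lam * V y 1 ^ k 1
  /-- `π · w_z · π ≥ -Λ (∑ V_a^{k_a} |π_a|² + V₂^{k₂-1} |π₁|²)`. -/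
  w_z : ∀ π : ZVar m,
    -(∑ a, ∑ i, ∑ b, ∑ j, π a i * dz w y a b j i * π b j) ≤
      Lam * (∑ a, V y a ^ k a * ‖π a‖ ^ 2 + V y 1 ^ (k 1 - 1) * ‖π 0‖ ^ 2)
  q_growth : ∀ a, ‖q y a‖ + ‖dx q y a‖ ≤ Lam * V y a ^ (k a - 1)
  /-- `|q_z| + |w_pᵀ|` is bounded blockwise by a lower triangular matrix; block `(a, b)` of
  `q_z` is `∂_{z_b} q_a`, and block `(a, b)` of `w_pᵀ` is `∂_{p_a} w_b`. -/
  coupling : ∀ a b, ‖dz q y a b‖ + ‖dp w y b a‖ ≤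
    Lam * (!![V y 0 ^ (k 0 - 1), 0; V y 1 ^ (k 1 - 2), V y 1 ^ (k 1 - 1)] a b)
  q_p : ∀ a b, ‖dp q y a b‖ ≤
    Lam * (!![V y 0 ^ (k 0 - 2), 0; 0, V y 1 ^ (k 1 - 2)] a b)
  elliptic : ∀ π : PVar n m,
    lam * ∑ a, V y a ^ (k a - 2) * ‖π a‖ ^ 2 ≤
      ∑ a, ∑ i, ∑ α, ∑ b, ∑ j, ∑ β, π a i α * dp q y a b j β i α * π b j β

/-- The weakly coupled conditions on `Ω`: the coefficients are locally Lipschitz, and for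
every `R > 0` there are constants `0 < λ(R) < Λ(R)` such that, for almost every `x ∈ Ω`, the
structure conditions hold at all `(x, z, p)` with `|x|² + |z|² ≤ R²`. -/
structure WeaklyCoupled {n : ℕ} {m : Fin 2 → ℕ} (Ω : Set (Fin n → ℝ)) (k : Fin 2 → ℝ)
    (q : CoeffArg n m → PVar n m) (w : CoeffArg n m → ZVar m) : Prop where
  lip_q : LocallyLipschitzOn (Ω ×ˢ univ) q
  lip_w : LocallyLipschitzOn (Ω ×ˢ univ) w
  cond : ∃ lam Lam : ℝ → ℝ, ∀ R > 0, 0 < lam R ∧ lam R < Lam R ∧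
    ∀ᵐ x ∂(volume.restrict Ω), ∀ (z : ZVar m) (p : PVar n m),
      ‖x‖ ^ 2 + ‖z‖ ^ 2 ≤ R ^ 2 → WeaklyCoupledAt k q w (lam R) (Lam R) (x, z, p)

/-- `u = (u₁, u₂)` has components `u_a^i ∈ L_1^{k_a}(Ω)`, with weak gradient `Du`. -/
def HasSobolevGradient {n : ℕ} {m : Fin 2 → ℕ} (Ω : Set (Fin n → ℝ)) (k : Fin 2 → ℝ)
    (u : (Fin n → ℝ) → ZVar m) (Du : (Fin n → ℝ) → PVar n m) : Prop :=
  ∀ a i, MemLp (fun x => u x a i) (ENNReal.ofReal (k a)) (volume.restrict Ω) ∧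
    ∀ β, IsWeakPartial Ω β (fun x => u x a i) (fun x => Du x a i β) ∧
      MemLp (fun x => Du x a i β) (ENNReal.ofReal (k a)) (volume.restrict Ω)

/-- `z = (z₁, z₂)` with `z_a^i ∈ L_1^{k_a} ∩ C⁰(Ω)` is a weak solution of
`∫_Ω ∂_α ξ_a^i q_{ai}^α(x, z, ∇z) + ξ_a^i w_{ai}(x, z, ∇z) = 0`, tested against all compactly
supported `ξ_a ∈ L_1^{k_a} ∩ C⁰(Ω)`. -/
def IsWeakSolution {n : ℕ} {m : Fin 2 → ℕ} (Ω : Set (Fin n → ℝ)) (k : Fin 2 → ℝ)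
    (q : CoeffArg n m → PVar n m) (w : CoeffArg n m → ZVar m)
    (z : (Fin n → ℝ) → ZVar m) : Prop :=
  ContinuousOn z Ω ∧ ∃ p : (Fin n → ℝ) → PVar n m, HasSobolevGradient Ω k z p ∧
    ∀ (ξ : (Fin n → ℝ) → ZVar m) (Dξ : (Fin n → ℝ) → PVar n m),
      Continuous ξ → HasCompactSupport ξ → tsupport ξ ⊆ Ω → HasSobolevGradient Ω k ξ Dξ →
      ∫ x in Ω, ∑ a, ∑ i, (∑ α, Dξ x a i α * q (x, z x, p x) a i α
        + ξ x a i * w (x, z x, p x) a i) = 0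

end

/-!
The proof is by difference quotients. Write `Δ_h f = (f(x + h e_γ) - f(x)) / h`, and let `W_a` be
the larger of the weights `V_a` at `x` and `x + h e_γ`. Near a given point the solution is cut off
to a function on the whole space (`exists_localSystem`), and the following estimates are made there.

*Energy inequality* (`LocalSystem.energy_le`). The difference of the equation, tested with
`η² Δ_h z`, and of its translate is an integral of the derivatives of `q` and `w` over the segment
joining `(x, z, ∇z)(x)` to `(x, z, ∇z)(x + h e_γ)`. For almost every `x` the structure conditions
hold at almost every point of that segment, and they are applied there
(`WeaklyCoupledAt.le_pairing_fderiv`). As the average of `V_a^{k_a-2}` over the segment is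
comparable to `W_a^{k_a-2}` (`le_integral_wt_rpow`), the energy `∫ η² W_a^{k_a-2} |Δ_h ∇z_a|²` is
bounded by the critical term `∫ η² W_a^{k_a} |Δ_h z_a|²` and a lower order term. The
constant in front of the critical term does not involve the gradient of `η`.

*Lower order term* (`LocalSystem.exists_integral_lowerDens_le`). It is bounded uniformly in `h` by
Young's inequality and the `L^r` bound for difference quotients. The coupling of the blocks enters
through the density `W₂^{k₂-1} |Δ_h z₁|² ≤ W₂^{k₂} + |Δ_h z₁|^{2k₂}`, which is integrable because
`z₁` lies in `L_1^{2k₂}`.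

*Critical term* (`LocalSystem.exists_crit_le`). On a set where `z` differs from a constant `c` by at
most `osc`, testing the equation with `(z_a - c_a) ψ` and using the coercivity `exists_coercive` of
`q_a` gives `∫ V_a^{k_a} ψ ≤ C ∫ ψ + C osc ∫ V_a^{k_a-1} |∇ψ|`, up to the coupling term
(`LocalSystem.exists_oscillation`). With `ψ = η² |Δ_h z_a|²` and its translate, the critical term is
at most `C osc` times the sum of the energy and itself, plus lower order terms. By continuity of `z`, on a small ball `osc`
is small enough for the energy to absorb it.

Hence `Δ_h ∇z` is bounded in `L²` near every point, uniformly in `h`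
(`exists_local_diffQuot_bound`), and weak compactness in `L²` gives second weak derivatives in `L²`
(`exists_isWeakPartial_of_local_bound`).
-/

open Filter Topology

/-! ### Weak partial derivatives of integrable functions on the whole space -/

/-- `g` is the weak partial derivative `∂u/∂x^γ` on all of `ℝⁿ`, with `u` and `g` integrable. -/
structure HasWeakPartial {n : ℕ} (γ : Fin n) (u g : (Fin n → ℝ) → ℝ) : Prop where
  int : Integrable u
  int' : Integrable g
  eq : ∀ φ : (Fin n → ℝ) → ℝ, ContDiff ℝ ∞ φ → HasCompactSupport φ →
    ∫ x, u x * fderiv ℝ φ x (Pi.single γ 1) = - ∫ x, g x * φ x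

/-- Lebesgue measure on the unit interval, as a probability measure on `ℝ`. -/
noncomputable def unitMeasure : Measure ℝ := volume.restrict (Ioc 0 1)

instance : IsProbabilityMeasure unitMeasure :=
  ⟨by simp [unitMeasure]⟩

theorem integral_unitMeasure (f : ℝ → ℝ) : ∫ t, f t ∂unitMeasure = ∫ t in (0 : ℝ)..1, f t := by
  rw [intervalIntegral.integral_of_le zero_le_one, unitMeasure]

section Tools

variable {n : ℕ}

theorem integrable_mul_of_continuous {u ψ : (Fin n → ℝ) → ℝ} (hu : Integrable u)
    (hc : Continuous ψ) (hs : HasCompactSupport ψ) : Integrable (fun x => u x * ψ x) := by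
  obtain ⟨C, hC⟩ := hs.exists_bound_of_continuous hc
  exact hu.mul_bdd hc.aestronglyMeasurable (Eventually.of_forall hC)

theorem measurePreserving_shear (v : Fin n → ℝ) :
    MeasurePreserving (fun p : (Fin n → ℝ) × ℝ => p.1 + p.2 • v)
      ((volume : Measure (Fin n → ℝ)).prod unitMeasure) volume := by
  have h1 : MeasurePreserving (fun p : ℝ × (Fin n → ℝ) => (p.1, p.2 + p.1 • v))
      (unitMeasure.prod (volume : Measure (Fin n → ℝ))) (unitMeasure.prod volume) := by
    refine MeasurePreserving.skew_product (g := fun t x => x + t • v) (MeasurePreserving.id _)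
      (by fun_prop) (Eventually.of_forall fun t => ?_)
    exact (measurePreserving_add_right volume (t • v)).map_eq
  exact (measurePreserving_snd.comp h1).comp Measure.measurePreserving_swap

theorem integrable_shear {g : (Fin n → ℝ) → ℝ} (hg : Integrable g) (v : Fin n → ℝ) :
    Integrable (fun p : (Fin n → ℝ) × ℝ => g (p.1 + p.2 • v))
      ((volume : Measure (Fin n → ℝ)).prod unitMeasure) :=
  ((measurePreserving_shear v).integrable_comp hg.aestronglyMeasurable).2 hg

/-- A property that holds almost everywhere holds, for almost every `x`, at almost every point of
the segment from `x` to `x + v`. -/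
theorem ae_ae_segment {p : (Fin n → ℝ) → Prop} (hp : ∀ᵐ x, p x) (v : Fin n → ℝ) :
    ∀ᵐ x : Fin n → ℝ, ∀ᵐ t ∂unitMeasure, p (x + t • v) :=
  Measure.ae_ae_of_ae_prod ((measurePreserving_shear v).quasiMeasurePreserving.ae hp)

theorem integrable_comp_add {g : (Fin n → ℝ) → ℝ} (hg : Integrable g) (v : Fin n → ℝ) :
    Integrable (fun x => g (x + v)) :=
  ((measurePreserving_add_right volume v).integrable_comp hg.aestronglyMeasurable).2 hg

theorem hasCompactSupport_comp_add {F : Type*} [Zero F] {ψ : (Fin n → ℝ) → F}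
    (hs : HasCompactSupport ψ) (v : Fin n → ℝ) : HasCompactSupport (fun x => ψ (x + v)) :=
  hs.comp_homeomorph (Homeomorph.addRight v)

theorem fderiv_comp_add (φ : (Fin n → ℝ) → ℝ) (v x : Fin n → ℝ) :
    fderiv ℝ (fun y => φ (y + v)) x = fderiv ℝ φ (x + v) :=
  fderiv_comp_add_right v

theorem continuous_fderiv_apply {φ : (Fin n → ℝ) → ℝ} (hφ : ContDiff ℝ ∞ φ) (v : Fin n → ℝ) :
    Continuous fun x => fderiv ℝ φ x v :=
  (hφ.continuous_fderiv (by simp)).clm_apply continuous_const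

theorem hasCompactSupport_fderiv_apply {φ : (Fin n → ℝ) → ℝ} (hφ : HasCompactSupport φ)
    (v : Fin n → ℝ) : HasCompactSupport fun x => fderiv ℝ φ x v :=
  hφ.fderiv_apply (𝕜 := ℝ) v

theorem fderiv_mul_apply {φ χ : (Fin n → ℝ) → ℝ} (hφ : ContDiff ℝ ∞ φ) (hχ : ContDiff ℝ ∞ χ)
    (x v : Fin n → ℝ) :
    fderiv ℝ (fun y => χ y * φ y) x v = χ x * fderiv ℝ φ x v + fderiv ℝ χ x v * φ x := by
  have h1 : DifferentiableAt ℝ φ x := (hφ.differentiable (by simp)) x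
  have h2 : DifferentiableAt ℝ χ x := (hχ.differentiable (by simp)) x
  rw [fderiv_fun_mul h2 h1]
  simp [mul_comm]

namespace HasWeakPartial

variable {γ : Fin n} {u v g g' : (Fin n → ℝ) → ℝ}

theorem isWeakPartial (h : HasWeakPartial γ u g) (Ω : Set (Fin n → ℝ)) :
    IsWeakPartial Ω γ u g where
  locInt := h.int.locallyIntegrable.locallyIntegrableOn Ω
  locInt' := h.int'.locallyIntegrable.locallyIntegrableOn Ω
  eq := by
    intro φ h1 h2 h3
    rw [setIntegral_eq_integral_of_forall_compl_eq_zero,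
      setIntegral_eq_integral_of_forall_compl_eq_zero]
    · exact h.eq φ h1 h2
    · intro x hx
      rw [image_eq_zero_of_notMem_tsupport (fun hx' => hx (h3 hx')), mul_zero]
    · intro x hx
      have : fderiv ℝ φ x = 0 :=
        image_eq_zero_of_notMem_tsupport (fun hx' => hx (h3 (tsupport_fderiv_subset ℝ hx')))
      simp [this]

theorem add (h : HasWeakPartial γ u g) (h' : HasWeakPartial γ v g') :
    HasWeakPartial γ (fun x => u x + v x) (fun x => g x + g' x) where
  int := h.int.add h'.int
  int' := h.int'.add h'.int'
  eq := by
    intro φ h1 h2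
    have c1 := continuous_fderiv_apply h1 (Pi.single γ 1)
    have c2 := hasCompactSupport_fderiv_apply h2 (Pi.single γ 1)
    simp only [add_mul]
    rw [integral_add (integrable_mul_of_continuous h.int c1 c2)
      (integrable_mul_of_continuous h'.int c1 c2),
      integral_add (integrable_mul_of_continuous h.int' h1.continuous h2)
      (integrable_mul_of_continuous h'.int' h1.continuous h2), h.eq φ h1 h2, h'.eq φ h1 h2]
    ring

theorem const_mul (h : HasWeakPartial γ u g) (c : ℝ) :
    HasWeakPartial γ (fun x => c * u x) (fun x => c * g x) where
  int := h.int.const_mul c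
  int' := h.int'.const_mul c
  eq := by
    intro φ h1 h2
    simp only [mul_assoc, integral_const_mul, h.eq φ h1 h2, mul_neg]

theorem sub (h : HasWeakPartial γ u g) (h' : HasWeakPartial γ v g') :
    HasWeakPartial γ (fun x => u x - v x) (fun x => g x - g' x) := by
  simpa [sub_eq_add_neg] using h.add (h'.const_mul (-1))

theorem sum {ι : Type*} (s : Finset ι) {u g : ι → (Fin n → ℝ) → ℝ}
    (h : ∀ i ∈ s, HasWeakPartial γ (u i) (g i)) :
    HasWeakPartial γ (fun x => ∑ i ∈ s, u i x) (fun x => ∑ i ∈ s, g i x) where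
  int := integrable_finsetSum s fun i hi => (h i hi).int
  int' := integrable_finsetSum s fun i hi => (h i hi).int'
  eq := by
    intro φ h1 h2
    have c1 := continuous_fderiv_apply h1 (Pi.single γ 1)
    have c2 := hasCompactSupport_fderiv_apply h2 (Pi.single γ 1)
    simp only [Finset.sum_mul]
    rw [integral_finsetSum s fun i hi => integrable_mul_of_continuous (h i hi).int c1 c2,
      integral_finsetSum s fun i hi => integrable_mul_of_continuous (h i hi).int' h1.continuous h2,
      ← Finset.sum_neg_distrib]
    exact Finset.sum_congr rfl fun i hi => (h i hi).eq φ h1 h2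

theorem translate (h : HasWeakPartial γ u g) (w : Fin n → ℝ) :
    HasWeakPartial γ (fun x => u (x + w)) (fun x => g (x + w)) where
  int := integrable_comp_add h.int w
  int' := integrable_comp_add h.int' w
  eq := by
    intro φ h1 h2
    have h1' : ContDiff ℝ ∞ (fun x => φ (x + -w)) := h1.comp (contDiff_id.add contDiff_const)
    have := h.eq _ h1' (hasCompactSupport_comp_add h2 (-w))
    rw [← integral_add_right_eq_self _ w, ← integral_add_right_eq_self (fun x => g x * _) w] at this
    simpa [fderiv_comp_add] using this

theorem smooth_mul (h : HasWeakPartial γ u g) {χ : (Fin n → ℝ) → ℝ} (hχ : ContDiff ℝ ∞ χ)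
    (hs : HasCompactSupport χ) :
    HasWeakPartial γ (fun x => u x * χ x)
      (fun x => g x * χ x + u x * fderiv ℝ χ x (Pi.single γ 1)) where
  int := integrable_mul_of_continuous h.int hχ.continuous hs
  int' := (integrable_mul_of_continuous h.int' hχ.continuous hs).add
    (integrable_mul_of_continuous h.int (continuous_fderiv_apply hχ _)
      (hasCompactSupport_fderiv_apply hs _))
  eq := by
    intro φ h1 h2
    have e1 := h.eq (fun x => χ x * φ x) (hχ.mul h1) h2.mul_left
    simp only [fderiv_mul_apply h1 hχ] at e1
    have i1 : Integrable fun x => u x * (χ x * fderiv ℝ φ x (Pi.single γ 1)) :=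
      integrable_mul_of_continuous h.int (hχ.continuous.mul (continuous_fderiv_apply h1 _))
        (hasCompactSupport_fderiv_apply h2 _).mul_left
    have i2 : Integrable fun x => u x * (fderiv ℝ χ x (Pi.single γ 1) * φ x) :=
      integrable_mul_of_continuous h.int ((continuous_fderiv_apply hχ _).mul h1.continuous)
        h2.mul_left
    have i3 : Integrable fun x => g x * (χ x * φ x) :=
      integrable_mul_of_continuous h.int' (hχ.continuous.mul h1.continuous) h2.mul_left
    simp only [mul_add] at e1
    rw [integral_add i1 i2] at e1
    simp only [add_mul, mul_assoc]
    rw [integral_add i3 i2]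
    linarith

/-- The fundamental theorem of calculus along segments, tested against a smooth function. -/
theorem integral_translate_sub_mul_smooth (h : HasWeakPartial γ u g) (t : ℝ)
    {φ : (Fin n → ℝ) → ℝ} (h1 : ContDiff ℝ ∞ φ) (h2 : HasCompactSupport φ) :
    ∫ x, (u (x + t • Pi.single γ 1) - u x) * φ x =
      ∫ x, (t * ∫ s, g (x + s • t • Pi.single γ 1) ∂unitMeasure) * φ x := by
  set e : Fin n → ℝ := Pi.single γ 1 with he
  have hcs (w : Fin n → ℝ) : ContDiff ℝ ∞ (fun x => φ (x + w)) :=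
    h1.comp (contDiff_id.add contDiff_const)
  -- Move the translation from `u` to the test function.
  have e1 : ∫ x, (u (x + t • e) - u x) * φ x = ∫ x, u x * (φ (x - t • e) - φ x) := by
    have i1 : Integrable fun x => u (x + t • e) * φ x :=
      integrable_mul_of_continuous (integrable_comp_add h.int _) h1.continuous h2
    have i2 : Integrable fun x => u x * φ x := integrable_mul_of_continuous h.int h1.continuous h2
    have i3 : Integrable fun x => u x * φ (x - t • e) := by
      simp only [sub_eq_add_neg]
      exact integrable_mul_of_continuous h.int (hcs _).continuous (hasCompactSupport_comp_add h2 _)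
    simp only [sub_mul, mul_sub]
    rw [integral_sub i1 i2, integral_sub i3 i2,
      ← integral_add_right_eq_self (fun x => u x * φ (x - t • e)) (t • e)]
    simp
  have e2 (x : Fin n → ℝ) : φ (x - t • e) - φ x =
      ∫ s, -t * fderiv ℝ φ (x + s • (-t • e)) e ∂unitMeasure := by
    rw [integral_unitMeasure, intervalIntegral.integral_eq_sub_of_hasDerivAt
      (f := fun s => φ (x + s • (-t • e)))]
    · simp [sub_eq_add_neg]
    · intro s _
      have hd : HasDerivAt (fun s : ℝ => x + s • (-t • e)) (-t • e) s := by
        simpa using ((hasDerivAt_id s).smul_const (-t • e)).const_add x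
      have := ((h1.differentiable (by simp)) (x + s • (-t • e))).hasFDerivAt.comp_hasDerivAt s hd
      simpa [Function.comp_def] using this
    · apply Continuous.intervalIntegrable
      exact continuous_const.mul ((continuous_fderiv_apply h1 e).comp (by fun_prop))
  obtain ⟨C, hC⟩ := (hasCompactSupport_fderiv_apply h2 e).exists_bound_of_continuous
    (continuous_fderiv_apply h1 e)
  have i4 : Integrable (Function.uncurry fun x s => u x * (-t * fderiv ℝ φ (x + s • (-t • e)) e))
      ((volume : Measure (Fin n → ℝ)).prod unitMeasure) := by
    refine (h.int.comp_fst unitMeasure).mul_bdd (c := |t| * C) ?_ (Eventually.of_forall ?_)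
    · exact (continuous_const.mul ((continuous_fderiv_apply h1 e).comp
        (by fun_prop))).aestronglyMeasurable
    · intro p
      simp only [norm_mul, norm_neg, Real.norm_eq_abs]
      exact mul_le_mul_of_nonneg_left (hC _) (abs_nonneg t)
  have i5 : Integrable (Function.uncurry fun x s => t * (g (x + s • t • e) * φ x))
      ((volume : Measure (Fin n → ℝ)).prod unitMeasure) := by
    obtain ⟨C, hC⟩ := h2.exists_bound_of_continuous h1.continuous
    refine (((integrable_shear h.int' (t • e)).mul_bdd (c := C)
      (g := fun p : (Fin n → ℝ) × ℝ => φ p.1) ?_ (Eventually.of_forall ?_))).const_mul t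
    · exact (h1.continuous.comp continuous_fst).aestronglyMeasurable
    · intro p
      exact hC _
  calc ∫ x, (u (x + t • e) - u x) * φ x
      = ∫ x, ∫ s, u x * (-t * fderiv ℝ φ (x + s • (-t • e)) e) ∂unitMeasure := by
        rw [e1]
        simp only [e2, integral_const_mul]
    _ = ∫ s, (∫ x, u x * (-t * fderiv ℝ φ (x + s • (-t • e)) e)) ∂unitMeasure :=
        integral_integral_swap i4
    _ = ∫ s, (∫ x, t * (g (x + s • t • e) * φ x)) ∂unitMeasure := by
        congr 1
        ext s
        have := h.eq _ (hcs (s • (-t • e))) (hasCompactSupport_comp_add h2 _)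
        simp only [fderiv_comp_add] at this
        have e3 : ∀ x, u x * (-t * fderiv ℝ φ (x + s • (-t • e)) e) =
          -t * (u x * fderiv ℝ φ (x + s • (-t • e)) e) := fun x => by ring
        simp only [e3, integral_const_mul]
        rw [this, ← integral_add_right_eq_self _ (s • t • e)]
        simp
    _ = ∫ x, ∫ s, t * (g (x + s • t • e) * φ x) ∂unitMeasure :=
        (integral_integral_swap i5).symm
    _ = ∫ x, (t * ∫ s, g (x + s • t • e) ∂unitMeasure) * φ x := by
        simp only [integral_const_mul, integral_mul_const, mul_assoc]

/-- Weakly differentiable functions satisfy the fundamental theorem of calculus along almost every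
segment parallel to a coordinate axis. -/
theorem ae_translate_sub (h : HasWeakPartial γ u g) (t : ℝ) :
    ∀ᵐ x, u (x + t • Pi.single γ 1) - u x =
      t * ∫ s, g (x + s • t • Pi.single γ 1) ∂unitMeasure := by
  have i1 := (integrable_comp_add h.int (t • Pi.single γ 1)).sub h.int
  have i2 := ((integrable_shear h.int' (t • Pi.single γ 1)).integral_prod_left).const_mul t
  have := ae_eq_zero_of_integral_contDiff_smul_eq_zero (i1.sub i2).locallyIntegrable ?_
  · filter_upwards [this] with x hx
    simpa [sub_eq_zero] using hx
  · intro φ h1 h2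
    have := h.integral_translate_sub_mul_smooth t h1 h2
    have j := integral_sub (integrable_mul_of_continuous i1 h1.continuous h2)
      (integrable_mul_of_continuous i2 h1.continuous h2)
    rw [← sub_eq_zero] at this
    refine Eq.trans ?_ (j.trans this)
    congr 1
    ext x
    simp only [Pi.sub_apply, smul_eq_mul]
    ring

/-- The formula of `ae_translate_sub`, tested against a continuous function and with the translation
moved onto it. -/
theorem integral_translate_sub_mul (h : HasWeakPartial γ u g) (t : ℝ)
    {ψ : (Fin n → ℝ) → ℝ} (h1 : Continuous ψ) (h2 : HasCompactSupport ψ) :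
    ∫ x, (u (x + t • Pi.single γ 1) - u x) * ψ x =
      t * ∫ p, g p.1 * ψ (p.1 - p.2 • t • Pi.single γ 1)
        ∂((volume : Measure (Fin n → ℝ)).prod unitMeasure) := by
  set e : Fin n → ℝ := Pi.single γ 1 with he
  obtain ⟨C, hC⟩ := h2.exists_bound_of_continuous h1
  have i5 : Integrable (Function.uncurry fun x s => g (x + s • t • e) * ψ x)
      ((volume : Measure (Fin n → ℝ)).prod unitMeasure) :=
    (integrable_shear h.int' (t • e)).mul_bdd (c := C)
      (g := fun p : (Fin n → ℝ) × ℝ => ψ p.1) (h1.comp continuous_fst).aestronglyMeasurable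
        (Eventually.of_forall fun p => hC _)
  have i6 : Integrable (fun p : (Fin n → ℝ) × ℝ => g p.1 * ψ (p.1 - p.2 • t • e))
      ((volume : Measure (Fin n → ℝ)).prod unitMeasure) :=
    (h.int'.comp_fst unitMeasure).mul_bdd (c := C)
      (g := fun p : (Fin n → ℝ) × ℝ => ψ (p.1 - p.2 • t • e))
      (h1.comp (by fun_prop)).aestronglyMeasurable (Eventually.of_forall fun p => hC _)
  calc ∫ x, (u (x + t • e) - u x) * ψ x
      = ∫ x, (t * ∫ s, g (x + s • t • e) ∂unitMeasure) * ψ x := by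
        refine integral_congr_ae ?_
        filter_upwards [h.ae_translate_sub t] with x hx
        rw [hx]
    _ = t * ∫ x, ∫ s, g (x + s • t • e) * ψ x ∂unitMeasure := by
        simp only [integral_mul_const, mul_assoc, integral_const_mul]
    _ = t * ∫ s, (∫ x, g (x + s • t • e) * ψ x) ∂unitMeasure := by
        rw [integral_integral_swap i5]
    _ = t * ∫ s, (∫ x, g x * ψ (x - s • t • e)) ∂unitMeasure := by
        congr 2
        ext s
        rw [← integral_add_right_eq_self (fun x => g x * ψ (x - s • t • e)) (s • t • e)]
        simp
    _ = _ := by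
        rw [integral_prod_symm _ i6]

/-- Averages of a continuous function over shrinking segments converge, tested against an
integrable function. -/
theorem _root_.tendsto_integral_shear {g ψ : (Fin n → ℝ) → ℝ} (hg : Integrable g)
    (h1 : Continuous ψ) (h2 : HasCompactSupport ψ) (e : Fin n → ℝ) :
    Tendsto (fun t : ℝ => ∫ p, g p.1 * ψ (p.1 - p.2 • t • e)
        ∂((volume : Measure (Fin n → ℝ)).prod unitMeasure)) (𝓝[≠] 0) (𝓝 (∫ x, g x * ψ x)) := by
  obtain ⟨C, hC⟩ := h2.exists_bound_of_continuous h1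
  have : ∫ x, g x * ψ x = ∫ p : (Fin n → ℝ) × ℝ, g p.1 * ψ p.1
      ∂((volume : Measure (Fin n → ℝ)).prod unitMeasure) := by
    rw [integral_prod _ ((integrable_mul_of_continuous hg h1 h2).comp_fst unitMeasure)]
    simp
  rw [this]
  refine (tendsto_integral_filter_of_dominated_convergence (fun p => ‖g p.1‖ * C)
    (Eventually.of_forall fun t => ?_) (Eventually.of_forall fun t => Eventually.of_forall ?_)
    ((hg.norm.comp_fst unitMeasure).mul_const C)
    (Eventually.of_forall fun p => ?_))
  · exact (hg.comp_fst unitMeasure).aestronglyMeasurable.mul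
      (h1.comp (by fun_prop)).aestronglyMeasurable
  · intro p
    rw [norm_mul]
    exact mul_le_mul_of_nonneg_left (hC _) (norm_nonneg _)
  · have hc : Continuous fun t : ℝ => g p.1 * ψ (p.1 - p.2 • t • e) :=
      continuous_const.mul (h1.comp (by fun_prop))
    have := hc.tendsto 0
    simp only [zero_smul, smul_zero, sub_zero] at this
    exact this.mono_left nhdsWithin_le_nhds

/-- Integration by parts for two continuous compactly supported weakly differentiable functions:
both sides are limits of the same difference quotient. -/
theorem integral_mul_symm (h : HasWeakPartial γ u g) (h' : HasWeakPartial γ v g')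
    (hu : Continuous u) (hus : HasCompactSupport u) (hv : Continuous v)
    (hvs : HasCompactSupport v) : ∫ x, g' x * u x = - ∫ x, g x * v x := by
  set e : Fin n → ℝ := Pi.single γ 1 with he
  have key (t : ℝ) (ht : t ≠ 0) :
      ∫ p, g' p.1 * u (p.1 - p.2 • t • e) ∂((volume : Measure (Fin n → ℝ)).prod unitMeasure) =
      - ∫ p, g p.1 * v (p.1 - p.2 • (-t) • e)
        ∂((volume : Measure (Fin n → ℝ)).prod unitMeasure) := by
    have a1 := h'.integral_translate_sub_mul t hu hus
    have a2 := h.integral_translate_sub_mul (-t) hv hvs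
    have a3 : ∫ x, (v (x + t • e) - v x) * u x = ∫ x, (u (x + -t • e) - u x) * v x := by
      have i1 : Integrable fun x => v (x + t • e) * u x :=
        integrable_mul_of_continuous (integrable_comp_add h'.int _) hu hus
      have i2 : Integrable fun x => v x * u x := integrable_mul_of_continuous h'.int hu hus
      have i3 : Integrable fun x => u (x + -t • e) * v x :=
        integrable_mul_of_continuous (integrable_comp_add h.int _) hv hvs
      have i4 : Integrable fun x => u x * v x := integrable_mul_of_continuous h.int hv hvs
      simp only [sub_mul]
      rw [integral_sub i1 i2, integral_sub i3 i4,
        ← integral_add_right_eq_self (fun x => u (x + -t • e) * v x) (t • e)]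
      simp [mul_comm]
    rw [a3, a2] at a1
    have := mul_left_cancel₀ ht (a1.symm.trans (by rw [neg_mul, ← mul_neg]))
    exact this
  have t1 := tendsto_integral_shear h'.int' hu hus e
  have t2 := (tendsto_integral_shear h.int' hv hvs e).comp (f := fun t : ℝ => -t)
    (x := 𝓝[≠] 0) (by
      refine tendsto_nhdsWithin_iff.2 ⟨?_, ?_⟩
      · have : Tendsto (fun t : ℝ => -t) (𝓝 0) (𝓝 (-0)) := tendsto_id.neg
        rw [neg_zero] at this
        exact this.mono_left nhdsWithin_le_nhds
      · filter_upwards [self_mem_nhdsWithin] with t ht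
        simpa using ht)
  refine tendsto_nhds_unique t1 (t2.neg.congr' ?_)
  filter_upwards [self_mem_nhdsWithin] with t ht
  exact (key t ht).symm

theorem mul (h : HasWeakPartial γ u g) (h' : HasWeakPartial γ v g')
    (hu : Continuous u) (hus : HasCompactSupport u) (hv : Continuous v)
    (hvs : HasCompactSupport v) :
    HasWeakPartial γ (fun x => u x * v x) (fun x => g x * v x + g' x * u x) where
  int := integrable_mul_of_continuous h.int hv hvs
  int' := (integrable_mul_of_continuous h.int' hv hvs).add
    (integrable_mul_of_continuous h'.int' hu hus)
  eq := by
    intro φ h1 h2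
    have := h.integral_mul_symm (h'.smooth_mul h1 h2) hu hus (hv.mul h1.continuous) h2.mul_left
    have i1 : Integrable fun x => g' x * u x * φ x :=
      integrable_mul_of_continuous (integrable_mul_of_continuous h'.int' hu hus) h1.continuous h2
    have i2 : Integrable fun x => u x * v x * fderiv ℝ φ x (Pi.single γ 1) :=
      integrable_mul_of_continuous (integrable_mul_of_continuous h.int hv hvs)
        (continuous_fderiv_apply h1 _) (hasCompactSupport_fderiv_apply h2 _)
    have i3 : Integrable fun x => g x * v x * φ x :=
      integrable_mul_of_continuous (integrable_mul_of_continuous h.int' hv hvs) h1.continuous h2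
    have e1 : ∀ x, (g' x * φ x + v x * fderiv ℝ φ x (Pi.single γ 1)) * u x =
      g' x * u x * φ x + u x * v x * fderiv ℝ φ x (Pi.single γ 1) := fun x => by ring
    simp only [e1, ← mul_assoc] at this
    rw [integral_add i1 i2] at this
    simp only [add_mul]
    rw [integral_add i3 i1]
    linarith

/-- In `L^r`, a translation difference is bounded by the step times the weak derivative. -/
theorem lintegral_translate_sub_le (h : HasWeakPartial γ u g) (t : ℝ) {r : ℝ} (hr : 1 ≤ r) :
    ∫⁻ x, ‖u (x + t • Pi.single γ 1) - u x‖ₑ ^ r ≤ ‖t‖ₑ ^ r * ∫⁻ x, ‖g x‖ₑ ^ r := by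
  set e : Fin n → ℝ := Pi.single γ 1 with he
  have hr0 : 0 < r := by linarith
  have hm : AEMeasurable (fun p : (Fin n → ℝ) × ℝ => ‖g (p.1 + p.2 • t • e)‖ₑ ^ r)
      ((volume : Measure (Fin n → ℝ)).prod unitMeasure) :=
    ((integrable_shear h.int' (t • e)).aestronglyMeasurable.enorm).pow_const r
  calc ∫⁻ x, ‖u (x + t • e) - u x‖ₑ ^ r
      ≤ ∫⁻ x, ‖t‖ₑ ^ r * ∫⁻ s, ‖g (x + s • t • e)‖ₑ ^ r ∂unitMeasure := by
        refine lintegral_mono_ae ?_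
        filter_upwards [h.ae_translate_sub t,
          (integrable_shear h.int' (t • e)).prod_right_ae] with x hx hi
        rw [hx, enorm_mul, ENNReal.mul_rpow_of_nonneg _ _ hr0.le]
        gcongr
        have j1 := eLpNorm_le_eLpNorm_of_exponent_le (p := 1) (q := ENNReal.ofReal r)
          (by simpa using hr) hi.aestronglyMeasurable
        rw [eLpNorm_one_eq_lintegral_enorm, eLpNorm_eq_lintegral_rpow_enorm_toReal
          (by simpa using hr0)
          (by simp), ENNReal.toReal_ofReal hr0.le] at j1
        have j2 := (enorm_integral_le_lintegral_enorm _).trans j1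
        have j3 := ENNReal.rpow_le_rpow j2 hr0.le
        rwa [← ENNReal.rpow_mul, one_div_mul_cancel hr0.ne', ENNReal.rpow_one] at j3
    _ = ‖t‖ₑ ^ r * ∫⁻ p, ‖g (p.1 + p.2 • t • e)‖ₑ ^ r
          ∂((volume : Measure (Fin n → ℝ)).prod unitMeasure) := by
        rw [lintegral_const_mul' _ _ (ENNReal.rpow_ne_top_of_nonneg hr0.le (by simp)),
          lintegral_prod _ hm]
    _ = _ := by
        congr 1
        have := lintegral_map' (μ := (volume : Measure (Fin n → ℝ)).prod unitMeasure)
          (f := fun x => ‖g x‖ₑ ^ r) (g := fun p => p.1 + p.2 • t • e)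
          (by rw [(measurePreserving_shear (t • e)).map_eq]
              exact h.int'.aestronglyMeasurable.enorm.pow_const r)
          (measurePreserving_shear (t • e)).measurable.aemeasurable
        rw [(measurePreserving_shear (t • e)).map_eq] at this
        exact this.symm

end HasWeakPartial

end Tools

/-! ### Localization of weak derivatives, and weak limits of difference quotients -/

section Local

variable {n : ℕ} {γ : Fin n} {Ω : Set (Fin n → ℝ)} {u v : (Fin n → ℝ) → ℝ}

theorem integrable_cutoff_mul (hu : LocallyIntegrableOn u Ω) {χ : (Fin n → ℝ) → ℝ}
    (hχ : Continuous χ) (hs : HasCompactSupport χ) (hΩ : tsupport χ ⊆ Ω) :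
    Integrable fun x => χ x * u x := by
  obtain ⟨C, hC⟩ := hs.exists_bound_of_continuous hχ
  refine IntegrableOn.integrable_of_forall_notMem_eq_zero (s := tsupport χ) ?_ ?_
  · exact (hu.integrableOn_compact_subset hΩ hs).bdd_mul hχ.aestronglyMeasurable
      (Eventually.of_forall hC)
  · intro x hx
    rw [image_eq_zero_of_notMem_tsupport hx, zero_mul]

/-- Multiplying by a cutoff function turns a weak partial derivative on `Ω` into one on the whole
space. -/
theorem IsWeakPartial.cutoff (h : IsWeakPartial Ω γ u v) {χ : (Fin n → ℝ) → ℝ}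
    (hχ : ContDiff ℝ ∞ χ) (hs : HasCompactSupport χ) (hΩ : tsupport χ ⊆ Ω) :
    HasWeakPartial γ (fun x => χ x * u x)
      (fun x => χ x * v x + fderiv ℝ χ x (Pi.single γ 1) * u x) := by
  have hs' := hasCompactSupport_fderiv_apply hs (Pi.single γ 1)
  have hc' := continuous_fderiv_apply hχ (Pi.single γ 1)
  have hΩ' : tsupport (fun x => fderiv ℝ χ x (Pi.single γ 1)) ⊆ Ω :=
    (tsupport_fderiv_apply_subset ℝ _).trans hΩ
  have i1 := integrable_cutoff_mul h.locInt hχ.continuous hs hΩ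
  have i2 := integrable_cutoff_mul h.locInt' hχ.continuous hs hΩ
  have i3 := integrable_cutoff_mul h.locInt hc' hs' hΩ'
  refine ⟨i1, i2.add i3, fun φ h1 h2 => ?_⟩
  have e1 := h.eq (fun x => χ x * φ x) (hχ.mul h1) h2.mul_left
    ((tsupport_mul_subset_left).trans hΩ)
  simp only [fderiv_mul_apply h1 hχ] at e1
  rw [setIntegral_eq_integral_of_forall_compl_eq_zero,
    setIntegral_eq_integral_of_forall_compl_eq_zero] at e1
  · have j1 := integrable_mul_of_continuous i1 (continuous_fderiv_apply h1 (Pi.single γ 1))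
      (hasCompactSupport_fderiv_apply h2 _)
    have j2 := integrable_mul_of_continuous i2 h1.continuous h2
    have j3 := integrable_mul_of_continuous i3 h1.continuous h2
    have e2 : ∀ x, u x * (χ x * fderiv ℝ φ x (Pi.single γ 1) +
        fderiv ℝ χ x (Pi.single γ 1) * φ x) = χ x * u x * fderiv ℝ φ x (Pi.single γ 1) +
        fderiv ℝ χ x (Pi.single γ 1) * u x * φ x := fun x => by ring
    have e3 : ∀ x, v x * (χ x * φ x) = χ x * v x * φ x := fun x => by ring
    simp only [e2, e3] at e1
    rw [integral_add j1 j3] at e1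
    simp only [add_mul]
    rw [integral_add j2 j3]
    linarith
  · intro x hx
    rw [image_eq_zero_of_notMem_tsupport (fun hx' => hx (hΩ hx')), zero_mul, mul_zero]
  · intro x hx
    have a1 : χ x = 0 := image_eq_zero_of_notMem_tsupport (fun hx' => hx (hΩ hx'))
    have a2 : fderiv ℝ χ x (Pi.single γ 1) = 0 :=
      image_eq_zero_of_notMem_tsupport (f := fun x => fderiv ℝ χ x (Pi.single γ 1))
        (fun hx' => hx (hΩ' hx'))
    rw [a1, a2]
    simp

theorem IsWeakPartial.ae_unique (hΩ : IsOpen Ω) {v' : (Fin n → ℝ) → ℝ}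
    (h : IsWeakPartial Ω γ u v) (h' : IsWeakPartial Ω γ u v') :
    v =ᵐ[volume.restrict Ω] v' := by
  have := hΩ.ae_eq_zero_of_integral_contDiff_smul_eq_zero (μ := volume)
    (h.locInt'.sub h'.locInt') ?_
  · rw [EventuallyEq, ae_restrict_iff' hΩ.measurableSet]
    filter_upwards [this] with x hx hxΩ
    simpa [sub_eq_zero] using hx hxΩ
  · intro φ h1 h2 h3
    have e := (h.eq φ h1 h2 h3).symm.trans (h'.eq φ h1 h2 h3)
    have a1 := integrable_cutoff_mul h.locInt' h1.continuous h2 h3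
    have a2 := integrable_cutoff_mul h'.locInt' h1.continuous h2 h3
    rw [setIntegral_eq_integral_of_forall_compl_eq_zero,
      setIntegral_eq_integral_of_forall_compl_eq_zero, neg_inj] at e
    · simp only [Pi.sub_apply, smul_eq_mul, mul_sub]
      rw [integral_sub a1 a2]
      simp only [mul_comm (φ _)]
      linarith
    all_goals
      intro x hx
      rw [image_eq_zero_of_notMem_tsupport (fun hx' => hx (h3 hx')), mul_zero]

theorem IsWeakPartial.mono {Ω' : Set (Fin n → ℝ)} (h : IsWeakPartial Ω γ u v) (hs : Ω' ⊆ Ω) :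
    IsWeakPartial Ω' γ u v where
  locInt := h.locInt.mono_set hs
  locInt' := h.locInt'.mono_set hs
  eq := by
    intro φ h1 h2 h3
    have := h.eq φ h1 h2 (h3.trans hs)
    have z1 : ∀ x ∉ tsupport φ, u x * fderiv ℝ φ x (Pi.single γ 1) = 0 := fun x hx => by
      have : fderiv ℝ φ x = 0 :=
        image_eq_zero_of_notMem_tsupport (fun hx' => hx (tsupport_fderiv_subset ℝ hx'))
      simp [this]
    have z2 : ∀ x ∉ tsupport φ, v x * φ x = 0 := fun x hx => by
      rw [image_eq_zero_of_notMem_tsupport hx, mul_zero]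
    rw [setIntegral_eq_integral_of_forall_compl_eq_zero
        (fun x hx => z1 x fun h' => hx (hs (h3 h'))),
      setIntegral_eq_integral_of_forall_compl_eq_zero
        (fun x hx => z2 x fun h' => hx (hs (h3 h')))] at this
    rwa [setIntegral_eq_integral_of_forall_compl_eq_zero (fun x hx => z1 x fun h' => hx (h3 h')),
      setIntegral_eq_integral_of_forall_compl_eq_zero (fun x hx => z2 x fun h' => hx (h3 h'))]

/-- Difference quotients of an integrable function converge weakly, against test functions, to
minus the distributional pairing with the derivative of the test function. -/
theorem tendsto_integral_difference_quotient (hu : Integrable u) {φ : (Fin n → ℝ) → ℝ}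
    (h1 : ContDiff ℝ ∞ φ) (h2 : HasCompactSupport φ) (e : Fin n → ℝ) :
    Tendsto (fun t : ℝ => ∫ x, t⁻¹ * (u (x + t • e) - u x) * φ x) (𝓝[≠] 0)
      (𝓝 (- ∫ x, u x * fderiv ℝ φ x e)) := by
  have key (t : ℝ) : ∫ x, t⁻¹ * (u (x + t • e) - u x) * φ x =
      ∫ x, u x * (t⁻¹ * (φ (x + t • -e) - φ x)) := by
    have i1 : Integrable fun x => u (x + t • e) * φ x :=
      integrable_mul_of_continuous (integrable_comp_add hu _) h1.continuous h2
    have i2 : Integrable fun x => u x * φ x := integrable_mul_of_continuous hu h1.continuous h2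
    have i3 : Integrable fun x => u x * φ (x + t • -e) :=
      integrable_mul_of_continuous hu (h1.continuous.comp (continuous_add_const _))
        (hasCompactSupport_comp_add h2 _)
    have e1 : ∀ x, t⁻¹ * (u (x + t • e) - u x) * φ x =
      t⁻¹ * (u (x + t • e) * φ x - u x * φ x) := fun x => by ring
    have e2 : ∀ x, u x * (t⁻¹ * (φ (x + t • -e) - φ x)) =
      t⁻¹ * (u x * φ (x + t • -e) - u x * φ x) := fun x => by ring
    simp only [e1, e2, integral_const_mul]
    rw [integral_sub i1 i2, integral_sub i3 i2,
      ← integral_add_right_eq_self (fun x => u x * φ (x + t • -e)) (t • e)]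
    simp
  simp only [key]
  rw [← integral_neg]
  obtain ⟨C, hC⟩ := h1.lipschitzWith_of_hasCompactSupport h2 (by simp)
  refine tendsto_integral_filter_of_dominated_convergence (fun x => ‖u x‖ * (C * ‖e‖))
    (Eventually.of_forall fun t => ?_) ?_ (hu.norm.mul_const _) (Eventually.of_forall fun x => ?_)
  · refine hu.aestronglyMeasurable.mul (Continuous.aestronglyMeasurable ?_)
    exact continuous_const.mul ((h1.continuous.comp (continuous_add_const _)).sub h1.continuous)
  · filter_upwards [self_mem_nhdsWithin] with t ht
    refine Eventually.of_forall fun x => ?_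
    rw [norm_mul]
    gcongr
    have := hC.dist_le_mul (x + t • -e) x
    rw [dist_eq_norm, dist_eq_norm, add_sub_cancel_left, norm_smul, norm_neg] at this
    rw [norm_mul, norm_inv]
    have ht' : 0 < ‖t‖ := norm_pos_iff.2 ht
    rw [inv_mul_le_iff₀ ht']
    linarith
  · have hd : HasDerivAt (fun t : ℝ => φ (x + t • -e)) (fderiv ℝ φ x (-e)) 0 := by
      have hd1 : HasDerivAt (fun s : ℝ => x + s • -e) (-e) 0 := by
        simpa using ((hasDerivAt_id (0 : ℝ)).smul_const (-e)).const_add x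
      have h3 : HasFDerivAt φ (fderiv ℝ φ x) (x + (0 : ℝ) • -e) := by
        simpa using ((h1.differentiable (by simp)) x).hasFDerivAt
      exact h3.comp_hasDerivAt (0 : ℝ) hd1
    have := (hasDerivAt_iff_tendsto_slope.1 hd).const_mul (u x)
    simp only [map_neg, mul_neg] at this
    refine this.congr fun t => ?_
    simp only [slope_def_field, zero_smul, add_zero, sub_zero, div_eq_inv_mul]

/-- A function whose difference quotients are bounded in `L²(Ω')` has a weak derivative in
`L²(Ω')`: a weak limit of the difference quotients. -/
theorem exists_isWeakPartial_of_difference_quotient_bounded {Ω' : Set (Fin n → ℝ)}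
    (hΩ' : IsOpen Ω') (hu : Integrable u) (hu2 : MemLp u 2) {C : ℝ≥0∞} (hC : C ≠ ⊤) {h₀ : ℝ}
    (h₀0 : 0 < h₀)
    (hb : ∀ t ∈ Ioo 0 h₀, ∫⁻ x in Ω', ‖t⁻¹ * (u (x + t • Pi.single γ 1) - u x)‖ₑ ^ (2 : ℝ) ≤ C) :
    ∃ v, IsWeakPartial Ω' γ u v ∧ MemLp v 2 (volume.restrict Ω') := by
  set e : Fin n → ℝ := Pi.single γ 1 with he
  set w : ℝ → (Fin n → ℝ) → ℝ := fun t x => t⁻¹ * (u (x + t • e) - u x) with hw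
  have hwm (t : ℝ) : MemLp (w t) 2 (volume.restrict Ω') := by
    refine MemLp.restrict Ω' ?_
    refine ((hu2.comp_measurePreserving (measurePreserving_add_right volume (t • e))).sub
      hu2).const_mul t⁻¹
  set H := Lp ℝ 2 (volume.restrict Ω')
  set W : ℝ → H := fun t => (hwm t).toLp (w t) with hW
  set f : ℝ → WeakDual ℝ H :=
    fun t => StrongDual.toWeakDual (InnerProductSpace.toDual ℝ H (W t)) with hf
  -- By Banach-Alaoglu the difference quotients converge weakly along an ultrafilter of steps.
  set U : Ultrafilter ℝ := Ultrafilter.of (𝓝[>] 0) with hU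
  have hU' : (U : Filter ℝ) ≤ 𝓝[>] 0 := Ultrafilter.of_le _
  have hmem : ∀ᶠ t in U, f t ∈ WeakDual.toStrongDual ⁻¹'
      Metric.closedBall (0 : StrongDual ℝ H) (C ^ (1 / (2 : ℝ))).toReal := by
    have : Ioo (0 : ℝ) h₀ ∈ (U : Filter ℝ) := hU' (Ioo_mem_nhdsGT h₀0)
    filter_upwards [this] with t ht
    rw [mem_preimage, mem_closedBall_zero_iff]
    change ‖InnerProductSpace.toDual ℝ H (W t)‖ ≤ _
    rw [LinearIsometryEquiv.norm_map, hW, Lp.norm_toLp]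
    refine ENNReal.toReal_mono (ENNReal.rpow_ne_top_of_nonneg (by norm_num) hC) ?_
    rw [eLpNorm_eq_lintegral_rpow_enorm_toReal (by simp) (by simp)]
    simp only [ENNReal.toReal_ofNat]
    gcongr
    exact hb t ht
  obtain ⟨ℓ, -, hℓ⟩ := (WeakDual.isCompact_closedBall (𝕜 := ℝ)
    (0 : StrongDual ℝ H) _).ultrafilter_le_nhds' (U.map f) hmem
  set v : H := (InnerProductSpace.toDual ℝ H).symm (WeakDual.toStrongDual ℓ) with hv
  have hvm : MemLp v 2 (volume.restrict Ω') := Lp.memLp v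
  refine ⟨v, ⟨hu.locallyIntegrable.locallyIntegrableOn Ω', ?_, fun φ h1 h2 h3 => ?_⟩, hvm⟩
  · refine (locallyIntegrableOn_iff hΩ'.isLocallyClosed).2 fun K hK hKc => ?_
    have hvK : MemLp v 2 (volume.restrict K) := hvm.mono_measure (Measure.restrict_mono hK le_rfl)
    have : IsFiniteMeasure (volume.restrict K) := ⟨by simpa using hKc.measure_lt_top⟩
    exact hvK.integrable (by norm_num)
  · have hφm : MemLp φ 2 (volume.restrict Ω') :=
      (h1.continuous.memLp_of_hasCompactSupport h2).restrict Ω'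
    set Φ : H := hφm.toLp φ
    have hpair (g : (Fin n → ℝ) → ℝ) (G : H) (hG : G =ᵐ[volume.restrict Ω'] g) :
        inner ℝ G Φ = ∫ x in Ω', g x * φ x := by
      rw [L2.inner_def]
      refine integral_congr_ae ?_
      filter_upwards [hG, hφm.coeFn_toLp] with x hx hx'
      rw [hx, hx']
      simp [mul_comm]
    have hset (g : (Fin n → ℝ) → ℝ) : ∫ x in Ω', g x * φ x = ∫ x, g x * φ x := by
      refine setIntegral_eq_integral_of_forall_compl_eq_zero fun x hx => ?_
      rw [image_eq_zero_of_notMem_tsupport (fun hx' => hx (h3 hx')), mul_zero]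
    have t1 : Tendsto (fun t => f t Φ) U (𝓝 (ℓ Φ)) :=
      ((WeakDual.eval_continuous Φ).tendsto ℓ).comp hℓ
    have t2 : Tendsto (fun t => f t Φ) U (𝓝 (- ∫ x, u x * fderiv ℝ φ x e)) := by
      have := (tendsto_integral_difference_quotient hu h1 h2 e).mono_left
        (nhdsGT_le_nhdsNE (0 : ℝ))
      refine (this.mono_left hU').congr fun t => ?_
      have e1 : f t Φ = inner ℝ (W t) Φ := rfl
      rw [e1, hpair (w t) (W t) (hwm t).coeFn_toLp, hset]
    have e2 : ℓ Φ = inner ℝ v Φ := by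
      rw [hv, InnerProductSpace.toDual_symm_apply]
      rfl
    rw [e2, hpair v v (by rfl)] at t1
    have e3 := tendsto_nhds_unique t1 t2
    rw [e3, neg_neg]
    refine setIntegral_eq_integral_of_forall_compl_eq_zero fun x hx => ?_
    have : fderiv ℝ φ x = 0 :=
      image_eq_zero_of_notMem_tsupport (fun hx' => hx (h3 (tsupport_fderiv_subset ℝ hx')))
    simp [this]

end Local

/-! ### Pointwise estimates for the coefficients -/

section Contractions

variable {F : Type*} [NormedAddCommGroup F] [NormedSpace ℝ F]

theorem norm_sum_smul_le {m : ℕ} (D : Fin m → ℝ) (c : Fin m → F) :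
    ‖∑ j, D j • c j‖ ≤ m * (‖D‖ * ‖c‖) := by
  calc ‖∑ j, D j • c j‖ ≤ ∑ _j : Fin m, ‖D‖ * ‖c‖ := by
        refine norm_sum_le_of_le _ fun j _ => ?_
        rw [norm_smul]
        exact mul_le_mul (norm_le_pi_norm D j) (norm_le_pi_norm c j) (norm_nonneg _) (norm_nonneg _)
    _ = _ := by simp

theorem norm_sum_sum_smul_le {m n : ℕ} (D : Fin m → Fin n → ℝ) (c : Fin m → Fin n → F) :
    ‖∑ j, ∑ β, D j β • c j β‖ ≤ (m * n) * (‖D‖ * ‖c‖) := by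
  calc ‖∑ j, ∑ β, D j β • c j β‖ ≤ ∑ _j : Fin m, n * (‖D‖ * ‖c‖) := by
        refine norm_sum_le_of_le _ fun j _ => (norm_sum_smul_le _ _).trans ?_
        gcongr
        · exact norm_le_pi_norm D j
        · exact norm_le_pi_norm c j
    _ = _ := by simp; ring

theorem abs_sum_mul_le {m : ℕ} (D c : Fin m → ℝ) : |∑ j, D j * c j| ≤ m * (‖D‖ * ‖c‖) :=
  norm_sum_smul_le D c

theorem abs_sum_sum_mul_le {m n : ℕ} (D c : Fin m → Fin n → ℝ) :
    |∑ j, ∑ β, D j β * c j β| ≤ (m * n) * (‖D‖ * ‖c‖) :=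
  norm_sum_sum_smul_le D c

end Contractions

section Derivative

variable {n : ℕ} {m : Fin 2 → ℕ} {F : Fin 2 → Type}
  [∀ a, NormedAddCommGroup (F a)] [∀ a, NormedSpace ℝ (F a)]

theorem zVar_eq_sum (D : ZVar m) :
    D = ∑ b, ∑ j, D b j • (Pi.single b (Pi.single j 1) : ZVar m) := by
  ext a i
  simp only [Finset.sum_apply, Pi.smul_apply, smul_eq_mul]
  rw [Finset.sum_eq_single a]
  · simp [Pi.single_apply]
  · intro b _ hb
    simp [Pi.single_eq_of_ne hb.symm]
  · simp

theorem pVar_eq_sum (P : PVar n m) : P =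
    ∑ b, ∑ j, ∑ β, P b j β • (Pi.single b (Pi.single j (Pi.single β 1)) : PVar n m) := by
  ext a i α
  simp only [Finset.sum_apply, Pi.smul_apply, smul_eq_mul]
  rw [Finset.sum_eq_single a]
  · rw [Finset.sum_eq_single i]
    · simp [Pi.single_apply]
    · intro j _ hj
      simp [Pi.single_eq_of_ne hj.symm]
    · simp
  · intro b _ hb
    simp [Pi.single_eq_of_ne hb.symm]
  · simp

/-- The derivative of a coefficient in the direction `(ξ, D, P)`, in terms of its blocks of partial
derivatives. -/
theorem fderiv_coeff_apply (c : CoeffArg n m → (a : Fin 2) → F a) (y : CoeffArg n m)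
    (ξ : Fin n → ℝ) (D : ZVar m) (P : PVar n m) (a : Fin 2) :
    fderiv ℝ c y (ξ, D, P) a = fderiv ℝ c y (ξ, 0, 0) a + ∑ b, ∑ j, D b j • dz c y a b j +
      ∑ b, ∑ j, ∑ β, P b j β • dp c y a b j β := by
  have e1 : (ξ, D, P) = ((ξ, 0, 0) : CoeffArg n m) +
      ContinuousLinearMap.inr ℝ (Fin n → ℝ) (ZVar m × PVar n m)
        (ContinuousLinearMap.inl ℝ (ZVar m) (PVar n m) D) +
      ContinuousLinearMap.inr ℝ (Fin n → ℝ) (ZVar m × PVar n m)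
        (ContinuousLinearMap.inr ℝ (ZVar m) (PVar n m) P) := by
    simp
  rw [e1]
  conv_lhs => rw [zVar_eq_sum D, pVar_eq_sum P]
  simp only [map_add, map_sum, map_smul, Pi.add_apply, Finset.sum_apply, Pi.smul_apply]
  rfl

end Derivative

/-! ### Weights -/

section Weights

/-- The weight `(1 + |p|²)^{1/2}`. -/
noncomputable def wt {F : Type*} [NormedAddCommGroup F] (p : F) : ℝ := Real.sqrt (1 + ‖p‖ ^ 2)

variable {F : Type*} [NormedAddCommGroup F]

theorem one_le_wt (p : F) : 1 ≤ wt p := by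
  rw [wt, Real.one_le_sqrt]
  nlinarith [sq_nonneg ‖p‖]

theorem wt_pos (p : F) : 0 < wt p := zero_lt_one.trans_le (one_le_wt p)

theorem wt_sq (p : F) : wt p ^ 2 = 1 + ‖p‖ ^ 2 := Real.sq_sqrt (by positivity)

theorem norm_le_wt (p : F) : ‖p‖ ≤ wt p :=
  Real.le_sqrt_of_sq_le (by linarith)

theorem wt_mono {G : Type*} [NormedAddCommGroup G] {p : F} {p' : G} (h : ‖p‖ ≤ ‖p'‖) :
    wt p ≤ wt p' := by
  unfold wt
  gcongr

theorem wt_le_one_add (p : F) : wt p ≤ 1 + ‖p‖ := by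
  rw [wt, Real.sqrt_le_left (by positivity)]
  nlinarith [norm_nonneg p]

theorem continuous_wt : Continuous (wt : F → ℝ) := by
  unfold wt
  fun_prop

variable [NormedSpace ℝ F]

theorem wt_segment_le (p p' : F) {t : ℝ} (ht : t ∈ Icc (0 : ℝ) 1) :
    wt (p + t • (p' - p)) ≤ max (wt p) (wt p') := by
  have h : ‖p + t • (p' - p)‖ ≤ max ‖p‖ ‖p'‖ := by
    have e : p + t • (p' - p) = (1 - t) • p + t • p' := by
      rw [smul_sub, sub_smul, one_smul]; abel
    rw [e]
    calc ‖(1 - t) • p + t • p'‖ ≤ (1 - t) * ‖p‖ + t * ‖p'‖ := by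
          refine (norm_add_le _ _).trans_eq ?_
          rw [norm_smul, norm_smul, Real.norm_of_nonneg ht.1,
            Real.norm_of_nonneg (by linarith [ht.2])]
      _ ≤ (1 - t) * max ‖p‖ ‖p'‖ + t * max ‖p‖ ‖p'‖ := by
          have := ht.1
          have := ht.2
          gcongr
          · exact le_max_left _ _
          · exact le_max_right _ _
      _ = _ := by ring
  rcases le_total ‖p‖ ‖p'‖ with h1 | h1
  · exact (wt_mono (h.trans_eq (max_eq_right h1))).trans (le_max_right _ _)
  · exact (wt_mono (h.trans_eq (max_eq_left h1))).trans (le_max_left _ _)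

theorem half_wt_le_segment (p p' : F) (h : ‖p'‖ ≤ ‖p‖) {t : ℝ} (h0 : 0 ≤ t) (h1 : t ≤ 1 / 4) :
    1 / 2 * wt p ≤ wt (p + t • (p' - p)) := by
  have e : ‖p‖ ≤ ‖p + t • (p' - p)‖ + t * (‖p'‖ + ‖p‖) := by
    calc ‖p‖ = ‖(p + t • (p' - p)) - t • (p' - p)‖ := by simp
      _ ≤ ‖p + t • (p' - p)‖ + ‖t • (p' - p)‖ := norm_sub_le _ _
      _ ≤ _ := by
        rw [norm_smul, Real.norm_of_nonneg h0]
        gcongr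
        exact norm_sub_le _ _
  have e2 : 1 / 2 * ‖p‖ ≤ ‖p + t • (p' - p)‖ := by
    nlinarith [norm_nonneg p, norm_nonneg p']
  rw [wt, wt]
  apply Real.le_sqrt_of_sq_le
  rw [mul_pow, Real.sq_sqrt (by positivity)]
  have := mul_self_le_mul_self (by positivity) e2
  nlinarith

/-- The average of `V^s` over a segment is comparable to its maximum at the end points. -/
theorem le_integral_wt_rpow (p p' : F) {s : ℝ} (hs : 0 ≤ s) :
    1 / 4 * (1 / 2) ^ s * max (wt p) (wt p') ^ s ≤
      ∫ t, wt (p + t • (p' - p)) ^ s ∂unitMeasure := by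
  have hcont (p p' : F) : Continuous fun t : ℝ => wt (p + t • (p' - p)) ^ s :=
    (continuous_wt.comp (by fun_prop)).rpow_const fun _ => Or.inr hs
  have key (p p' : F) (h : ‖p'‖ ≤ ‖p‖) : 1 / 4 * (1 / 2) ^ s * wt p ^ s ≤
      ∫ t in (0 : ℝ)..1, wt (p + t • (p' - p)) ^ s := by
    calc 1 / 4 * (1 / 2) ^ s * wt p ^ s = ∫ _t in (0 : ℝ)..1 / 4, (1 / 2 * wt p) ^ s := by
          rw [intervalIntegral.integral_const, Real.mul_rpow (by norm_num) (wt_pos p).le]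
          simp only [smul_eq_mul]
          ring
      _ ≤ ∫ t in (0 : ℝ)..1 / 4, wt (p + t • (p' - p)) ^ s := by
          refine intervalIntegral.integral_mono_on (by norm_num) (by simp)
            ((hcont p p').intervalIntegrable _ _) fun t ht => ?_
          have := wt_pos p
          exact Real.rpow_le_rpow (by positivity) (half_wt_le_segment p p' h ht.1 ht.2) hs
      _ ≤ _ := by
          refine intervalIntegral.integral_mono_interval le_rfl (by norm_num) (by norm_num)
            (Eventually.of_forall fun t => ?_) ((hcont p p').intervalIntegrable _ _)
          exact Real.rpow_nonneg (wt_pos _).le _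
  rw [integral_unitMeasure]
  rcases le_total ‖p'‖ ‖p‖ with h | h
  · rw [max_eq_left (wt_mono h)]
    exact key p p' h
  · rw [max_eq_right (wt_mono h)]
    refine (key p' p h).trans_eq ?_
    have := intervalIntegral.integral_comp_sub_left (a := 0) (b := 1)
      (fun t : ℝ => wt (p + t • (p' - p)) ^ s) 1
    simp only [sub_self, sub_zero] at this
    rw [← this]
    congr 1
    ext t
    congr 2
    rw [sub_smul, one_smul, smul_sub, smul_sub]
    abel

end Weights

section Young

theorem mul_le_young {δ : ℝ} (hδ : 0 < δ) (K x y : ℝ) :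
    K * x * y ≤ δ * x ^ 2 + K ^ 2 / δ * y ^ 2 := by
  have h : 0 ≤ (δ * x - K * y) ^ 2 / δ := by positivity
  have e : (δ * x - K * y) ^ 2 / δ = δ * x ^ 2 - 2 * (K * x * y) + K ^ 2 / δ * y ^ 2 := by
    field_simp
    ring
  have h2 : 0 ≤ δ * x ^ 2 + K ^ 2 / δ * y ^ 2 := by positivity
  rw [e] at h
  linarith

/-- Young's inequality for all the terms of the differentiated system other than the elliptic one.
Here `s` is the value of the cutoff function, `M` bounds its gradient, `W` and `A = W^{k-2}` are the
weights, `d` and `e` the sizes of the difference quotients of `z` and `∇z`. The coefficient of the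
critical term `s² A W² d²` does not involve `M`. -/
theorem lower_order_le {ε K M s A₀ A₁ W₀ W₁ d₀ d₁ e₀ e₁ : ℝ} (hε : 0 < ε) (hK : 0 < K)
    (hs0 : 0 ≤ s) (hs1 : s ≤ 1) (hA₀ : 0 ≤ A₀) (hA₁ : 0 ≤ A₁) (hW₀ : 1 ≤ W₀)
    (hW₁ : 1 ≤ W₁) :
    s ^ 2 * (K * (e₀ * (A₀ * W₀ + d₀ * (A₀ * W₀))) +
        K * (e₁ * (A₁ * W₁ + d₀ * A₁ + d₁ * (A₁ * W₁)))) +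
      s * (2 * M * K * (d₀ * (A₀ * W₀ + d₀ * (A₀ * W₀) + e₀ * A₀)) +
        2 * M * K * (d₁ * (A₁ * W₁ + d₀ * A₁ + d₁ * (A₁ * W₁) + e₁ * A₁))) +
      s ^ 2 * (K * (d₀ * (A₀ * W₀ ^ 2 + A₁ * W₁ + e₀ * (A₀ * W₀) + e₁ * A₁)) +
        K * (d₁ * (A₁ * W₁ ^ 2 + e₁ * (A₁ * W₁)))) +
      s ^ 2 * (K * (A₀ * W₀ ^ 2 * d₀ ^ 2 + A₁ * W₁ ^ 2 * d₁ ^ 2 + A₁ * W₁ * d₀ ^ 2)) ≤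
    6 * ε * (s ^ 2 * A₀ * e₀ ^ 2 + s ^ 2 * A₁ * e₁ ^ 2) +
      (2 * K ^ 2 / ε + 4 * K) * (s ^ 2 * A₀ * W₀ ^ 2 * d₀ ^ 2 + s ^ 2 * A₁ * W₁ ^ 2 * d₁ ^ 2) +
      20 * ((K + K ^ 2 / ε) * (1 + 4 * M ^ 2)) *
        (A₀ * W₀ ^ 2 + A₁ * W₁ ^ 2 + A₀ * d₀ ^ 2 + A₁ * d₁ ^ 2 + A₁ * W₁ * d₀ ^ 2) := by
  have hs2 : s ^ 2 ≤ 1 := by nlinarith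
  set L := K ^ 2 / ε with hL
  have hL0 : 0 ≤ L := by positivity
  set c := (K + L) * (1 + 4 * M ^ 2) with hc
  have hcK : K ≤ c := by rw [hc]; nlinarith [mul_nonneg (add_nonneg hK.le hL0) (sq_nonneg M)]
  have hcL : L ≤ c := by rw [hc]; nlinarith [mul_nonneg (add_nonneg hK.le hL0) (sq_nonneg M)]
  have hcM : 4 * M ^ 2 * L ≤ c := by rw [hc]; nlinarith [mul_nonneg hK.le (sq_nonneg M)]
  have hcM2 : K * M ^ 2 ≤ c := by
    rw [hc]; nlinarith [mul_nonneg hK.le (sq_nonneg M), mul_nonneg hL0 (sq_nonneg M)]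
  have hc0 : 0 ≤ c := hK.le.trans hcK
  -- The densities of the lower order term; `A₁ d₀²` is bounded by the last one as `1 ≤ W₁`.
  set B₁ := A₀ * W₀ ^ 2
  set B₂ := A₁ * W₁ ^ 2
  set B₃ := A₀ * d₀ ^ 2
  set B₄ := A₁ * d₁ ^ 2
  set B₅ := A₁ * W₁ * d₀ ^ 2
  have hB₁ : 0 ≤ B₁ := by positivity
  have hB₂ : 0 ≤ B₂ := by positivity
  have hB₃ : 0 ≤ B₃ := by positivity
  have hB₄ : 0 ≤ B₄ := by positivity
  have hB₅ : 0 ≤ B₅ := by positivity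
  have hB₅' : A₁ * d₀ ^ 2 ≤ B₅ := by
    have := mul_le_mul_of_nonneg_left hW₁ (by positivity : 0 ≤ A₁ * d₀ ^ 2)
    calc A₁ * d₀ ^ 2 = A₁ * d₀ ^ 2 * 1 := (mul_one _).symm
      _ ≤ A₁ * d₀ ^ 2 * W₁ := this
      _ = B₅ := by ring
  have hsB {x : ℝ} (hx : 0 ≤ x) : s ^ 2 * x ≤ x := mul_le_of_le_one_left hx hs2
  -- Young's inequality for a term with the factor `e`.
  have young {A : ℝ} (hA : 0 ≤ A) (x y : ℝ) :
      A * (K * x * y) ≤ ε * (A * x ^ 2) + L * (A * y ^ 2) := by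
    have := mul_le_mul_of_nonneg_left (mul_le_young hε K x y) hA
    linarith
  have young' {A : ℝ} (hA : 0 ≤ A) (x y : ℝ) :
      A * (2 * K * x * y) ≤ K * (A * x ^ 2) + K * (A * y ^ 2) := by
    nlinarith [mul_nonneg (mul_nonneg hA hK.le) (sq_nonneg (x - y))]
  have b1 : L * (s ^ 2 * B₁) ≤ c * B₁ := mul_le_mul hcL (hsB hB₁) (by positivity) hc0
  have b2 : L * (s ^ 2 * B₂) ≤ c * B₂ := mul_le_mul hcL (hsB hB₂) (by positivity) hc0
  have b3 : L * (s ^ 2 * (A₁ * d₀ ^ 2)) ≤ c * B₅ :=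
    mul_le_mul hcL ((hsB (by positivity)).trans hB₅') (by positivity) hc0
  have b4 : 4 * M ^ 2 * L * B₃ ≤ c * B₃ := mul_le_mul_of_nonneg_right hcM hB₃
  have b5 : 4 * M ^ 2 * L * B₄ ≤ c * B₄ := mul_le_mul_of_nonneg_right hcM hB₄
  have b6 : K * M ^ 2 * B₃ ≤ c * B₃ := mul_le_mul_of_nonneg_right hcM2 hB₃
  have b7 : K * M ^ 2 * B₄ ≤ c * B₄ := mul_le_mul_of_nonneg_right hcM2 hB₄
  have b8 : K * (s ^ 2 * B₁) ≤ c * B₁ := mul_le_mul hcK (hsB hB₁) (by positivity) hc0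
  have b9 : K * (s ^ 2 * B₂) ≤ c * B₂ := mul_le_mul hcK (hsB hB₂) (by positivity) hc0
  have b10 : K * (s ^ 2 * (A₁ * d₀ ^ 2)) ≤ c * B₅ :=
    mul_le_mul hcK ((hsB (by positivity)).trans hB₅') (by positivity) hc0
  have b11 : K * (s ^ 2 * B₅) ≤ c * B₅ := mul_le_mul hcK (hsB hB₅) (by positivity) hc0
  have t1 := young hA₀ (s * e₀) (s * W₀)
  have t2 := young hA₀ (s * e₀) (s * d₀ * W₀)
  have t3 := young hA₁ (s * e₁) (s * W₁)
  have t4 := young hA₁ (s * e₁) (s * d₀)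
  have t5 := young hA₁ (s * e₁) (s * d₁ * W₁)
  have t6 := young' hA₀ (M * d₀) (s * W₀)
  have t7 := young' hA₀ (M * d₀) (s * d₀ * W₀)
  have t8 := young hA₀ (s * e₀) (2 * M * d₀)
  have t9 := young' hA₁ (M * d₁) (s * W₁)
  have t10 := young' hA₁ (M * d₁) (s * d₀)
  have t11 := young' hA₁ (M * d₁) (s * d₁ * W₁)
  have t12 := young hA₁ (s * e₁) (2 * M * d₁)
  have t13 := young' hA₀ (s * d₀ * W₀) (s * W₀)
  have t14 := young' hA₁ (s * d₀) (s * W₁)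
  have t15 := young' hA₁ (s * d₁ * W₁) (s * W₁)
  have p1 : 0 ≤ ε * (A₀ * (s * e₀) ^ 2) := by positivity
  have p2 : 0 ≤ K * (s ^ 2 * A₀ * W₀ ^ 2 * d₀ ^ 2) := by positivity
  have p3 : 0 ≤ K * (s ^ 2 * A₁ * W₁ ^ 2 * d₁ ^ 2) := by positivity
  have p4 : 0 ≤ L * (s ^ 2 * A₀ * W₀ ^ 2 * d₀ ^ 2) := by positivity
  have p5 : 0 ≤ L * (s ^ 2 * A₁ * W₁ ^ 2 * d₁ ^ 2) := by positivity
  have n1 := mul_nonneg hc0 hB₁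
  have n2 := mul_nonneg hc0 hB₂
  have n3 := mul_nonneg hc0 hB₃
  have n4 := mul_nonneg hc0 hB₄
  have n5 := mul_nonneg hc0 hB₅
  have r13 : 0 ≤ K * (A₀ * ((s * d₀ * W₀) ^ 2 + (s * W₀) ^ 2)) := by positivity
  have r14 : 0 ≤ K * (A₁ * ((s * d₀) ^ 2 + (s * W₁) ^ 2)) := by positivity
  have r15 : 0 ≤ K * (A₁ * ((s * d₁ * W₁) ^ 2 + (s * W₁) ^ 2)) := by positivity
  have hdiv : 2 * K ^ 2 / ε = 2 * L := by rw [hL]; ring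
  rw [hdiv]
  linarith

end Young

/-! ### The integrand of the weak formulation -/

section Pairing

/-- The dot product of two arrays. -/
def dot2 {m n : ℕ} (x y : Fin m → Fin n → ℝ) : ℝ := ∑ i, ∑ α, x i α * y i α

/-- The dot product of two vectors. -/
def dot1 {m : ℕ} (x y : Fin m → ℝ) : ℝ := ∑ i, x i * y i

section dot

variable {m n : ℕ}

theorem dot2_add (x y y' : Fin m → Fin n → ℝ) : dot2 x (y + y') = dot2 x y + dot2 x y' := by
  simp [dot2, mul_add, Finset.sum_add_distrib]

theorem add_dot2 (x x' y : Fin m → Fin n → ℝ) : dot2 (x + x') y = dot2 x y + dot2 x' y := by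
  simp [dot2, add_mul, Finset.sum_add_distrib]

theorem smul_dot2 (c : ℝ) (x y : Fin m → Fin n → ℝ) : dot2 (c • x) y = c * dot2 x y := by
  simp [dot2, mul_assoc, Finset.mul_sum]

theorem dot2_smul (c : ℝ) (x y : Fin m → Fin n → ℝ) : dot2 x (c • y) = c * dot2 x y := by
  simp only [dot2, Finset.mul_sum, Pi.smul_apply, smul_eq_mul]
  exact Finset.sum_congr rfl fun i _ => Finset.sum_congr rfl fun α _ => by ring

theorem dot1_add (x y y' : Fin m → ℝ) : dot1 x (y + y') = dot1 x y + dot1 x y' := by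
  simp [dot1, mul_add, Finset.sum_add_distrib]

theorem smul_dot1 (c : ℝ) (x y : Fin m → ℝ) : dot1 (c • x) y = c * dot1 x y := by
  simp [dot1, mul_assoc, Finset.mul_sum]

theorem dot1_smul (c : ℝ) (x y : Fin m → ℝ) : dot1 x (c • y) = c * dot1 x y := by
  simp only [dot1, Finset.mul_sum, Pi.smul_apply, smul_eq_mul]
  exact Finset.sum_congr rfl fun i _ => by ring

end dot

variable {n : ℕ} {m : Fin 2 → ℕ}

/-- A constant bounding all the dimensions that occur in contractions of arrays. -/
def dimConst (n : ℕ) (m : Fin 2 → ℕ) : ℝ := (1 + n) * (1 + m 0) * (1 + m 1)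

theorem one_le_dimConst : 1 ≤ dimConst n m := by
  unfold dimConst
  have h1 : (0 : ℝ) ≤ n := by positivity
  have h2 : (0 : ℝ) ≤ m 0 := by positivity
  have h3 : (0 : ℝ) ≤ m 1 := by positivity
  exact one_le_mul_of_one_le_of_one_le (one_le_mul_of_one_le_of_one_le (by linarith) (by linarith))
    (by linarith)

theorem mul_le_dimConst (a : Fin 2) : (m a * n : ℝ) ≤ dimConst n m := by
  have h1 : (0 : ℝ) ≤ n := by positivity
  have h2 : (0 : ℝ) ≤ m 0 := by positivity
  have h3 : (0 : ℝ) ≤ m 1 := by positivity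
  have h4 := mul_nonneg h1 h2
  have h5 := mul_nonneg h1 h3
  have h6 := mul_nonneg h2 h3
  have h7 := mul_nonneg h1 h6
  unfold dimConst
  fin_cases a
  · simp only [Fin.zero_eta]; nlinarith
  · simp only [Fin.mk_one]; nlinarith

theorem natCast_le_dimConst (a : Fin 2) : (m a : ℝ) ≤ dimConst n m := by
  have h1 : (0 : ℝ) ≤ n := by positivity
  have h2 : (0 : ℝ) ≤ m 0 := by positivity
  have h3 : (0 : ℝ) ≤ m 1 := by positivity
  have h4 := mul_nonneg h1 h2
  have h5 := mul_nonneg h1 h3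
  have h6 := mul_nonneg h2 h3
  have h7 := mul_nonneg h1 h6
  unfold dimConst
  fin_cases a
  · simp only [Fin.zero_eta]; nlinarith
  · simp only [Fin.mk_one]; nlinarith

theorem abs_dot2_le (a : Fin 2) (x y : Fin (m a) → Fin n → ℝ) :
    |dot2 x y| ≤ dimConst n m * (‖x‖ * ‖y‖) :=
  (abs_sum_sum_mul_le x y).trans (mul_le_mul_of_nonneg_right (mul_le_dimConst a) (by positivity))

theorem abs_dot1_le (n : ℕ) (a : Fin 2) (x y : Fin (m a) → ℝ) :
    |dot1 x y| ≤ dimConst n m * (‖x‖ * ‖y‖) :=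
  (abs_sum_mul_le x y).trans (mul_le_mul_of_nonneg_right (natCast_le_dimConst a) (by positivity))

/-- The integrand of the weak formulation, as a function of the test function `B`, its gradient
`A`, and the values `Q`, `w` of the coefficients. -/
def pairing (A : PVar n m) (B : ZVar m) (Q : PVar n m) (w : ZVar m) : ℝ :=
  ∑ a, ∑ i, (∑ α, A a i α * Q a i α + B a i * w a i)

theorem pairing_eq (A : PVar n m) (B : ZVar m) (Q : PVar n m) (w : ZVar m) :
    pairing A B Q w = ∑ a, (dot2 (A a) (Q a) + dot1 (B a) (w a)) := by
  simp [pairing, dot2, dot1, Finset.sum_add_distrib]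

theorem pairing_smul (c : ℝ) (A : PVar n m) (B : ZVar m) (Q : PVar n m) (w : ZVar m) :
    pairing A B (c • Q) (c • w) = c * pairing A B Q w := by
  simp only [pairing_eq, Pi.smul_apply, dot2_smul, dot1_smul, ← mul_add, Finset.mul_sum]

theorem abs_pairing_le (A : PVar n m) (B : ZVar m) (Q : PVar n m) (w : ZVar m) :
    |pairing A B Q w| ≤ dimConst n m * ∑ a, (‖A a‖ * ‖Q a‖ + ‖B a‖ * ‖w a‖) := by
  rw [pairing_eq, Finset.mul_sum]
  refine (Finset.abs_sum_le_sum_abs _ _).trans (Finset.sum_le_sum fun a _ => ?_)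
  refine (abs_add_le _ _).trans ?_
  rw [mul_add]
  exact add_le_add (abs_dot2_le a _ _) (abs_dot1_le n a _ _)

/-- The integrand of the weak formulation as a continuous linear functional of the coefficients. -/
noncomputable def pairingL (A : PVar n m) (B : ZVar m) : PVar n m × ZVar m →L[ℝ] ℝ :=
  LinearMap.toContinuousLinearMap
    { toFun := fun y => pairing A B y.1 y.2
      map_add' := fun y y' => by
        simp only [pairing_eq, Prod.fst_add, Prod.snd_add, Pi.add_apply, dot2_add, dot1_add,
          Finset.sum_add_distrib]
        ring
      map_smul' := fun c y => by
        simp only [Prod.smul_fst, Prod.smul_snd, pairing_smul, RingHom.id_apply, smul_eq_mul] }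

theorem pairingL_apply (A : PVar n m) (B : ZVar m) (y : PVar n m × ZVar m) :
    pairingL A B y = pairing A B y.1 y.2 := rfl

/-- The fundamental theorem of calculus for locally Lipschitz coefficients that are differentiable
at almost every point of a segment. -/
theorem integral_le_pairing_sub {q : CoeffArg n m → PVar n m} {w : CoeffArg n m → ZVar m}
    {S : Set (CoeffArg n m)} (hq : LocallyLipschitzOn S q) (hw : LocallyLipschitzOn S w)
    (A : PVar n m) (B : ZVar m) {y v : CoeffArg n m} (hS : ∀ t ∈ Icc (0 : ℝ) 1, y + t • v ∈ S)
    {ℓ : ℝ → ℝ} (hℓ : Continuous ℓ)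
    (h : ∀ᵐ t ∂unitMeasure, DifferentiableAt ℝ q (y + t • v) ∧ DifferentiableAt ℝ w (y + t • v) ∧
      ℓ t ≤ pairing A B (fderiv ℝ q (y + t • v) v) (fderiv ℝ w (y + t • v) v)) :
    ∫ t, ℓ t ∂unitMeasure ≤ pairing A B (q (y + v)) (w (y + v)) - pairing A B (q y) (w y) := by
  set c : ℝ → CoeffArg n m := fun t => y + t • v with hc
  set f : ℝ → ℝ := fun t => pairingL A B (q (c t), w (c t)) with hf
  have hK : IsCompact (c '' Icc 0 1) := isCompact_Icc.image (by fun_prop)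
  have hKS : c '' Icc 0 1 ⊆ S := by
    rintro _ ⟨t, ht, rfl⟩
    exact hS t ht
  obtain ⟨C₁, h₁⟩ := (hq.mono hKS).exists_lipschitzOnWith_of_compact hK
  obtain ⟨C₂, h₂⟩ := (hw.mono hKS).exists_lipschitzOnWith_of_compact hK
  have hcl : LipschitzWith ‖v‖₊ c := by
    refine LipschitzWith.of_dist_le_mul fun t t' => ?_
    rw [hc, dist_add_left, dist_eq_norm, ← sub_smul, norm_smul, ← dist_eq_norm, mul_comm]
    rfl
  have hfl := (pairingL A B).lipschitz.comp_lipschitzOnWith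
    ((h₁.prodMk h₂).comp hcl.lipschitzOnWith (mapsTo_image c (Icc 0 1)))
  rw [← uIcc_of_le zero_le_one] at hfl
  have hac : AbsolutelyContinuousOnInterval f 0 1 := hfl.absolutelyContinuousOnInterval
  have hftc := hac.integral_deriv_eq_sub
  have e1 : f 1 - f 0 = pairing A B (q (y + v)) (w (y + v)) - pairing A B (q y) (w y) := by
    simp [hf, hc, pairingL_apply]
  rw [← e1, ← hftc, integral_unitMeasure]
  refine intervalIntegral.integral_mono_ae_restrict zero_le_one (hℓ.intervalIntegrable _ _)
    hac.intervalIntegrable_deriv ?_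
  rw [Measure.restrict_congr_set Ioc_ae_eq_Icc.symm]
  change ∀ᵐ t ∂unitMeasure, ℓ t ≤ deriv f t
  filter_upwards [h] with t ht
  obtain ⟨d1, d2, d3⟩ := ht
  have hct : HasDerivAt c v t := by
    simpa [hc] using ((hasDerivAt_id t).smul_const v).const_add y
  have := (pairingL A B).hasFDerivAt.comp_hasDerivAt t
    ((d1.hasFDerivAt.comp_hasDerivAt t hct).prodMk (d2.hasFDerivAt.comp_hasDerivAt t hct))
  have e2 : deriv f t = _ := this.deriv
  rw [e2]
  exact d3

end Pairing

section Pointwise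

variable {n : ℕ} {m : Fin 2 → ℕ} {k : Fin 2 → ℝ} {q : CoeffArg n m → PVar n m}
  {w : CoeffArg n m → ZVar m} {lam Lam : ℝ} {y : CoeffArg n m}

theorem sum_elliptic_eq (c : (a b : Fin 2) → Fin (m b) → Fin n → Fin (m a) → Fin n → ℝ)
    (π : PVar n m) :
    ∑ a, ∑ i, ∑ α, ∑ b, ∑ j, ∑ β, π a i α * c a b j β i α * π b j β =
      ∑ a, dot2 (π a) (∑ b, ∑ j, ∑ β, π b j β • c a b j β) := by
  simp only [dot2, Finset.sum_apply, Pi.smul_apply, smul_eq_mul, Finset.mul_sum]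
  repeat' refine Finset.sum_congr rfl fun _ _ => ?_
  ring

theorem sum_zeroth_eq (c : (a b : Fin 2) → Fin (m b) → Fin (m a) → ℝ) (π : ZVar m) :
    ∑ a, ∑ i, ∑ b, ∑ j, π a i * c a b j i * π b j =
      ∑ a, dot1 (π a) (∑ b, ∑ j, π b j • c a b j) := by
  simp only [dot1, Finset.sum_apply, Pi.smul_apply, smul_eq_mul, Finset.mul_sum]
  repeat' refine Finset.sum_congr rfl fun _ _ => ?_
  ring

/-- The gradient of `s² D` when `P` is the gradient of `D` and `τ` that of `s`. -/
def testGrad (s : ℝ) (τ : Fin n → ℝ) (D : ZVar m) (P : PVar n m) : PVar n m :=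
  fun a => s ^ 2 • P a + (2 * s) • fun i α => τ α * D a i

theorem norm_outer_le {m n : ℕ} (τ : Fin n → ℝ) (D : Fin m → ℝ) :
    ‖(fun i α => τ α * D i : Fin m → Fin n → ℝ)‖ ≤ ‖τ‖ * ‖D‖ := by
  refine (pi_norm_le_iff_of_nonneg (by positivity)).2 fun i =>
    (pi_norm_le_iff_of_nonneg (by positivity)).2 fun α => ?_
  rw [norm_mul]
  exact mul_le_mul (norm_le_pi_norm τ α) (norm_le_pi_norm D i) (norm_nonneg _) (norm_nonneg _)

/-- The structure conditions bound from below the integrand of the differentiated system. Here `D`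
and `P` stand for the difference quotients of `z` and `∇z`, and `W` is any upper bound of the
weights at `y`; the terms subtracted on the left are those of `lower_order_le`. -/
theorem WeaklyCoupledAt.le_pairing_fderiv (h : WeaklyCoupledAt k q w lam Lam y)
    (hk : ∀ a, 2 ≤ k a) (hLam : 0 < Lam) {ε M s : ℝ} (hε : 0 < ε) (hs0 : 0 ≤ s) (hs1 : s ≤ 1)
    {τ : Fin n → ℝ} (hτ : ‖τ‖ ≤ M) (γ : Fin n) (D : ZVar m) (P : PVar n m) {W : Fin 2 → ℝ}
    (hW : ∀ a, V y a ≤ W a) {K : ℝ} (hK : K = dimConst n m ^ 2 * Lam) :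
    lam * s ^ 2 * ∑ a, V y a ^ (k a - 2) * ‖P a‖ ^ 2 -
      (6 * ε * (s ^ 2 * W 0 ^ (k 0 - 2) * ‖P 0‖ ^ 2 + s ^ 2 * W 1 ^ (k 1 - 2) * ‖P 1‖ ^ 2) +
      (2 * K ^ 2 / ε + 4 * K) * (s ^ 2 * W 0 ^ (k 0 - 2) * W 0 ^ 2 * ‖D 0‖ ^ 2 +
        s ^ 2 * W 1 ^ (k 1 - 2) * W 1 ^ 2 * ‖D 1‖ ^ 2) +
      20 * ((K + K ^ 2 / ε) * (1 + 4 * M ^ 2)) *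
        (W 0 ^ (k 0 - 2) * W 0 ^ 2 + W 1 ^ (k 1 - 2) * W 1 ^ 2 + W 0 ^ (k 0 - 2) * ‖D 0‖ ^ 2 +
          W 1 ^ (k 1 - 2) * ‖D 1‖ ^ 2 + W 1 ^ (k 1 - 2) * W 1 * ‖D 0‖ ^ 2)) ≤
    pairing (testGrad s τ D P) (s ^ 2 • D) (fderiv ℝ q y (Pi.single γ 1, D, P))
      (fderiv ℝ w y (Pi.single γ 1, D, P)) := by
  have hV1 (a : Fin 2) : 1 ≤ V y a := one_le_wt (y.2.2 a)
  have hW1 (a : Fin 2) : 1 ≤ W a := (hV1 a).trans (hW a)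
  have hW0 (a : Fin 2) : 0 < W a := zero_lt_one.trans_le (hW1 a)
  have hM : 0 ≤ M := (norm_nonneg _).trans hτ
  set N := dimConst n m with hN
  have hN1 : 1 ≤ N := one_le_dimConst
  have hN0 : 0 ≤ N := zero_le_one.trans hN1
  have hNL : N * Lam ≤ K := by rw [hK]; nlinarith [mul_nonneg hN0 hLam.le]
  have hLK : Lam ≤ K := by nlinarith
  have hK0 : 0 < K := hLam.trans_le hLK
  set A : Fin 2 → ℝ := fun a => W a ^ (k a - 2) with hA
  have hA0 (a : Fin 2) : 0 ≤ A a := Real.rpow_nonneg (hW0 a).le _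
  -- Powers of the weight at `y` are bounded by powers of `W`.
  have v2 (a : Fin 2) : V y a ^ (k a - 2) ≤ A a :=
    Real.rpow_le_rpow (by linarith [hV1 a]) (hW a) (by linarith [hk a])
  have v1 (a : Fin 2) : V y a ^ (k a - 1) ≤ A a * W a := by
    have e : A a * W a = W a ^ (k a - 1) := by
      rw [hA, ← Real.rpow_add_one (hW0 a).ne']; ring_nf
    rw [e]
    exact Real.rpow_le_rpow (by linarith [hV1 a]) (hW a) (by linarith [hk a])
  have v0 (a : Fin 2) : V y a ^ k a ≤ A a * W a ^ 2 := by
    have e : A a * W a ^ 2 = W a ^ k a := by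
      rw [hA, ← Real.rpow_natCast (W a) 2, ← Real.rpow_add (hW0 a)]; norm_num
    rw [e]
    exact Real.rpow_le_rpow (by linarith [hV1 a]) (hW a) (by linarith [hk a])
  have lm {x x' : ℝ} (hx : x ≤ x') : Lam * x ≤ Lam * x' := mul_le_mul_of_nonneg_left hx hLam.le
  set Qx : PVar n m := fun a => dx q y a γ with hQx
  set Qz : PVar n m := fun a => ∑ b, ∑ j, D b j • dz q y a b j with hQz
  set Qp : PVar n m := fun a => ∑ b, ∑ j, ∑ β, P b j β • dp q y a b j β with hQp
  set wx : ZVar m := fun a => dx w y a γ with hwx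
  set wz : ZVar m := fun a => ∑ b, ∑ j, D b j • dz w y a b j with hwz
  set wp : ZVar m := fun a => ∑ b, ∑ j, ∑ β, P b j β • dp w y a b j β with hwp
  have eQ (a : Fin 2) : fderiv ℝ q y (Pi.single γ 1, D, P) a = Qx a + Qz a + Qp a :=
    fderiv_coeff_apply q y (Pi.single γ 1) D P a
  have ew (a : Fin 2) : fderiv ℝ w y (Pi.single γ 1, D, P) a = wx a + wz a + wp a :=
    fderiv_coeff_apply w y (Pi.single γ 1) D P a
  -- Bounds for the single blocks.
  have c00 := h.coupling 0 0
  have c01 := h.coupling 0 1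
  have c10 := h.coupling 1 0
  have c11 := h.coupling 1 1
  simp only [Matrix.of_apply, Matrix.cons_val', Matrix.cons_val_zero, Matrix.cons_val_one,
    Matrix.cons_val_fin_one, mul_zero] at c00 c01 c10 c11
  have p00 := h.q_p 0 0
  have p01 := h.q_p 0 1
  have p10 := h.q_p 1 0
  have p11 := h.q_p 1 1
  simp only [Matrix.of_apply, Matrix.cons_val', Matrix.cons_val_zero, Matrix.cons_val_one,
    Matrix.cons_val_fin_one, mul_zero] at p00 p01 p10 p11
  have hz (a : Fin 2) : ‖Qz a‖ ≤ N * (‖D 0‖ * ‖dz q y a 0‖) + N * (‖D 1‖ * ‖dz q y a 1‖) := by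
    rw [hQz]
    simp only [Fin.sum_univ_two]
    refine (norm_add_le _ _).trans (add_le_add ?_ ?_) <;>
    exact (norm_sum_smul_le _ _).trans
      (mul_le_mul_of_nonneg_right (natCast_le_dimConst _) (by positivity))
  have hp (a : Fin 2) : ‖Qp a‖ ≤ N * (‖P 0‖ * ‖dp q y a 0‖) + N * (‖P 1‖ * ‖dp q y a 1‖) := by
    rw [hQp]
    simp only [Fin.sum_univ_two]
    refine (norm_add_le _ _).trans (add_le_add ?_ ?_) <;>
    exact (norm_sum_sum_smul_le _ _).trans
      (mul_le_mul_of_nonneg_right (mul_le_dimConst _) (by positivity))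
  have hwp' (a : Fin 2) : ‖wp a‖ ≤ N * (‖P 0‖ * ‖dp w y a 0‖) + N * (‖P 1‖ * ‖dp w y a 1‖) := by
    rw [hwp]
    simp only [Fin.sum_univ_two]
    refine (norm_add_le _ _).trans (add_le_add ?_ ?_) <;>
    exact (norm_sum_sum_smul_le _ _).trans
      (mul_le_mul_of_nonneg_right (mul_le_dimConst _) (by positivity))
  have hx (a : Fin 2) : ‖Qx a‖ ≤ Lam * (A a * W a) := by
    have := h.q_growth a
    have h1 := norm_le_pi_norm (dx q y a) γ
    have h2 := norm_nonneg (q y a)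
    have h3 := lm (v1 a)
    change ‖dx q y a γ‖ ≤ _
    linarith
  have hwx0 : ‖wx 0‖ ≤ Lam * (A 0 * W 0 ^ 2 + A 1 * W 1) := by
    have := h.w_one
    have h1 := norm_le_pi_norm (dx w y 0) γ
    have h2 := norm_nonneg (w y 0)
    have h3 := lm (add_le_add (v0 0) (v1 1))
    change ‖dx w y 0 γ‖ ≤ _
    linarith
  have hwx1 : ‖wx 1‖ ≤ Lam * (A 1 * W 1 ^ 2) := by
    have := h.w_two
    have h1 := norm_le_pi_norm (dx w y 1) γ
    have h2 := norm_nonneg (w y 1)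
    have h3 := lm (v0 1)
    change ‖dx w y 1 γ‖ ≤ _
    linarith
  have prodle {x c b : ℝ} (hx : 0 ≤ x) (hc : c ≤ b) : N * (x * c) ≤ N * (x * b) :=
    mul_le_mul_of_nonneg_left (mul_le_mul_of_nonneg_left hc hx) hN0
  have d0 := norm_nonneg (D 0)
  have d1 := norm_nonneg (D 1)
  have e0 := norm_nonneg (P 0)
  have e1 := norm_nonneg (P 1)
  have hLN : ∀ {x}, 0 ≤ x → Lam * x ≤ N * (Lam * x) := fun {x} hx =>
    le_mul_of_one_le_left (by positivity) hN1
  have q0W := hA0 0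
  have q1W := hA0 1
  have w0W := (hW0 0).le
  have w1W := (hW0 1).le
  have a0 : ‖Qx 0 + Qz 0‖ ≤ N * Lam * (A 0 * W 0 + ‖D 0‖ * (A 0 * W 0)) := by
    have h1 := hz 0
    have h2 := prodle d0 (b := Lam * (A 0 * W 0)) (by
      have := norm_nonneg (dp w y 0 0); have := lm (v1 0); linarith : ‖dz q y 0 0‖ ≤ _)
    have h3 := prodle d1 (b := 0) (by
      have := norm_nonneg (dp w y 1 0); linarith : ‖dz q y 0 1‖ ≤ _)
    have h4 := hx 0
    have h5 := hLN (by positivity : 0 ≤ A 0 * W 0)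
    have h6 := norm_add_le (Qx 0) (Qz 0)
    linarith
  have a1 : ‖Qx 1 + Qz 1‖ ≤ N * Lam * (A 1 * W 1 + ‖D 0‖ * A 1 + ‖D 1‖ * (A 1 * W 1)) := by
    have h1 := hz 1
    have h2 := prodle d0 (b := Lam * A 1) (by
      have := norm_nonneg (dp w y 0 1); have := lm (v2 1); linarith : ‖dz q y 1 0‖ ≤ _)
    have h3 := prodle d1 (b := Lam * (A 1 * W 1)) (by
      have := norm_nonneg (dp w y 1 1); have := lm (v1 1); linarith : ‖dz q y 1 1‖ ≤ _)
    have h4 := hx 1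
    have h5 := hLN (by positivity : 0 ≤ A 1 * W 1)
    have h6 := norm_add_le (Qx 1) (Qz 1)
    linarith
  have b0 : ‖Qp 0‖ ≤ N * Lam * (‖P 0‖ * A 0) := by
    have h1 := hp 0
    have h2 := prodle e0 (b := Lam * A 0) (by have := lm (v2 0); linarith : ‖dp q y 0 0‖ ≤ _)
    have h3 := prodle e1 (b := 0) p01
    linarith
  have b1 : ‖Qp 1‖ ≤ N * Lam * (‖P 1‖ * A 1) := by
    have h1 := hp 1
    have h2 := prodle e1 (b := Lam * A 1) (by have := lm (v2 1); linarith : ‖dp q y 1 1‖ ≤ _)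
    have h3 := prodle e0 (b := 0) p10
    linarith
  have g0 : ‖wx 0 + wp 0‖ ≤ N * Lam * (A 0 * W 0 ^ 2 + A 1 * W 1 + ‖P 0‖ * (A 0 * W 0) +
      ‖P 1‖ * A 1) := by
    have h1 := hwp' 0
    have h2 := prodle e0 (b := Lam * (A 0 * W 0)) (by
      have := norm_nonneg (dz q y 0 0); have := lm (v1 0); linarith : ‖dp w y 0 0‖ ≤ _)
    have h3 := prodle e1 (b := Lam * A 1) (by
      have := norm_nonneg (dz q y 1 0); have := lm (v2 1); linarith : ‖dp w y 0 1‖ ≤ _)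
    have h5 := hLN (by positivity : 0 ≤ A 0 * W 0 ^ 2 + A 1 * W 1)
    have h6 := norm_add_le (wx 0) (wp 0)
    linarith
  have g1 : ‖wx 1 + wp 1‖ ≤ N * Lam * (A 1 * W 1 ^ 2 + ‖P 1‖ * (A 1 * W 1)) := by
    have h1 := hwp' 1
    have h2 := prodle e0 (b := 0) (by
      have := norm_nonneg (dz q y 0 1); linarith : ‖dp w y 1 0‖ ≤ _)
    have h3 := prodle e1 (b := Lam * (A 1 * W 1)) (by
      have := norm_nonneg (dz q y 1 1); have := lm (v1 1); linarith : ‖dp w y 1 1‖ ≤ _)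
    have h5 := hLN (by positivity : 0 ≤ A 1 * W 1 ^ 2)
    have h6 := norm_add_le (wx 1) (wp 1)
    linarith
  -- Split the pairing into the elliptic part, the zeroth order part and the rest.
  set T : PVar n m := fun a i α => τ α * D a i with hT
  have split : pairing (testGrad s τ D P) (s ^ 2 • D) (fderiv ℝ q y (Pi.single γ 1, D, P))
      (fderiv ℝ w y (Pi.single γ 1, D, P)) = s ^ 2 * ∑ a, dot2 (P a) (Qp a) +
      s ^ 2 * ∑ a, dot1 (D a) (wz a) + s ^ 2 * ∑ a, dot2 (P a) (Qx a + Qz a) +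
      2 * s * ∑ a, dot2 (T a) (Qx a + Qz a + Qp a) + s ^ 2 * ∑ a, dot1 (D a) (wx a + wp a) := by
    rw [pairing_eq]
    simp only [eQ, ew, testGrad, add_dot2, smul_dot2, smul_dot1, dot1_add, dot2_add,
      Pi.smul_apply, Fin.sum_univ_two, hT]
    ring
  have ell : lam * ∑ a, V y a ^ (k a - 2) * ‖P a‖ ^ 2 ≤ ∑ a, dot2 (P a) (Qp a) := by
    rw [hQp, ← sum_elliptic_eq]
    exact h.elliptic P
  have zer : -(Lam * (A 0 * W 0 ^ 2 * ‖D 0‖ ^ 2 + A 1 * W 1 ^ 2 * ‖D 1‖ ^ 2 +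
      A 1 * W 1 * ‖D 0‖ ^ 2)) ≤ ∑ a, dot1 (D a) (wz a) := by
    have h1 := h.w_z D
    rw [sum_zeroth_eq, Fin.sum_univ_two (f := fun a => V y a ^ k a * ‖D a‖ ^ 2)] at h1
    have h2 : Lam * (V y 0 ^ k 0 * ‖D 0‖ ^ 2 + V y 1 ^ k 1 * ‖D 1‖ ^ 2 +
        V y 1 ^ (k 1 - 1) * ‖D 0‖ ^ 2) ≤ Lam * (A 0 * W 0 ^ 2 * ‖D 0‖ ^ 2 +
        A 1 * W 1 ^ 2 * ‖D 1‖ ^ 2 + A 1 * W 1 * ‖D 0‖ ^ 2) := by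
      refine lm (add_le_add (add_le_add ?_ ?_) ?_)
      · exact mul_le_mul_of_nonneg_right (v0 0) (by positivity)
      · exact mul_le_mul_of_nonneg_right (v0 1) (by positivity)
      · exact mul_le_mul_of_nonneg_right (v1 1) (by positivity)
    change -(∑ a, dot1 (D a) (wz a)) ≤ _ at h1
    linarith
  have dot2b (a : Fin 2) (x y : Fin (m a) → Fin n → ℝ) {X Y : ℝ} (hX : ‖x‖ ≤ X) (hX0 : 0 ≤ X)
      (hY : ‖y‖ ≤ N * Lam * Y) : -(K * (X * Y)) ≤ dot2 x y := by
    have h1 := abs_dot2_le (m := m) a x y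
    have h2 : ‖x‖ * ‖y‖ ≤ X * (N * Lam * Y) := mul_le_mul hX hY (norm_nonneg _) hX0
    have h3 := mul_le_mul_of_nonneg_left h2 hN0
    have h4 := neg_abs_le (dot2 x y)
    rw [hK]
    linarith
  have dot1b (a : Fin 2) (x y : Fin (m a) → ℝ) {Y : ℝ}
      (hY : ‖y‖ ≤ N * Lam * Y) : -(K * (‖x‖ * Y)) ≤ dot1 x y := by
    have h1 := abs_dot1_le n a x y
    have h2 : ‖x‖ * ‖y‖ ≤ ‖x‖ * (N * Lam * Y) := mul_le_mul_of_nonneg_left hY (norm_nonneg _)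
    have h3 := mul_le_mul_of_nonneg_left h2 hN0
    have h4 := neg_abs_le (dot1 x y)
    rw [hK]
    linarith
  have hTn (a : Fin 2) : ‖T a‖ ≤ M * ‖D a‖ :=
    (norm_outer_le τ (D a)).trans (mul_le_mul_of_nonneg_right hτ (norm_nonneg _))
  have r1 := dot2b 0 (P 0) _ le_rfl e0 a0
  have r2 := dot2b 1 (P 1) _ le_rfl e1 a1
  have r3 := dot2b 0 (T 0) (Qx 0 + Qz 0 + Qp 0) (hTn 0) (by positivity)
    (Y := A 0 * W 0 + ‖D 0‖ * (A 0 * W 0) + ‖P 0‖ * A 0)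
    ((norm_add_le _ _).trans (by linarith))
  have r4 := dot2b 1 (T 1) (Qx 1 + Qz 1 + Qp 1) (hTn 1) (by positivity)
    (Y := A 1 * W 1 + ‖D 0‖ * A 1 + ‖D 1‖ * (A 1 * W 1) + ‖P 1‖ * A 1)
    ((norm_add_le _ _).trans (by linarith))
  have r5 := dot1b 0 (D 0) _ g0
  have r6 := dot1b 1 (D 1) _ g1
  have zer' : -(K * (A 0 * W 0 ^ 2 * ‖D 0‖ ^ 2 + A 1 * W 1 ^ 2 * ‖D 1‖ ^ 2 +
      A 1 * W 1 * ‖D 0‖ ^ 2)) ≤ ∑ a, dot1 (D a) (wz a) := by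
    refine le_trans (neg_le_neg (mul_le_mul_of_nonneg_right hLK ?_)) zer
    positivity
  have low := lower_order_le (M := M) (e₀ := ‖P 0‖) (e₁ := ‖P 1‖) (d₀ := ‖D 0‖) (d₁ := ‖D 1‖)
    hε hK0 hs0 hs1 (hA0 0) (hA0 1) (hW1 0) (hW1 1)
  rw [split]
  simp only [Fin.sum_univ_two] at ell zer' ⊢
  have ss := sq_nonneg s
  have f1 := mul_le_mul_of_nonneg_left ell ss
  have f2 := mul_le_mul_of_nonneg_left zer' ss
  have f3 := mul_le_mul_of_nonneg_left (add_le_add r1 r2) ss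
  have f4 := mul_le_mul_of_nonneg_left (add_le_add r3 r4) hs0
  have f5 := mul_le_mul_of_nonneg_left (add_le_add r5 r6) ss
  linarith

end Pointwise

/-! ### Increments of the coefficients along segments -/

section Increment

variable {n : ℕ} {m : Fin 2 → ℕ} {k : Fin 2 → ℝ} {q : CoeffArg n m → PVar n m}
  {w : CoeffArg n m → ZVar m} {lam Lam : ℝ} {S : Set (CoeffArg n m)}

/-- The constant comparing the average of `V^{k-2}` over a segment with its maximum at the end
points. -/
noncomputable def segConst (k : ℝ) : ℝ := 1 / 4 * (1 / 2) ^ (k - 2)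

theorem segConst_pos (k : ℝ) : 0 < segConst k := by
  unfold segConst
  positivity

/-- The structure conditions integrated over the segment joining two values of `(x, z, ∇z)`. -/
theorem le_pairing_increment (hq : LocallyLipschitzOn S q) (hw : LocallyLipschitzOn S w)
    (hk : ∀ a, 2 ≤ k a) (hlam : 0 < lam) (hLam : 0 < Lam) {ε M s h : ℝ} (hε : 0 < ε) (hh : 0 < h)
    (hs0 : 0 ≤ s) (hs1 : s ≤ 1) {τ : Fin n → ℝ} (hτ : ‖τ‖ ≤ M) (γ : Fin n) (D : ZVar m)
    (P : PVar n m) {y y' : CoeffArg n m} (hy : y' = y + h • (Pi.single γ 1, D, P))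
    (hS : ∀ t ∈ Icc (0 : ℝ) 1, y + t • (y' - y) ∈ S)
    (hae : ∀ᵐ t ∂unitMeasure, WeaklyCoupledAt k q w lam Lam (y + t • (y' - y)))
    {W : Fin 2 → ℝ} (hW : ∀ a, W a = max (V y a) (V y' a))
    {K : ℝ} (hK : K = dimConst n m ^ 2 * Lam) :
    h * (lam * s ^ 2 * ∑ a, segConst (k a) * W a ^ (k a - 2) * ‖P a‖ ^ 2 -
      (6 * ε * (s ^ 2 * W 0 ^ (k 0 - 2) * ‖P 0‖ ^ 2 + s ^ 2 * W 1 ^ (k 1 - 2) * ‖P 1‖ ^ 2) +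
      (2 * K ^ 2 / ε + 4 * K) * (s ^ 2 * W 0 ^ (k 0 - 2) * W 0 ^ 2 * ‖D 0‖ ^ 2 +
        s ^ 2 * W 1 ^ (k 1 - 2) * W 1 ^ 2 * ‖D 1‖ ^ 2) +
      20 * ((K + K ^ 2 / ε) * (1 + 4 * M ^ 2)) *
        (W 0 ^ (k 0 - 2) * W 0 ^ 2 + W 1 ^ (k 1 - 2) * W 1 ^ 2 + W 0 ^ (k 0 - 2) * ‖D 0‖ ^ 2 +
          W 1 ^ (k 1 - 2) * ‖D 1‖ ^ 2 + W 1 ^ (k 1 - 2) * W 1 * ‖D 0‖ ^ 2))) ≤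
    pairing (testGrad s τ D P) (s ^ 2 • D) (q y') (w y') -
      pairing (testGrad s τ D P) (s ^ 2 • D) (q y) (w y) := by
  set E := (6 * ε * (s ^ 2 * W 0 ^ (k 0 - 2) * ‖P 0‖ ^ 2 + s ^ 2 * W 1 ^ (k 1 - 2) * ‖P 1‖ ^ 2) +
      (2 * K ^ 2 / ε + 4 * K) * (s ^ 2 * W 0 ^ (k 0 - 2) * W 0 ^ 2 * ‖D 0‖ ^ 2 +
        s ^ 2 * W 1 ^ (k 1 - 2) * W 1 ^ 2 * ‖D 1‖ ^ 2) +
      20 * ((K + K ^ 2 / ε) * (1 + 4 * M ^ 2)) *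
        (W 0 ^ (k 0 - 2) * W 0 ^ 2 + W 1 ^ (k 1 - 2) * W 1 ^ 2 + W 0 ^ (k 0 - 2) * ‖D 0‖ ^ 2 +
          W 1 ^ (k 1 - 2) * ‖D 1‖ ^ 2 + W 1 ^ (k 1 - 2) * W 1 * ‖D 0‖ ^ 2)) with hE
  have hv : y' - y = h • (Pi.single γ 1, D, P) := by rw [hy, add_sub_cancel_left]
  have hVt (t : ℝ) (a : Fin 2) : V (y + t • (y' - y)) a =
      wt (y.2.2 a + t • (y'.2.2 a - y.2.2 a)) := rfl
  have hVc (a : Fin 2) : Continuous fun t : ℝ => V (y + t • (y' - y)) a ^ (k a - 2) := by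
    simp only [hVt]
    exact (continuous_wt.comp (by fun_prop)).rpow_const fun _ => Or.inr (by linarith [hk a])
  have hint (a : Fin 2) : Integrable (fun t : ℝ => V (y + t • (y' - y)) a ^ (k a - 2))
      unitMeasure := by
    have := (hVc a).integrableOn_Icc (μ := volume) (a := 0) (b := 1)
    exact this.mono_set Ioc_subset_Icc_self
  have hℓ : Continuous fun t : ℝ =>
      h * (lam * s ^ 2 * ∑ a, V (y + t • (y' - y)) a ^ (k a - 2) * ‖P a‖ ^ 2 - E) := by
    refine continuous_const.mul ((continuous_const.mul ?_).sub continuous_const)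
    exact continuous_finsetSum _ fun a _ => (hVc a).mul continuous_const
  have key := integral_le_pairing_sub hq hw (testGrad s τ D P) (s ^ 2 • D) hS hℓ ?_
  · rw [add_sub_cancel] at key
    refine le_trans ?_ key
    rw [integral_const_mul, integral_sub, integral_const_mul, integral_finsetSum]
    · simp only [integral_mul_const, integral_const, probReal_univ, one_smul]
      gcongr with a
      rw [hW a]
      exact le_integral_wt_rpow (y.2.2 a) (y'.2.2 a) (by linarith [hk a])
    · exact fun a _ => (hint a).mul_const _
    · exact (integrable_finsetSum _ fun a _ => (hint a).mul_const _).const_mul _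
    · exact integrable_const _
  · have hmem : ∀ᵐ t ∂unitMeasure, t ∈ Ioc (0 : ℝ) 1 := ae_restrict_mem measurableSet_Ioc
    filter_upwards [hae, hmem] with t ht htm
    refine ⟨ht.diff_q, ht.diff_w, ?_⟩
    have hWt (a : Fin 2) : V (y + t • (y' - y)) a ≤ W a := by
      rw [hVt, hW a]
      exact wt_segment_le _ _ ⟨htm.1.le, htm.2⟩
    have := ht.le_pairing_fderiv hk hLam hε hs0 hs1 hτ γ D P hWt hK
    rw [hv, map_smul, map_smul, pairing_smul]
    rw [← hv]
    exact mul_le_mul_of_nonneg_left this hh.le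

theorem rpow_sub_one_le {v δ k : ℝ} (hv : 1 ≤ v) (hδ : 0 < δ) (hk : 1 ≤ k) :
    v ^ (k - 1) ≤ δ * v ^ k + (1 / δ) ^ (k - 1) := by
  have hv0 : 0 < v := by linarith
  rcases le_total (1 / δ) v with h | h
  · have e : v ^ k = v * v ^ (k - 1) := by
      rw [mul_comm, ← Real.rpow_add_one hv0.ne']; ring_nf
    have h1 : 1 ≤ δ * v := by rwa [div_le_iff₀' hδ] at h
    have h2 : 0 ≤ v ^ (k - 1) := Real.rpow_nonneg hv0.le _
    have h3 : 0 ≤ (1 / δ) ^ (k - 1) := Real.rpow_nonneg (by positivity) _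
    rw [e]
    nlinarith
  · have h1 := Real.rpow_le_rpow hv0.le h (by linarith : 0 ≤ k - 1)
    have h2 : 0 ≤ δ * v ^ k := mul_nonneg hδ.le (Real.rpow_nonneg hv0.le _)
    linarith

/-- Coercivity: `q_a · p_a` controls `V_a^{k_a}`. The ellipticity is integrated over the segment
that joins `p` with its block `a` replaced by zero to `p`; at the first end point `V_a = 1`, so that
`|q_a| ≤ Λ` there. -/
theorem exists_coercive (hk : ∀ a, 2 ≤ k a) (hlam : 0 < lam) (hLam : 0 < Lam) (a : Fin 2) :
    ∃ c > 0, ∃ C ≥ 0, ∀ (q : CoeffArg n m → PVar n m) (w : CoeffArg n m → ZVar m)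
      (S : Set (CoeffArg n m)) (x : Fin n → ℝ) (z : ZVar m), LocallyLipschitzOn S q →
      LocallyLipschitzOn S w → (∀ p, (x, z, p) ∈ S) →
      (∀ p, WeaklyCoupledAt k q w lam Lam (x, z, p)) →
      ∀ p : PVar n m, c * wt (p a) ^ k a - C ≤ dot2 (p a) (q (x, z, p) a) := by
  set N := dimConst n m with hN
  have hN0 : 0 < N := zero_lt_one.trans_le one_le_dimConst
  set c := lam * segConst (k a) with hc
  have hc0 : 0 < c := mul_pos hlam (segConst_pos _)
  have hcN : 0 < c + N * Lam := by positivity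
  -- With this `δ`, the terms of order `V_a^{k_a-1}` cost half of the coercivity.
  set δ := c / 2 / (c + N * Lam) with hδ
  have hδ0 : 0 < δ := by positivity
  refine ⟨c / 2, by positivity, (c + N * Lam) * (1 / δ) ^ (k a - 1), by positivity, ?_⟩
  intro q w S x z hq hw hS h p
  set p₀ : PVar n m := Function.update p a 0 with hp₀
  set π : PVar n m := Pi.single a (p a) with hπ
  have hp : p = p₀ + π := by
    ext b
    by_cases hb : b = a
    · subst hb; simp [hp₀, hπ]
    · simp [hp₀, hπ, hb]
  set y : CoeffArg n m := (x, z, p₀) with hy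
  set v : CoeffArg n m := (0, 0, π) with hv
  have hyt (t : ℝ) : y + t • v = (x, z, p₀ + t • π) := by simp [hy, hv]
  have hVt (t : ℝ) : V (y + t • v) a = wt ((0 : Fin (m a) → Fin n → ℝ) + t • (p a - 0)) := by
    rw [hyt]
    change wt ((p₀ + t • π) a) = _
    simp [hp₀, hπ]
  have hVc : Continuous fun t : ℝ => V (y + t • v) a ^ (k a - 2) := by
    simp only [hVt]
    exact (continuous_wt.comp (by fun_prop)).rpow_const fun _ => Or.inr (by linarith [hk a])
  have key := integral_le_pairing_sub hq hw π 0 (y := y) (v := v)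
    (fun t _ => by rw [hyt]; exact hS _)
    (ℓ := fun t => lam * (V (y + t • v) a ^ (k a - 2) * ‖p a‖ ^ 2))
    (continuous_const.mul (hVc.mul continuous_const)) (Eventually.of_forall fun t => ?_)
  · simp only [integral_const_mul, integral_mul_const, hVt] at key
    have h1 := le_integral_wt_rpow (0 : Fin (m a) → Fin n → ℝ) (p a)
      (by linarith [hk a] : 0 ≤ k a - 2)
    rw [max_eq_right (wt_mono (by simp))] at h1
    have hyv : y + v = (x, z, p) := by
      have := hyt 1
      rwa [one_smul, one_smul, ← hp] at this
    have pe (Q : PVar n m) (w' : ZVar m) : pairing π 0 Q w' = dot2 (p a) (Q a) := by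
      rw [pairing_eq, Finset.sum_eq_single a]
      · simp [hπ, dot1]
      · intro b _ hb
        simp [hπ, dot1, dot2, hb]
      · simp
    rw [hyv, pe, pe] at key
    have g1 : ‖q y a‖ ≤ Lam := by
      have h2 := (h p₀).q_growth a
      have h3 : V (x, z, p₀) a = 1 := by
        change wt (p₀ a) = 1
        simp [hp₀, wt]
      rw [h3, Real.one_rpow, mul_one] at h2
      have := norm_nonneg (dx q (x, z, p₀) a)
      change ‖q (x, z, p₀) a‖ ≤ Lam
      linarith
    have hv1 := one_le_wt (p a)
    have hv0 := wt_pos (p a)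
    have g2 := (abs_le.1 (abs_dot2_le (m := m) a (p a) (q y a))).1
    have g3 : ‖p a‖ * ‖q y a‖ ≤ wt (p a) ^ (k a - 1) * Lam := by
      refine mul_le_mul ?_ g1 (norm_nonneg _) (Real.rpow_nonneg hv0.le _)
      exact (norm_le_wt _).trans (Real.self_le_rpow_of_one_le hv1 (by linarith [hk a]))
    have e1 : wt (p a) ^ (k a - 2) * ‖p a‖ ^ 2 = wt (p a) ^ k a - wt (p a) ^ (k a - 2) := by
      have : ‖p a‖ ^ 2 = wt (p a) ^ 2 - 1 := by rw [wt_sq]; ring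
      rw [this, mul_sub, mul_one, ← Real.rpow_natCast (wt (p a)) 2, ← Real.rpow_add hv0]
      norm_num
    have g4 : c * (wt (p a) ^ k a - wt (p a) ^ (k a - 2)) ≤
        lam * ((∫ t, wt ((0 : Fin (m a) → Fin n → ℝ) + t • (p a - 0)) ^ (k a - 2) ∂unitMeasure) *
          ‖p a‖ ^ 2) := by
      rw [← e1, hc, mul_assoc, ← mul_assoc (segConst _)]
      have := mul_le_mul_of_nonneg_right h1 (sq_nonneg ‖p a‖)
      exact mul_le_mul_of_nonneg_left this hlam.le
    have g5 : wt (p a) ^ (k a - 2) ≤ wt (p a) ^ (k a - 1) :=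
      Real.rpow_le_rpow_of_exponent_le hv1 (by linarith)
    have g6 := rpow_sub_one_le hv1 hδ0 (by linarith [hk a] : 1 ≤ k a)
    have g7 := mul_le_mul_of_nonneg_left g6 hcN.le
    have e2 : (c + N * Lam) * (δ * wt (p a) ^ k a + (1 / δ) ^ (k a - 1)) =
        c / 2 * wt (p a) ^ k a + (c + N * Lam) * (1 / δ) ^ (k a - 1) := by
      rw [mul_add, ← mul_assoc, hδ, mul_div_cancel₀ _ hcN.ne']
    have g8 := mul_le_mul_of_nonneg_left g3 hN0.le
    have g9 := mul_le_mul_of_nonneg_left g5 hc0.le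
    rw [e2] at g7
    linarith
  · have ht := h (p₀ + t • π)
    rw [← hyt] at ht
    refine ⟨ht.diff_q, ht.diff_w, ?_⟩
    have he := ht.elliptic π
    rw [sum_elliptic_eq] at he
    have e1 (b : Fin 2) : fderiv ℝ q (y + t • v) v b =
        ∑ b', ∑ j, ∑ β, π b' j β • dp q (y + t • v) b b' j β := by
      rw [hv, fderiv_coeff_apply]
      have : ((0, 0, 0) : CoeffArg n m) = 0 := rfl
      simp [this]
    rw [pairing_eq]
    simp only [e1, Pi.zero_apply]
    have e2 (f : ZVar m) : ∑ a, dot1 ((0 : ZVar m) a) (f a) = 0 := by simp [dot1]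
    rw [Finset.sum_add_distrib]
    have e3 := e2 (fderiv ℝ w (y + t • v) v)
    simp only [Pi.zero_apply] at e3
    rw [e3, add_zero]
    refine le_trans (le_of_eq ?_) he
    rw [Finset.sum_eq_single a]
    · simp [hπ]
    · intro b _ hb
      simp [hπ, hb]
    · simp

end Increment

/-! ### Test fields and local systems -/

section Elementary

theorem rpow_sub_one_mul_le {a b k : ℝ} (ha : 0 ≤ a) (hb : 0 ≤ b) (hk : 1 ≤ k) :
    a ^ (k - 1) * b ≤ a ^ k + b ^ k := by
  have ha' := Real.rpow_nonneg ha k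
  have hb' := Real.rpow_nonneg hb k
  have key {c : ℝ} (hc : 0 ≤ c) : c ^ (k - 1) * c = c ^ k := by
    rcases hc.eq_or_lt with rfl | h
    · rw [mul_zero, Real.zero_rpow (by linarith)]
    · rw [← Real.rpow_add_one h.ne']; ring_nf
  rcases le_total a b with h | h
  · have := mul_le_mul_of_nonneg_right (Real.rpow_le_rpow ha h (by linarith : 0 ≤ k - 1)) hb
    rw [key hb] at this
    linarith
  · have := mul_le_mul_of_nonneg_left h (Real.rpow_nonneg ha (k - 1))
    rw [key ha] at this
    linarith

theorem rpow_sub_two_mul_le {a b k : ℝ} (ha : 0 ≤ a) (hb : 0 ≤ b) (hk : 2 ≤ k) :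
    a ^ (k - 2) * b ^ 2 ≤ a ^ k + b ^ k := by
  have ha' := Real.rpow_nonneg ha k
  have hb' := Real.rpow_nonneg hb k
  have key {c : ℝ} (hc : 0 ≤ c) : c ^ (k - 2) * c ^ 2 = c ^ k := by
    rcases hc.eq_or_lt with rfl | h
    · rw [Real.zero_rpow (by linarith : k ≠ 0)]; simp
    · rw [← Real.rpow_natCast c 2, ← Real.rpow_add h]; norm_num
  rcases le_total a b with h | h
  · have := mul_le_mul_of_nonneg_right (Real.rpow_le_rpow ha h (by linarith : 0 ≤ k - 2))
      (sq_nonneg b)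
    rw [key hb] at this
    linarith
  · have := mul_le_mul_of_nonneg_left (pow_le_pow_left₀ hb h 2) (Real.rpow_nonneg ha (k - 2))
    rw [key ha] at this
    linarith

theorem wt_rpow_le {F : Type*} [NormedAddCommGroup F] (p : F) {k : ℝ} (hk : 0 ≤ k) :
    wt p ^ k ≤ 2 ^ k * (1 + ‖p‖ ^ k) := by
  have h0 := norm_nonneg p
  have h1 : wt p ≤ 2 * max 1 ‖p‖ := by
    have := wt_le_one_add p
    have := le_max_left 1 ‖p‖
    have := le_max_right 1 ‖p‖
    linarith
  refine (Real.rpow_le_rpow (wt_pos p).le h1 hk).trans ?_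
  rw [Real.mul_rpow (by norm_num) (by positivity)]
  gcongr
  have := Real.rpow_nonneg h0 k
  rcases le_total 1 ‖p‖ with h | h
  · rw [max_eq_right h]; linarith
  · rw [max_eq_left h, Real.one_rpow]; linarith

theorem integrable_norm_rpow_of_memLp {α F : Type*} [MeasurableSpace α] {μ : Measure α}
    [NormedAddCommGroup F] {f : α → F} {r : ℝ} (hr : 0 < r) (hf : MemLp f (ENNReal.ofReal r) μ) :
    Integrable (fun x => ‖f x‖ ^ r) μ := by
  have := hf.integrable_norm_rpow (by simpa using hr) (by simp)
  rwa [ENNReal.toReal_ofReal hr.le] at this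

end Elementary

section LocalSystem

variable {n : ℕ} {m : Fin 2 → ℕ}

/-- A test field supported in `K`, with its weak gradient. The representative of the gradient is
required to vanish everywhere outside `K`. -/
structure IsTestField (k : Fin 2 → ℝ) (K : Set (Fin n → ℝ)) (ξ : (Fin n → ℝ) → ZVar m)
    (Dξ : (Fin n → ℝ) → PVar n m) : Prop where
  cont : Continuous ξ
  zero : ∀ x ∉ K, ξ x = 0
  grad_zero : ∀ x ∉ K, Dξ x = 0
  weak : ∀ a i γ, HasWeakPartial γ (fun x => ξ x a i) (fun x => Dξ x a i γ)
  memLp : ∀ a i γ, MemLp (fun x => Dξ x a i γ) (ENNReal.ofReal (k a))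

/-- A weak solution of a weakly coupled system on a compact set `K`, cut off outside `K` so that
it and its gradient are defined on the whole space. The gradient of the first block has the
additional integrability that the coupling requires. The structure conditions are required for
`|z| ≤ R`, where `R` bounds the solution on `K`. -/
structure LocalSystem (k : Fin 2 → ℝ) (q : CoeffArg n m → PVar n m) (w : CoeffArg n m → ZVar m)
    (lam Lam R : ℝ) (K : Set (Fin n → ℝ)) (Z : (Fin n → ℝ) → ZVar m)
    (P : (Fin n → ℝ) → PVar n m) : Prop where
  two_le : ∀ a, 2 ≤ k a
  lam_pos : 0 < lam
  Lam_pos : 0 < Lam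
  compact : IsCompact K
  cont : Continuous Z
  supp : HasCompactSupport Z
  weak : ∀ a i γ, HasWeakPartial γ (fun x => Z x a i) (fun x => P x a i γ)
  memLp : ∀ a i γ, MemLp (fun x => P x a i γ) (ENNReal.ofReal (k a))
  memLp_zero : ∀ i γ, MemLp (fun x => P x 0 i γ) (ENNReal.ofReal (2 * k 1))
  lip_q : LocallyLipschitzOn (K ×ˢ univ) q
  lip_w : LocallyLipschitzOn (K ×ˢ univ) w
  cond : ∀ᵐ x, x ∈ K → ∀ z p, ‖z‖ ≤ R → WeaklyCoupledAt k q w lam Lam (x, z, p)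
  bound : ∀ x ∈ K, ‖Z x‖ ≤ R
  eq : ∀ (ξ : (Fin n → ℝ) → ZVar m) (Dξ : (Fin n → ℝ) → PVar n m), IsTestField k K ξ Dξ →
    ∫ x, pairing (Dξ x) (ξ x) (q (x, Z x, P x)) (w (x, Z x, P x)) = 0

theorem IsTestField.mono {k : Fin 2 → ℝ} {K K' : Set (Fin n → ℝ)} {ξ : (Fin n → ℝ) → ZVar m}
    {Dξ : (Fin n → ℝ) → PVar n m} (h : IsTestField k K' ξ Dξ) (hK : K' ⊆ K) :
    IsTestField k K ξ Dξ :=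
  ⟨h.cont, fun x hx => h.zero x fun h' => hx (hK h'),
    fun x hx => h.grad_zero x fun h' => hx (hK h'),
    h.weak, h.memLp⟩

theorem IsTestField.translate {k : Fin 2 → ℝ} {K K' : Set (Fin n → ℝ)} {ξ : (Fin n → ℝ) → ZVar m}
    {Dξ : (Fin n → ℝ) → PVar n m} (h : IsTestField k K ξ Dξ) (v : Fin n → ℝ)
    (hK : ∀ x, x + v ∈ K → x ∈ K') :
    IsTestField k K' (fun x => ξ (x + v)) (fun x => Dξ (x + v)) where
  cont := h.cont.comp (continuous_add_const v)
  zero x hx := h.zero _ fun h' => hx (hK x h')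
  grad_zero x hx := h.grad_zero _ fun h' => hx (hK x h')
  weak a i γ := (h.weak a i γ).translate v
  memLp a i γ := (h.memLp a i γ).comp_measurePreserving (measurePreserving_add_right volume v)

theorem memLp_pVar {P : (Fin n → ℝ) → PVar n m} {a : Fin 2} {p : ℝ≥0∞}
    (h : ∀ i γ, MemLp (fun x => P x a i γ) p) : MemLp (fun x => P x a) p :=
  memLp_pi_iff.2 fun i => memLp_pi_iff.2 fun γ => h i γ

theorem aestronglyMeasurable_pairing {μ : Measure (Fin n → ℝ)} {A Q : (Fin n → ℝ) → PVar n m}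
    {B W : (Fin n → ℝ) → ZVar m} (hA : AEMeasurable A μ) (hB : AEMeasurable B μ)
    (hQ : AEMeasurable Q μ) (hW : AEMeasurable W μ) :
    AEStronglyMeasurable (fun x => pairing (A x) (B x) (Q x) (W x)) μ := by
  have comp {F : (Fin n → ℝ) → ZVar m} (hF : AEMeasurable F μ) (a : Fin 2) (i : Fin (m a)) :
      AEMeasurable (fun x => F x a i) μ :=
    aemeasurable_pi_iff.1 (aemeasurable_pi_iff.1 hF a) i
  have comp' {F : (Fin n → ℝ) → PVar n m} (hF : AEMeasurable F μ) (a : Fin 2) (i : Fin (m a))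
      (α : Fin n) : AEMeasurable (fun x => F x a i α) μ :=
    aemeasurable_pi_iff.1 (aemeasurable_pi_iff.1 (aemeasurable_pi_iff.1 hF a) i) α
  refine AEMeasurable.aestronglyMeasurable ?_
  unfold pairing
  refine Finset.aemeasurable_fun_sum _ fun a _ => Finset.aemeasurable_fun_sum _ fun i _ =>
    AEMeasurable.add (Finset.aemeasurable_fun_sum _ fun α _ => ?_) ?_
  · exact (comp' hA a i α).mul (comp' hQ a i α)
  · exact (comp hB a i).mul (comp hW a i)

namespace LocalSystem

variable {k : Fin 2 → ℝ} {q : CoeffArg n m → PVar n m} {w : CoeffArg n m → ZVar m}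
  {lam Lam R : ℝ} {K : Set (Fin n → ℝ)} {Z : (Fin n → ℝ) → ZVar m} {P : (Fin n → ℝ) → PVar n m}

theorem mono (h : LocalSystem k q w lam Lam R K Z P) {K' : Set (Fin n → ℝ)} (hK' : IsCompact K')
    (hK : K' ⊆ K) : LocalSystem k q w lam Lam R K' Z P :=
  { h with
    compact := hK'
    lip_q := h.lip_q.mono (prod_mono hK le_rfl)
    lip_w := h.lip_w.mono (prod_mono hK le_rfl)
    cond := h.cond.mono fun _ hx hxK => hx (hK hxK)
    bound := fun x hx => h.bound x (hK hx)
    eq := fun ξ Dξ hξ => h.eq ξ Dξ (hξ.mono hK) }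

theorem k_pos (h : LocalSystem k q w lam Lam R K Z P) (a : Fin 2) : 0 < k a := by
  linarith [h.two_le a]

theorem memLp_grad (h : LocalSystem k q w lam Lam R K Z P) (a : Fin 2) :
    MemLp (fun x => P x a) (ENNReal.ofReal (k a)) :=
  memLp_pVar (h.memLp a)

theorem integrable_grad_rpow (h : LocalSystem k q w lam Lam R K Z P) (a : Fin 2) :
    Integrable fun x => ‖P x a‖ ^ k a :=
  integrable_norm_rpow_of_memLp (h.k_pos a) (h.memLp_grad a)

theorem aemeasurable_grad (h : LocalSystem k q w lam Lam R K Z P) : AEMeasurable P :=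
  aemeasurable_pi_lambda _ fun a => (h.memLp_grad a).aestronglyMeasurable.aemeasurable

theorem aestronglyMeasurable_wt (h : LocalSystem k q w lam Lam R K Z P) (a : Fin 2) :
    AEStronglyMeasurable fun x => wt (P x a) :=
  continuous_wt.comp_aestronglyMeasurable (h.memLp_grad a).aestronglyMeasurable

theorem aestronglyMeasurable_wt_rpow (h : LocalSystem k q w lam Lam R K Z P) (a : Fin 2) (s : ℝ) :
    AEStronglyMeasurable fun x => wt (P x a) ^ s :=
  ((h.aestronglyMeasurable_wt a).aemeasurable.pow_const s).aestronglyMeasurable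

theorem integrableOn_wt_rpow (h : LocalSystem k q w lam Lam R K Z P) (a : Fin 2)
    {S : Set (Fin n → ℝ)} (hS : volume S ≠ ⊤) :
    IntegrableOn (fun x => wt (P x a) ^ k a) S := by
  have h1 : IntegrableOn (fun x => 2 ^ k a * (1 + ‖P x a‖ ^ k a)) S :=
    ((integrableOn_const hS).add (h.integrable_grad_rpow a).integrableOn).const_mul _
  refine h1.mono' (h.aestronglyMeasurable_wt_rpow a _).restrict (Eventually.of_forall fun x => ?_)
  rw [Real.norm_of_nonneg (Real.rpow_nonneg (wt_pos _).le _)]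
  exact wt_rpow_le _ (h.k_pos a).le

theorem aestronglyMeasurable_coeff {F : Type*} [NormedAddCommGroup F] [NormedSpace ℝ F]
    [FiniteDimensional ℝ F] (h : LocalSystem k q w lam Lam R K Z P)
    {c : CoeffArg n m → F} (hc : LocallyLipschitzOn (K ×ˢ univ) c) :
    AEStronglyMeasurable (fun x => c (x, Z x, P x)) (volume.restrict K) := by
  classical
  borelize F
  have hS : MeasurableSet (K ×ˢ (univ : Set (ZVar m × PVar n m))) :=
    h.compact.measurableSet.prod MeasurableSet.univ
  have h1 : Measurable ((K ×ˢ univ).piecewise c 0) :=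
    hc.continuousOn.measurable_piecewise continuousOn_const hS
  have h2 : AEMeasurable (fun x => (x, Z x, P x)) :=
    aemeasurable_id.prodMk (h.cont.measurable.aemeasurable.prodMk h.aemeasurable_grad)
  have := FiniteDimensional.proper ℝ F
  refine (((h1.comp_aemeasurable h2).mono_measure Measure.restrict_le_self).congr
    ?_).aestronglyMeasurable
  filter_upwards [ae_restrict_mem h.compact.measurableSet] with x hx
  exact piecewise_eq_of_mem _ _ _ (mk_mem_prod hx (mem_univ _))

end LocalSystem

/-- The contribution of the second block to the growth of `w₁`. -/
noncomputable def couplingTerm (k : Fin 2 → ℝ) (p : PVar n m) (a : Fin 2) : ℝ :=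
  if a = 0 then wt (p 1) ^ (k 1 - 1) else 0

theorem couplingTerm_nonneg (k : Fin 2 → ℝ) (p : PVar n m) (a : Fin 2) :
    0 ≤ couplingTerm k p a := by
  unfold couplingTerm
  split_ifs
  · exact Real.rpow_nonneg (wt_pos _).le _
  · exact le_rfl

theorem couplingTerm_le {k : Fin 2 → ℝ} (p : PVar n m) (a : Fin 2) :
    couplingTerm k p a ≤ wt (p 1) ^ k 1 := by
  unfold couplingTerm
  split_ifs
  · exact Real.rpow_le_rpow_of_exponent_le (one_le_wt _) (by linarith)
  · exact Real.rpow_nonneg (wt_pos _).le _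

namespace LocalSystem

variable {k : Fin 2 → ℝ} {q : CoeffArg n m → PVar n m} {w : CoeffArg n m → ZVar m}
  {lam Lam R : ℝ} {K : Set (Fin n → ℝ)} {Z : (Fin n → ℝ) → ZVar m} {P : (Fin n → ℝ) → PVar n m}

theorem ae_cond (h : LocalSystem k q w lam Lam R K Z P) :
    ∀ᵐ x ∂(volume.restrict K), ∀ p, WeaklyCoupledAt k q w lam Lam (x, Z x, p) := by
  rw [ae_restrict_iff' h.compact.measurableSet]
  filter_upwards [h.cond] with x hx hxK p
  exact hx hxK _ _ (h.bound x hxK)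

theorem _root_.WeaklyCoupledAt.norm_q_le {x : Fin n → ℝ} {z : ZVar m} {p : PVar n m}
    (h : WeaklyCoupledAt k q w lam Lam (x, z, p)) (a : Fin 2) :
    ‖q (x, z, p) a‖ ≤ Lam * wt (p a) ^ (k a - 1) :=
  le_trans (by linarith [norm_nonneg (dx q (x, z, p) a)]) (h.q_growth a)

theorem _root_.WeaklyCoupledAt.norm_w_le {x : Fin n → ℝ} {z : ZVar m} {p : PVar n m}
    (h : WeaklyCoupledAt k q w lam Lam (x, z, p)) (a : Fin 2) :
    ‖w (x, z, p) a‖ ≤ Lam * (wt (p a) ^ k a + couplingTerm k p a) := by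
  match a with
  | 0 => exact le_trans (by linarith [norm_nonneg (dx w (x, z, p) 0)]) h.w_one
  | 1 =>
    refine le_trans (by linarith [norm_nonneg (dx w (x, z, p) 1)]) (h.w_two.trans_eq ?_)
    simp [couplingTerm, V, wt]

theorem integrable_pairing (h : LocalSystem k q w lam Lam R K Z P) {ξ : (Fin n → ℝ) → ZVar m}
    {Dξ : (Fin n → ℝ) → PVar n m} (hξ : IsTestField k K ξ Dξ) :
    Integrable fun x => pairing (Dξ x) (ξ x) (q (x, Z x, P x)) (w (x, Z x, P x)) := by
  have hK : volume K ≠ ⊤ := h.compact.measure_lt_top.ne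
  have hDξ (a : Fin 2) : MemLp (fun x => Dξ x a) (ENNReal.ofReal (k a)) := memLp_pVar (hξ.memLp a)
  obtain ⟨C, hC⟩ := (HasCompactSupport.intro h.compact hξ.zero).exists_bound_of_continuous hξ.cont
  have hC0 : 0 ≤ C := (norm_nonneg _).trans (hC 0)
  have hm : AEStronglyMeasurable
      (fun x => pairing (Dξ x) (ξ x) (q (x, Z x, P x)) (w (x, Z x, P x))) (volume.restrict K) := by
    refine aestronglyMeasurable_pairing ?_ hξ.cont.measurable.aemeasurable
      (h.aestronglyMeasurable_coeff h.lip_q).aemeasurable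
      (h.aestronglyMeasurable_coeff h.lip_w).aemeasurable
    exact (aemeasurable_pi_lambda _ fun a =>
      (hDξ a).aestronglyMeasurable.aemeasurable).mono_measure Measure.restrict_le_self
  refine IntegrableOn.integrable_of_forall_notMem_eq_zero (s := K) ?_ ?_
  · have hg : IntegrableOn (fun x => dimConst n m *
        ∑ a, (Lam * (wt (P x a) ^ k a + ‖Dξ x a‖ ^ k a) +
        C * (Lam * (wt (P x a) ^ k a + wt (P x 1) ^ k 1)))) K := by
      refine Integrable.const_mul (integrable_finsetSum _ fun a _ => ?_) _
      have i1 := h.integrableOn_wt_rpow a hK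
      have i2 := h.integrableOn_wt_rpow 1 hK
      have i3 := (integrable_norm_rpow_of_memLp (h.k_pos a) (hDξ a)).integrableOn (s := K)
      have i4 : IntegrableOn (fun x => Lam * (wt (P x a) ^ k a + ‖Dξ x a‖ ^ k a)) K :=
        (i1.add i3).const_mul Lam
      have i5 : IntegrableOn (fun x => Lam * (wt (P x a) ^ k a + wt (P x 1) ^ k 1)) K :=
        (i1.add i2).const_mul Lam
      exact i4.add (i5.const_mul C)
    refine hg.mono' ?_ ?_
    · exact hm
    · filter_upwards [h.ae_cond] with x hx
      refine (abs_pairing_le _ _ _ _).trans (mul_le_mul_of_nonneg_left (Finset.sum_le_sum fun a _ =>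
        add_le_add ?_ ?_) (zero_le_one.trans one_le_dimConst : 0 ≤ dimConst n m))
      · have h1 := (hx (P x)).norm_q_le a
        have h2 := rpow_sub_one_mul_le (wt_pos (P x a)).le (norm_nonneg (Dξ x a))
          (by linarith [h.two_le a] : 1 ≤ k a)
        calc ‖Dξ x a‖ * ‖q (x, Z x, P x) a‖ ≤ ‖Dξ x a‖ * (Lam * wt (P x a) ^ (k a - 1)) := by gcongr
          _ = Lam * (wt (P x a) ^ (k a - 1) * ‖Dξ x a‖) := by ring
          _ ≤ _ := mul_le_mul_of_nonneg_left h2 h.Lam_pos.le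
      · have h1 := (hx (P x)).norm_w_le a
        have h2 := couplingTerm_le (k := k) (P x) a
        have h3 := h.Lam_pos.le
        refine mul_le_mul ((norm_le_pi_norm _ a).trans (hC x)) (h1.trans ?_) (norm_nonneg _) hC0
        gcongr
  · intro x hx
    rw [hξ.zero x hx, hξ.grad_zero x hx]
    simp [pairing]

end LocalSystem

end LocalSystem

/-! ### Small oscillation -/

namespace LocalSystem

variable {n : ℕ} {m : Fin 2 → ℕ} {k : Fin 2 → ℝ} {q : CoeffArg n m → PVar n m}
  {w : CoeffArg n m → ZVar m} {lam Lam R : ℝ} {K : Set (Fin n → ℝ)} {Z : (Fin n → ℝ) → ZVar m}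
  {P : (Fin n → ℝ) → PVar n m}

theorem aestronglyMeasurable_couplingTerm (h : LocalSystem k q w lam Lam R K Z P) (a : Fin 2) :
    AEStronglyMeasurable fun x => couplingTerm k (P x) a := by
  unfold couplingTerm
  split_ifs
  · exact h.aestronglyMeasurable_wt_rpow 1 _
  · exact aestronglyMeasurable_const

/-- The test field `(z_a - c_a) ψ` in the block `a`. -/
theorem isTestField_single (h : LocalSystem k q w lam Lam R K Z P) (c : ZVar m) (a : Fin 2)
    {ψ : (Fin n → ℝ) → ℝ} {Dψ : (Fin n → ℝ) → Fin n → ℝ} (hψ : Continuous ψ)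
    (hψK : ∀ x ∉ K, ψ x = 0) (hDK : ∀ x ∉ K, Dψ x = 0)
    (hw : ∀ γ, HasWeakPartial γ ψ fun x => Dψ x γ)
    (hD : ∀ γ, MemLp (fun x => Dψ x γ) (ENNReal.ofReal (k a))) :
    IsTestField k K (fun x => Pi.single a (ψ x • (Z x - c) a))
      (fun x => Pi.single a (ψ x • P x a + fun i γ => Dψ x γ * (Z x - c) a i)) := by
  have hψs : HasCompactSupport ψ := HasCompactSupport.intro h.compact hψK
  obtain ⟨B, hB⟩ := hψs.exists_bound_of_continuous hψ
  obtain ⟨B', hB'⟩ := h.supp.exists_bound_of_continuous h.cont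
  have hZc (b : Fin 2) (i : Fin (m b)) : Continuous fun x => Z x b i :=
    (continuous_apply i).comp ((continuous_apply b).comp h.cont)
  have hZs (b : Fin 2) (i : Fin (m b)) : HasCompactSupport fun x => Z x b i :=
    h.supp.comp_left (g := fun z : ZVar m => z b i) rfl
  refine ⟨?_, fun x hx => ?_, fun x hx => ?_, fun b i γ => ?_, fun b i γ => ?_⟩
  · refine (continuous_single a).comp (hψ.smul ?_)
    exact (continuous_apply a).comp (h.cont.sub continuous_const)
  · simp [hψK x hx]
  · simp only [hψK x hx, hDK x hx, zero_smul, Pi.zero_apply, zero_mul, zero_add]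
    exact Pi.single_zero a
  · by_cases hb : b = a
    · subst hb
      have := ((h.weak b i γ).mul (hw γ) (hZc b i) (hZs b i) hψ hψs).sub ((hw γ).const_mul (c b i))
      simp only [Pi.single_eq_same]
      convert this using 2 with x x
      · simp only [Pi.smul_apply, Pi.sub_apply, smul_eq_mul]; ring
      · simp only [Pi.add_apply, Pi.smul_apply, Pi.sub_apply, smul_eq_mul]; ring
    · simp only [Pi.single_eq_of_ne hb, Pi.zero_apply]
      exact ⟨integrable_zero _ _ _, integrable_zero _ _ _, by simp⟩
  · by_cases hb : b = a
    · subst hb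
      simp only [Pi.single_eq_same, Pi.add_apply, Pi.smul_apply, smul_eq_mul]
      refine MemLp.add ?_ ?_
      · refine MemLp.of_le_mul (c := B) (h.memLp b i γ)
          (hψ.aestronglyMeasurable.mul (h.memLp b i γ).aestronglyMeasurable)
          (Eventually.of_forall fun x => ?_)
        rw [norm_mul]
        exact mul_le_mul_of_nonneg_right (hB x) (norm_nonneg _)
      · refine MemLp.of_le_mul (c := B' + ‖c‖) (hD γ)
          ((hD γ).aestronglyMeasurable.mul ((hZc b i).sub continuous_const).aestronglyMeasurable)
          (Eventually.of_forall fun x => ?_)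
        rw [norm_mul, mul_comm]
        refine mul_le_mul_of_nonneg_right ?_ (norm_nonneg _)
        refine (norm_le_pi_norm ((Z x - c) b) i).trans ((norm_le_pi_norm (Z x - c) b).trans ?_)
        exact (norm_sub_le _ _).trans (add_le_add (hB' x) le_rfl)
    · simp only [Pi.single_eq_of_ne hb, Pi.zero_apply]
      exact MemLp.zero'

/-- A consequence of testing the equation with `(z_a - c_a) ψ`: where `z_a` oscillates little,
the integral of `V_a^{k_a} ψ` is controlled by a small multiple of an integral of `∇ψ`. -/
theorem exists_oscillation (hk : ∀ a, 2 ≤ k a) (hlam : 0 < lam) (hLam : 0 < Lam) (n : ℕ)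
    (m : Fin 2 → ℕ) (a : Fin 2) :
    ∃ C₀ > 0, ∃ osc₀ > 0, ∀ (q : CoeffArg n m → PVar n m) (w : CoeffArg n m → ZVar m) (R : ℝ)
      (K : Set (Fin n → ℝ)) (Z : (Fin n → ℝ) → ZVar m) (P : (Fin n → ℝ) → PVar n m),
      LocalSystem k q w lam Lam R K Z P → ∀ (c : ZVar m) (osc : ℝ), 0 ≤ osc → osc ≤ osc₀ →
      (∀ x ∈ K, ‖Z x - c‖ ≤ osc) → ∀ (ψ : (Fin n → ℝ) → ℝ)
      (Dψ : (Fin n → ℝ) → Fin n → ℝ), Continuous ψ → (∀ x, 0 ≤ ψ x) → (∀ x ∉ K, ψ x = 0) →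
      (∀ x ∉ K, Dψ x = 0) → (∀ γ, HasWeakPartial γ ψ fun x => Dψ x γ) →
      (∀ γ, MemLp (fun x => Dψ x γ) (ENNReal.ofReal (k a))) →
      Integrable (fun x => wt (P x a) ^ k a * ψ x) ∧
      Integrable (fun x => ψ x * (1 + couplingTerm k (P x) a)) ∧
      Integrable (fun x => wt (P x a) ^ (k a - 1) * ‖Dψ x‖) ∧
      ∫ x, wt (P x a) ^ k a * ψ x ≤ C₀ * (∫ x, ψ x * (1 + couplingTerm k (P x) a)) +
        C₀ * osc * ∫ x, wt (P x a) ^ (k a - 1) * ‖Dψ x‖ := by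
  obtain ⟨c₁, hc₁, C₁, hC₁, hco⟩ := exists_coercive (n := n) (m := m) hk hlam hLam a
  set N := dimConst n m with hN
  have hN0 : 0 < N := zero_lt_one.trans_le one_le_dimConst
  refine ⟨2 / c₁ * (C₁ + c₁ / 2 + N * Lam), by positivity, c₁ / (2 * (N * Lam)), by positivity, ?_⟩
  intro q w R K Z P h c osc hosc0 hosc hZ ψ Dψ hψ hψ0 hψK hDK hw hD
  have hψs : HasCompactSupport ψ := HasCompactSupport.intro h.compact hψK
  obtain ⟨B, hB⟩ := hψs.exists_bound_of_continuous hψ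
  have hKf : volume K ≠ ⊤ := h.compact.measure_lt_top.ne
  have hDm : MemLp Dψ (ENNReal.ofReal (k a)) := memLp_pi_iff.2 hD
  have hka : 1 ≤ k a := by linarith [hk a]
  have i1 : Integrable (fun x => wt (P x a) ^ k a * ψ x) := by
    refine IntegrableOn.integrable_of_forall_notMem_eq_zero (s := K) ?_ fun x hx => by
      rw [hψK x hx, mul_zero]
    exact (h.integrableOn_wt_rpow a hKf).mul_bdd hψ.aestronglyMeasurable (Eventually.of_forall hB)
  have i2 : Integrable (fun x => ψ x * (1 + couplingTerm k (P x) a)) := by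
    refine IntegrableOn.integrable_of_forall_notMem_eq_zero (s := K) ?_ fun x hx => by
      rw [hψK x hx, zero_mul]
    refine Integrable.bdd_mul ?_ hψ.aestronglyMeasurable (Eventually.of_forall hB)
    refine (integrableOn_const hKf).add ?_
    refine (h.integrableOn_wt_rpow 1 hKf).mono' (h.aestronglyMeasurable_couplingTerm a).restrict
      (Eventually.of_forall fun x => ?_)
    rw [Real.norm_of_nonneg (couplingTerm_nonneg _ _ _)]
    exact couplingTerm_le _ _
  have i3 : Integrable (fun x => wt (P x a) ^ (k a - 1) * ‖Dψ x‖) := by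
    refine IntegrableOn.integrable_of_forall_notMem_eq_zero (s := K) ?_ fun x hx => by
      rw [hDK x hx, norm_zero, mul_zero]
    refine ((h.integrableOn_wt_rpow a hKf).add
      (integrable_norm_rpow_of_memLp (h.k_pos a) hDm).integrableOn).mono'
      ((h.aestronglyMeasurable_wt_rpow a _).mul hDm.aestronglyMeasurable.norm).restrict
      (Eventually.of_forall fun x => ?_)
    rw [Real.norm_of_nonneg (mul_nonneg (Real.rpow_nonneg (wt_pos _).le _) (norm_nonneg _))]
    exact rpow_sub_one_mul_le (wt_pos _).le (norm_nonneg _) hka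
  refine ⟨i1, i2, i3, ?_⟩
  have htest := h.isTestField_single c a hψ hψK hDK hw hD
  -- For small `osc`, the term `(z_a - c_a) w_a ψ` costs half of the coercivity.
  have hNL : N * Lam * osc ≤ c₁ / 2 := by
    rw [le_div_iff₀ (by positivity)] at hosc
    linarith
  have key : ∫ x, (c₁ / 2 * (wt (P x a) ^ k a * ψ x) -
      (C₁ + c₁ / 2) * (ψ x * (1 + couplingTerm k (P x) a)) -
      N * Lam * osc * (wt (P x a) ^ (k a - 1) * ‖Dψ x‖)) ≤ 0 := by
    rw [← h.eq _ _ htest]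
    refine integral_mono_ae (((i1.const_mul _).sub (i2.const_mul _)).sub (i3.const_mul _))
      (h.integrable_pairing htest) ?_
    filter_upwards [h.cond] with x hx
    by_cases hxK : x ∈ K
    · have hxc := fun p => hx hxK (Z x) p (h.bound x hxK)
      have g1 := hco q w (K ×ˢ univ) x (Z x) h.lip_q h.lip_w
        (fun p => mk_mem_prod hxK (mem_univ _)) hxc (P x)
      have g2 := (hxc (P x)).norm_q_le a
      have g3 := (hxc (P x)).norm_w_le a
      have hV0 : 0 ≤ wt (P x a) ^ (k a - 1) := Real.rpow_nonneg (wt_pos _).le _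
      have hV1 : 0 ≤ wt (P x a) ^ k a := Real.rpow_nonneg (wt_pos _).le _
      have hT := couplingTerm_nonneg k (P x) a
      set Q := q (x, Z x, P x)
      set w' := w (x, Z x, P x)
      set T := couplingTerm k (P x) a
      have hza : ‖(Z x - c) a‖ ≤ osc := (norm_le_pi_norm _ a).trans (hZ x hxK)
      have e : pairing (Pi.single a (ψ x • P x a + fun i γ => Dψ x γ * (Z x - c) a i))
          (Pi.single a (ψ x • (Z x - c) a)) Q w' = ψ x * dot2 (P x a) (Q a) +
          dot2 (fun i γ => Dψ x γ * (Z x - c) a i) (Q a) + ψ x * dot1 ((Z x - c) a) (w' a) := by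
        rw [pairing_eq, Finset.sum_eq_single a]
        · simp only [Pi.single_eq_same, add_dot2, smul_dot2, smul_dot1]
        · intro b _ hb
          simp [dot1, dot2, hb]
        · simp
      have g4 := (abs_le.1 (abs_dot2_le (m := m) a (fun i γ => Dψ x γ * (Z x - c) a i) (Q a))).1
      have g5 := (abs_le.1 (abs_dot1_le n a ((Z x - c) a) (w' a))).1
      have g6 : ‖(fun i γ => Dψ x γ * (Z x - c) a i : Fin (m a) → Fin n → ℝ)‖ * ‖Q a‖ ≤
          (‖Dψ x‖ * osc) * (Lam * wt (P x a) ^ (k a - 1)) := by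
        refine mul_le_mul ((norm_outer_le _ _).trans ?_) g2 (norm_nonneg _) (by positivity)
        exact mul_le_mul_of_nonneg_left hza (norm_nonneg _)
      have g7 : ‖(Z x - c) a‖ * ‖w' a‖ ≤ osc * (Lam * (wt (P x a) ^ k a + T)) :=
        mul_le_mul hza g3 (norm_nonneg _) hosc0
      have g8 := mul_le_mul_of_nonneg_left g6 hN0.le
      have g9 := mul_le_mul_of_nonneg_left g7 hN0.le
      have g10 := mul_le_mul_of_nonneg_right hNL (add_nonneg hV1 hT)
      have g11 : -(c₁ / 2 * (wt (P x a) ^ k a + T)) ≤ dot1 ((Z x - c) a) (w' a) := by linarith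
      have f1 := mul_le_mul_of_nonneg_left g1 (hψ0 x)
      have f2 := mul_le_mul_of_nonneg_left g11 (hψ0 x)
      have f3 := mul_nonneg hC₁ (mul_nonneg (hψ0 x) hT)
      have f4 := mul_nonneg hc₁.le (hψ0 x)
      change _ ≤ pairing _ _ Q w'
      rw [e]
      linarith
    · have e1 : (Pi.single a (ψ x • P x a + fun i γ => Dψ x γ * (Z x - c) a i) : PVar n m) = 0 :=
        htest.grad_zero x hxK
      have e2 : (Pi.single a (ψ x • (Z x - c) a) : ZVar m) = 0 := htest.zero x hxK
      change _ ≤ pairing _ _ _ _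
      rw [e1, e2, hψK x hxK, hDK x hxK]
      simp [pairing]
  have i4 : Integrable fun x => c₁ / 2 * (wt (P x a) ^ k a * ψ x) -
      (C₁ + c₁ / 2) * (ψ x * (1 + couplingTerm k (P x) a)) :=
    (i1.const_mul _).sub (i2.const_mul _)
  rw [integral_sub i4 (i3.const_mul _), integral_sub (i1.const_mul _) (i2.const_mul _),
    integral_const_mul, integral_const_mul, integral_const_mul] at key
  have J2 : 0 ≤ ∫ x, ψ x * (1 + couplingTerm k (P x) a) := integral_nonneg fun x =>
    mul_nonneg (hψ0 x) (by linarith [couplingTerm_nonneg k (P x) a])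
  have J3 : 0 ≤ ∫ x, wt (P x a) ^ (k a - 1) * ‖Dψ x‖ := integral_nonneg fun x =>
    mul_nonneg (Real.rpow_nonneg (wt_pos _).le _) (norm_nonneg _)
  set I1 := ∫ x, wt (P x a) ^ k a * ψ x
  set I2 := ∫ x, ψ x * (1 + couplingTerm k (P x) a)
  set I3 := ∫ x, wt (P x a) ^ (k a - 1) * ‖Dψ x‖
  have hNL0 : 0 ≤ N * Lam := by positivity
  have f1 : c₁ / 2 * I1 ≤ (C₁ + c₁ / 2 + N * Lam) * (I2 + osc * I3) := by
    have p1 := mul_nonneg hNL0 J2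
    have p2 := mul_nonneg (add_nonneg hC₁ (by positivity : 0 ≤ c₁ / 2)) (mul_nonneg hosc0 J3)
    linarith
  have f2 := mul_le_mul_of_nonneg_left f1 (by positivity : 0 ≤ 2 / c₁)
  have e3 : 2 / c₁ * (c₁ / 2 * I1) = I1 := by field_simp
  rw [e3] at f2
  linarith

end LocalSystem

/-! ### Difference quotients and their integrability -/

section DiffQuot

variable {n : ℕ}

/-- The difference quotient of step `h` in the direction of the coordinate `γ`. -/
noncomputable def diffQuot {F : Type*} [NormedAddCommGroup F] [NormedSpace ℝ F] (γ : Fin n) (h : ℝ)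
    (f : (Fin n → ℝ) → F) (x : Fin n → ℝ) : F := h⁻¹ • (f (x + h • Pi.single γ 1) - f x)

/-- Difference quotients are bounded in `L^r` by the weak derivative. -/
theorem HasWeakPartial.integral_diffQuot_rpow_le {γ : Fin n} {u g : (Fin n → ℝ) → ℝ}
    (hu : HasWeakPartial γ u g) {r : ℝ} (hr : 1 ≤ r) (hg : MemLp g (ENNReal.ofReal r)) {h : ℝ}
    (hh : h ≠ 0) :
    Integrable (fun x => ‖diffQuot γ h u x‖ ^ r) ∧
      ∫ x, ‖diffQuot γ h u x‖ ^ r ≤ ∫ x, ‖g x‖ ^ r := by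
  have hr0 : 0 < r := by linarith
  have e (f : (Fin n → ℝ) → ℝ) (x : Fin n → ℝ) : ENNReal.ofReal (‖f x‖ ^ r) = ‖f x‖ₑ ^ r := by
    rw [← ENNReal.ofReal_rpow_of_nonneg (norm_nonneg _) hr0.le, ofReal_norm]
  have hgi := integrable_norm_rpow_of_memLp hr0 hg
  have hle : ∫⁻ x, ‖diffQuot γ h u x‖ₑ ^ r ≤ ∫⁻ x, ‖g x‖ₑ ^ r := by
    have h1 := hu.lintegral_translate_sub_le h hr
    have h2 : ∀ x, ‖diffQuot γ h u x‖ₑ ^ r =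
        ‖h⁻¹‖ₑ ^ r * ‖u (x + h • Pi.single γ 1) - u x‖ₑ ^ r := fun x => by
      rw [diffQuot, smul_eq_mul, enorm_mul, ENNReal.mul_rpow_of_nonneg _ _ hr0.le]
    simp only [h2]
    rw [lintegral_const_mul' _ _ (ENNReal.rpow_ne_top_of_nonneg hr0.le (by simp))]
    calc _ ≤ ‖h⁻¹‖ₑ ^ r * (‖h‖ₑ ^ r * ∫⁻ x, ‖g x‖ₑ ^ r) := by gcongr
      _ = _ := by
        rw [← mul_assoc, ← ENNReal.mul_rpow_of_nonneg _ _ hr0.le, ← enorm_mul,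
          inv_mul_cancel₀ hh]
        simp
  have hfin : ∫⁻ x, ‖g x‖ₑ ^ r ≠ ⊤ := by
    have := hgi.2
    rw [hasFiniteIntegral_iff_ofReal (Eventually.of_forall fun x => by positivity)] at this
    simpa only [e] using this.ne
  have hm : AEStronglyMeasurable (diffQuot γ h u) :=
    ((integrable_comp_add hu.int (h • Pi.single γ 1)).sub
      hu.int).aestronglyMeasurable.const_smul h⁻¹
  have hm' : AEStronglyMeasurable fun x => ‖diffQuot γ h u x‖ ^ r :=
    (hm.norm.aemeasurable.pow_const r).aestronglyMeasurable
  have n1 : ∀ f : (Fin n → ℝ) → ℝ, 0 ≤ᵐ[volume] fun x => ‖f x‖ ^ r := fun f =>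
    Eventually.of_forall fun x => Real.rpow_nonneg (norm_nonneg _) r
  refine ⟨⟨hm', ?_⟩, ?_⟩
  · rw [hasFiniteIntegral_iff_ofReal (n1 _)]
    simp only [e]
    exact hle.trans_lt hfin.lt_top
  · rw [integral_eq_lintegral_of_nonneg_ae (n1 _) hm',
      integral_eq_lintegral_of_nonneg_ae (n1 _) hgi.aestronglyMeasurable]
    simp only [e]
    exact ENNReal.toReal_mono hfin hle

theorem norm_rpow_le_sum {m : ℕ} (x : Fin m → ℝ) {r : ℝ} (hr : 0 < r) :
    ‖x‖ ^ r ≤ ∑ i, ‖x i‖ ^ r := by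
  have h0 : 0 ≤ ∑ i, ‖x i‖ ^ r := Finset.sum_nonneg fun i _ => by positivity
  have h1 : ‖x‖ ≤ (∑ i, ‖x i‖ ^ r) ^ r⁻¹ := by
    refine (pi_norm_le_iff_of_nonneg (by positivity)).2 fun i => ?_
    rw [Real.le_rpow_inv_iff_of_pos (norm_nonneg _) h0 hr]
    exact Finset.single_le_sum (f := fun i => ‖x i‖ ^ r) (fun i _ => by positivity)
      (Finset.mem_univ i)
  exact (Real.le_rpow_inv_iff_of_pos (norm_nonneg _) h0 hr).1 h1

/-- The gradient of a smooth function, as a vector of partial derivatives. -/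
noncomputable def partials (η : (Fin n → ℝ) → ℝ) (x : Fin n → ℝ) : Fin n → ℝ :=
  fun α => fderiv ℝ η x (Pi.single α 1)

/-- A smooth cutoff function supported in `K`, with gradient bounded by `M`. -/
structure IsCutoff (η : (Fin n → ℝ) → ℝ) (K : Set (Fin n → ℝ)) (M : ℝ) : Prop where
  smooth : ContDiff ℝ ∞ η
  nonneg : ∀ x, 0 ≤ η x
  le_one : ∀ x, η x ≤ 1
  zero : ∀ x ∉ K, η x = 0
  grad_le : ∀ x, ‖partials η x‖ ≤ M

end DiffQuot

/-- The larger of the weights at the end points of the segment from `x` to `x + h e_γ`. -/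
noncomputable def maxWt {n : ℕ} {m : Fin 2 → ℕ} (γ : Fin n) (h : ℝ) (P : (Fin n → ℝ) → PVar n m)
    (x : Fin n → ℝ) (a : Fin 2) : ℝ := max (wt (P x a)) (wt (P (x + h • Pi.single γ 1) a))

section maxWt

variable {n : ℕ} {m : Fin 2 → ℕ} {γ : Fin n} {h : ℝ} {P : (Fin n → ℝ) → PVar n m} {x : Fin n → ℝ}
  {a : Fin 2}

theorem one_le_maxWt : 1 ≤ maxWt γ h P x a := (one_le_wt _).trans (le_max_left _ _)

theorem maxWt_pos : 0 < maxWt γ h P x a := zero_lt_one.trans_le one_le_maxWt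

theorem maxWt_rpow_le {r : ℝ} : maxWt γ h P x a ^ r ≤
    wt (P x a) ^ r + wt (P (x + h • Pi.single γ 1) a) ^ r := by
  have h1 := Real.rpow_nonneg (wt_pos (P x a)).le r
  have h2 := Real.rpow_nonneg (wt_pos (P (x + h • Pi.single γ 1) a)).le r
  unfold maxWt
  rcases max_choice (wt (P x a)) (wt (P (x + h • Pi.single γ 1) a)) with e | e <;> rw [e] <;>
    linarith

theorem maxWt_rpow_mul_sq {r : ℝ} : maxWt γ h P x a ^ (r - 2) * maxWt γ h P x a ^ 2 =
    maxWt γ h P x a ^ r := by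
  rw [← Real.rpow_natCast (maxWt γ h P x a) 2, ← Real.rpow_add maxWt_pos]; norm_num

theorem maxWt_rpow_mul {r : ℝ} : maxWt γ h P x a ^ (r - 2) * maxWt γ h P x a =
    maxWt γ h P x a ^ (r - 1) := by
  rw [← Real.rpow_add_one maxWt_pos.ne']; ring_nf

end maxWt

section Densities

variable {n : ℕ} {m : Fin 2 → ℕ}

/-- The energy density `η² W^{k-2} |Δ_h ∇z_a|²`. -/
noncomputable def energyDens (k : Fin 2 → ℝ) (γ : Fin n) (h : ℝ) (η : (Fin n → ℝ) → ℝ)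
    (P : (Fin n → ℝ) → PVar n m) (a : Fin 2) (x : Fin n → ℝ) : ℝ :=
  η x ^ 2 * maxWt γ h P x a ^ (k a - 2) * ‖diffQuot γ h P x a‖ ^ 2

/-- The critical density `η² W^k |Δ_h z_a|²`. -/
noncomputable def critDens (k : Fin 2 → ℝ) (γ : Fin n) (h : ℝ) (η : (Fin n → ℝ) → ℝ)
    (Z : (Fin n → ℝ) → ZVar m) (P : (Fin n → ℝ) → PVar n m) (a : Fin 2) (x : Fin n → ℝ) : ℝ :=
  η x ^ 2 * maxWt γ h P x a ^ (k a - 2) * maxWt γ h P x a ^ 2 * ‖diffQuot γ h Z x a‖ ^ 2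

/-- The sum of the densities whose integrals are bounded uniformly in the step `h`. -/
noncomputable def lowerDens (k : Fin 2 → ℝ) (γ : Fin n) (h : ℝ) (K : Set (Fin n → ℝ))
    (Z : (Fin n → ℝ) → ZVar m) (P : (Fin n → ℝ) → PVar n m) : (Fin n → ℝ) → ℝ :=
  K.indicator fun x => maxWt γ h P x 0 ^ (k 0 - 2) * maxWt γ h P x 0 ^ 2 +
    maxWt γ h P x 1 ^ (k 1 - 2) * maxWt γ h P x 1 ^ 2 +
    maxWt γ h P x 0 ^ (k 0 - 2) * ‖diffQuot γ h Z x 0‖ ^ 2 +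
    maxWt γ h P x 1 ^ (k 1 - 2) * ‖diffQuot γ h Z x 1‖ ^ 2 +
    maxWt γ h P x 1 ^ (k 1 - 2) * maxWt γ h P x 1 * ‖diffQuot γ h Z x 0‖ ^ 2

end Densities

namespace LocalSystem

variable {n : ℕ} {m : Fin 2 → ℕ} {k : Fin 2 → ℝ} {q : CoeffArg n m → PVar n m}
  {w : CoeffArg n m → ZVar m} {lam Lam R : ℝ} {K : Set (Fin n → ℝ)} {Z : (Fin n → ℝ) → ZVar m}
  {P : (Fin n → ℝ) → PVar n m}

theorem continuous_diffQuot (hs : LocalSystem k q w lam Lam R K Z P) (γ : Fin n) (h : ℝ) :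
    Continuous (diffQuot γ h Z) := by
  have := hs.cont
  unfold diffQuot
  fun_prop

theorem hasCompactSupport_diffQuot (hs : LocalSystem k q w lam Lam R K Z P) (γ : Fin n) (h : ℝ) :
    HasCompactSupport (diffQuot γ h Z) := by
  have h1 := (hasCompactSupport_comp_add hs.supp (h • Pi.single γ 1)).sub hs.supp
  exact h1.comp_left (g := fun z => h⁻¹ • z) (smul_zero _)

theorem weak_diffQuot (hs : LocalSystem k q w lam Lam R K Z P) (γ : Fin n) (h : ℝ) (a : Fin 2)
    (i : Fin (m a)) (α : Fin n) :
    HasWeakPartial α (fun x => diffQuot γ h Z x a i) (fun x => diffQuot γ h P x a i α) :=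
  (((hs.weak a i α).translate (h • Pi.single γ 1)).sub (hs.weak a i α)).const_mul h⁻¹

theorem memLp_diffQuot (hs : LocalSystem k q w lam Lam R K Z P) (γ : Fin n) (h : ℝ) (a : Fin 2)
    (i : Fin (m a)) (α : Fin n) :
    MemLp (fun x => diffQuot γ h P x a i α) (ENNReal.ofReal (k a)) :=
  (((hs.memLp a i α).comp_measurePreserving (measurePreserving_add_right volume
    (h • Pi.single γ 1))).sub (hs.memLp a i α)).const_mul h⁻¹

theorem integrable_diffQuot_grad_rpow (hs : LocalSystem k q w lam Lam R K Z P) (γ : Fin n) (h : ℝ)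
    (a : Fin 2) : Integrable fun x => ‖diffQuot γ h P x a‖ ^ k a :=
  integrable_norm_rpow_of_memLp (hs.k_pos a) (memLp_pVar (hs.memLp_diffQuot γ h a))

theorem aestronglyMeasurable_maxWt_rpow (hs : LocalSystem k q w lam Lam R K Z P) (γ : Fin n)
    (h : ℝ) (a : Fin 2) (r : ℝ) : AEStronglyMeasurable fun x => maxWt γ h P x a ^ r := by
  have h1 := (hs.aestronglyMeasurable_wt a).aemeasurable
  have h2 := ((hs.aestronglyMeasurable_wt a).comp_measurePreserving
    (measurePreserving_add_right volume (h • Pi.single γ 1))).aemeasurable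
  exact ((h1.max h2).pow_const r).aestronglyMeasurable

/-- On a set of finite measure, the weights are integrable uniformly in the step. -/
theorem integrableOn_maxWt (hs : LocalSystem k q w lam Lam R K Z P) (γ : Fin n)
    (h : ℝ) (a : Fin 2) {S : Set (Fin n → ℝ)} (hS : volume S ≠ ⊤) :
    IntegrableOn (fun x => maxWt γ h P x a ^ k a) S ∧
    ∫ x in S, maxWt γ h P x a ^ k a ≤
      2 * 2 ^ k a * (volume.real S + ∫ x, ‖P x a‖ ^ k a) := by
  have hk := (hs.k_pos a).le
  have i0 := hs.integrable_grad_rpow a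
  have i1 := integrable_comp_add i0 (h • Pi.single γ 1)
  have hle (x : Fin n → ℝ) : maxWt γ h P x a ^ k a ≤ 2 ^ k a * (1 + ‖P x a‖ ^ k a) +
      2 ^ k a * (1 + ‖P (x + h • Pi.single γ 1) a‖ ^ k a) :=
    maxWt_rpow_le.trans (add_le_add (wt_rpow_le _ hk) (wt_rpow_le _ hk))
  have j1 : IntegrableOn (fun x => 2 ^ k a * (1 + ‖P x a‖ ^ k a)) S :=
    ((integrableOn_const hS).add i0.integrableOn).const_mul _
  have j2 : IntegrableOn (fun x => 2 ^ k a * (1 + ‖P (x + h • Pi.single γ 1) a‖ ^ k a)) S :=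
    ((integrableOn_const hS).add i1.integrableOn).const_mul _
  have j3 : IntegrableOn (fun x => maxWt γ h P x a ^ k a) S := by
    refine (j1.add j2).mono' (hs.aestronglyMeasurable_maxWt_rpow γ h a _).restrict
      (Eventually.of_forall fun x => ?_)
    rw [Real.norm_of_nonneg (Real.rpow_nonneg maxWt_pos.le _)]
    exact hle x
  refine ⟨j3, (integral_mono j3 (j1.add j2) hle).trans ?_⟩
  have j0 : Integrable (fun _ => (1 : ℝ)) (volume.restrict S) := integrableOn_const hS
  have e1 : ∫ x in S, (2 ^ k a * (1 + ‖P x a‖ ^ k a) +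
      2 ^ k a * (1 + ‖P (x + h • Pi.single γ 1) a‖ ^ k a)) =
      2 ^ k a * (volume.real S + ∫ x in S, ‖P x a‖ ^ k a) +
      2 ^ k a * (volume.real S + ∫ x in S, ‖P (x + h • Pi.single γ 1) a‖ ^ k a) := by
    rw [integral_add j1 j2, integral_const_mul, integral_const_mul,
      integral_add j0 i0.integrableOn, integral_add j0 i1.integrableOn]
    simp
  have l1 : ∫ x in S, ‖P x a‖ ^ k a ≤ ∫ x, ‖P x a‖ ^ k a :=
    setIntegral_le_integral i0 (Eventually.of_forall fun x => by positivity)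
  have l2 : ∫ x in S, ‖P (x + h • Pi.single γ 1) a‖ ^ k a ≤ ∫ x, ‖P x a‖ ^ k a := by
    refine (setIntegral_le_integral i1 (Eventually.of_forall fun x => by positivity)).trans_eq ?_
    exact integral_add_right_eq_self (fun x => ‖P x a‖ ^ k a) _
  have hp : (0 : ℝ) ≤ 2 ^ k a := by positivity
  refine e1.trans_le ?_
  have := mul_le_mul_of_nonneg_left l1 hp
  have := mul_le_mul_of_nonneg_left l2 hp
  linarith

theorem integral_diffQuot_rpow_le (hs : LocalSystem k q w lam Lam R K Z P) (γ : Fin n) {h : ℝ}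
    (hh : h ≠ 0) (a : Fin 2) {r : ℝ} (hr : 1 ≤ r)
    (hP : ∀ i, MemLp (fun x => P x a i γ) (ENNReal.ofReal r)) :
    Integrable (fun x => ‖diffQuot γ h Z x a‖ ^ r) ∧
      ∫ x, ‖diffQuot γ h Z x a‖ ^ r ≤ ∑ i, ∫ x, ‖P x a i γ‖ ^ r := by
  have h1 (i : Fin (m a)) := (hs.weak a i γ).integral_diffQuot_rpow_le hr (hP i) hh
  have h2 : Integrable fun x => ∑ i, ‖diffQuot γ h (fun x => Z x a i) x‖ ^ r :=
    integrable_finsetSum _ fun i _ => (h1 i).1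
  have h3 (x : Fin n → ℝ) : ‖diffQuot γ h Z x a‖ ^ r ≤
      ∑ i, ‖diffQuot γ h (fun x => Z x a i) x‖ ^ r := norm_rpow_le_sum _ (by linarith)
  have h4 : Integrable (fun x => ‖diffQuot γ h Z x a‖ ^ r) := by
    refine h2.mono' ?_ (Eventually.of_forall fun x => ?_)
    · refine (Continuous.rpow_const ?_ fun _ => Or.inr (by linarith)).aestronglyMeasurable
      exact ((continuous_apply a).comp (hs.continuous_diffQuot γ h)).norm
    · rw [Real.norm_of_nonneg (by positivity)]
      exact h3 x
  refine ⟨h4, (integral_mono h4 h2 h3).trans ?_⟩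
  rw [integral_finsetSum _ fun i _ => (h1 i).1]
  exact Finset.sum_le_sum fun i _ => (h1 i).2

/-- The lower order density is integrable, with a bound uniform in the step `h`. -/
theorem exists_integral_lowerDens_le (hs : LocalSystem k q w lam Lam R K Z P)
    {S : Set (Fin n → ℝ)} (hSm : MeasurableSet S) (hS : volume S ≠ ⊤) :
    ∃ C, ∀ (γ : Fin n) (h : ℝ), h ≠ 0 → Integrable (lowerDens k γ h S Z P) ∧
      ∫ x, lowerDens k γ h S Z P x ≤ C := by
  set I : Fin 2 → ℝ := fun a => 2 * 2 ^ k a * (volume.real S + ∫ x, ‖P x a‖ ^ k a) with hI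
  set J : Fin 2 → ℝ := fun a => ∑ i, ∑ γ, ∫ x, ‖P x a i γ‖ ^ k a with hJ
  set J' : ℝ := ∑ i, ∑ γ, ∫ x, ‖P x 0 i γ‖ ^ (2 * k 1) with hJ'
  refine ⟨2 * I 0 + 3 * I 1 + J 0 + J 1 + J', fun γ h hh => ?_⟩
  have hk0 := hs.two_le 0
  have hk1 := hs.two_le 1
  have w0 := hs.integrableOn_maxWt γ h 0 hS
  have w1 := hs.integrableOn_maxWt γ h 1 hS
  have d0 := hs.integral_diffQuot_rpow_le γ hh 0 (by linarith) fun i => hs.memLp 0 i γ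
  have d1 := hs.integral_diffQuot_rpow_le γ hh 1 (by linarith) fun i => hs.memLp 1 i γ
  have d2 := hs.integral_diffQuot_rpow_le γ hh 0 (by linarith) fun i => hs.memLp_zero i γ
  have sumle (a : Fin 2) (r : ℝ) : ∑ i, ∫ x, ‖P x a i γ‖ ^ r ≤ ∑ i, ∑ γ, ∫ x, ‖P x a i γ‖ ^ r :=
    Finset.sum_le_sum fun i _ => Finset.single_le_sum (f := fun γ => ∫ x, ‖P x a i γ‖ ^ r)
      (fun γ _ => integral_nonneg fun x => by positivity) (Finset.mem_univ γ)
  set f : (Fin n → ℝ) → ℝ := fun x => maxWt γ h P x 0 ^ (k 0 - 2) * maxWt γ h P x 0 ^ 2 +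
    maxWt γ h P x 1 ^ (k 1 - 2) * maxWt γ h P x 1 ^ 2 +
    maxWt γ h P x 0 ^ (k 0 - 2) * ‖diffQuot γ h Z x 0‖ ^ 2 +
    maxWt γ h P x 1 ^ (k 1 - 2) * ‖diffQuot γ h Z x 1‖ ^ 2 +
    maxWt γ h P x 1 ^ (k 1 - 2) * maxWt γ h P x 1 * ‖diffQuot γ h Z x 0‖ ^ 2 with hf
  set g : (Fin n → ℝ) → ℝ := fun x => 2 * maxWt γ h P x 0 ^ k 0 + 3 * maxWt γ h P x 1 ^ k 1 +
    ‖diffQuot γ h Z x 0‖ ^ k 0 + ‖diffQuot γ h Z x 1‖ ^ k 1 + ‖diffQuot γ h Z x 0‖ ^ (2 * k 1)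
    with hg
  have f0 (x : Fin n → ℝ) : 0 ≤ f x := by
    have := maxWt_pos (γ := γ) (h := h) (P := P) (x := x) (a := 0)
    have := maxWt_pos (γ := γ) (h := h) (P := P) (x := x) (a := 1)
    positivity
  -- Young's inequality; the last density uses the exponents `k₂ / (k₂ - 1)` and `k₂`.
  have fg (x : Fin n → ℝ) : f x ≤ g x := by
    have p0 := (maxWt_pos (γ := γ) (h := h) (P := P) (x := x) (a := 0)).le
    have p1 := (maxWt_pos (γ := γ) (h := h) (P := P) (x := x) (a := 1)).le
    have r1 := rpow_sub_two_mul_le p0 (norm_nonneg (diffQuot γ h Z x 0)) hk0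
    have r2 := rpow_sub_two_mul_le p1 (norm_nonneg (diffQuot γ h Z x 1)) hk1
    have r3 := rpow_sub_one_mul_le p1 (sq_nonneg ‖diffQuot γ h Z x 0‖) (by linarith : 1 ≤ k 1)
    rw [← Real.rpow_natCast ‖diffQuot γ h Z x 0‖ 2, ← Real.rpow_mul (norm_nonneg _)] at r3
    simp only [Nat.cast_ofNat] at r3
    simp only [hf, hg, maxWt_rpow_mul_sq, maxWt_rpow_mul]
    have e : ‖diffQuot γ h Z x 0‖ ^ (2 : ℝ) = ‖diffQuot γ h Z x 0‖ ^ 2 :=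
      Real.rpow_natCast _ 2
    rw [e] at r3
    linarith
  have gi1 : IntegrableOn (fun x => 2 * maxWt γ h P x 0 ^ k 0 + 3 * maxWt γ h P x 1 ^ k 1) S :=
    (w0.1.const_mul 2).add (w1.1.const_mul 3)
  have gi2 : IntegrableOn (fun x => 2 * maxWt γ h P x 0 ^ k 0 + 3 * maxWt γ h P x 1 ^ k 1 +
    ‖diffQuot γ h Z x 0‖ ^ k 0) S := gi1.add d0.1.integrableOn
  have gi3 : IntegrableOn (fun x => 2 * maxWt γ h P x 0 ^ k 0 + 3 * maxWt γ h P x 1 ^ k 1 +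
    ‖diffQuot γ h Z x 0‖ ^ k 0 + ‖diffQuot γ h Z x 1‖ ^ k 1) S := gi2.add d1.1.integrableOn
  have gi : IntegrableOn g S := gi3.add d2.1.integrableOn
  have hDm (a : Fin 2) : AEStronglyMeasurable fun x => ‖diffQuot γ h Z x a‖ ^ 2 :=
    (((continuous_apply a).comp (hs.continuous_diffQuot γ h)).norm.pow 2).aestronglyMeasurable
  have fm : AEStronglyMeasurable f := by
    simp only [hf, maxWt_rpow_mul_sq, maxWt_rpow_mul]
    exact ((((hs.aestronglyMeasurable_maxWt_rpow γ h 0 _).add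
      (hs.aestronglyMeasurable_maxWt_rpow γ h 1 _)).add
      ((hs.aestronglyMeasurable_maxWt_rpow γ h 0 _).mul (hDm 0))).add
      ((hs.aestronglyMeasurable_maxWt_rpow γ h 1 _).mul (hDm 1))).add
      ((hs.aestronglyMeasurable_maxWt_rpow γ h 1 _).mul (hDm 0))
  have fi : IntegrableOn f S := gi.mono' fm.restrict (Eventually.of_forall fun x => by
    rw [Real.norm_of_nonneg (f0 x)]
    exact fg x)
  refine ⟨(integrable_indicator_iff hSm).2 fi, ?_⟩
  have e0 : ∫ x, lowerDens k γ h S Z P x = ∫ x in S, f x := integral_indicator hSm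
  rw [e0]
  refine (integral_mono fi gi fg).trans ?_
  have e1 : ∫ x in S, g x = 2 * (∫ x in S, maxWt γ h P x 0 ^ k 0) +
      3 * (∫ x in S, maxWt γ h P x 1 ^ k 1) + (∫ x in S, ‖diffQuot γ h Z x 0‖ ^ k 0) +
      (∫ x in S, ‖diffQuot γ h Z x 1‖ ^ k 1) + ∫ x in S, ‖diffQuot γ h Z x 0‖ ^ (2 * k 1) := by
    rw [hg, integral_add gi3 d2.1.integrableOn, integral_add gi2 d1.1.integrableOn,
      integral_add gi1 d0.1.integrableOn, integral_add (w0.1.const_mul 2) (w1.1.const_mul 3),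
      integral_const_mul, integral_const_mul]
  have l0 : ∫ x in S, ‖diffQuot γ h Z x 0‖ ^ k 0 ≤ J 0 :=
    (setIntegral_le_integral d0.1 (Eventually.of_forall fun x => by positivity)).trans
      (d0.2.trans (sumle 0 _))
  have l1 : ∫ x in S, ‖diffQuot γ h Z x 1‖ ^ k 1 ≤ J 1 :=
    (setIntegral_le_integral d1.1 (Eventually.of_forall fun x => by positivity)).trans
      (d1.2.trans (sumle 1 _))
  have l2 : ∫ x in S, ‖diffQuot γ h Z x 0‖ ^ (2 * k 1) ≤ J' :=
    (setIntegral_le_integral d2.1 (Eventually.of_forall fun x => by positivity)).trans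
      (d2.2.trans (sumle 0 _))
  rw [e1]
  have := w0.2
  have := w1.2
  simp only [hI]
  linarith

end LocalSystem

/-! ### The differentiated system -/

section Cutoff

variable {n : ℕ}

theorem fderiv_sq_apply {η : (Fin n → ℝ) → ℝ} (hη : ContDiff ℝ ∞ η) (x : Fin n → ℝ) (α : Fin n) :
    fderiv ℝ (fun y => η y ^ 2) x (Pi.single α 1) = 2 * η x * partials η x α := by
  have hd : DifferentiableAt ℝ η x := (hη.differentiable (by simp)) x
  rw [fderiv_fun_pow 2 hd]
  simp [partials]

theorem continuous_partials {η : (Fin n → ℝ) → ℝ} (hη : ContDiff ℝ ∞ η) (α : Fin n) :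
    Continuous fun x => partials η x α := continuous_fderiv_apply hη _

theorem IsCutoff.hasCompactSupport {η : (Fin n → ℝ) → ℝ} {K : Set (Fin n → ℝ)} {M : ℝ}
    (h : IsCutoff η K M) (hK : IsCompact K) : HasCompactSupport η :=
  HasCompactSupport.intro hK h.zero

/-- The product of a continuous compactly supported function with a function in `L^p`. -/
theorem memLp_continuous_mul {f g : (Fin n → ℝ) → ℝ} {p : ℝ≥0∞} (hf : Continuous f)
    (hs : HasCompactSupport f) (hg : MemLp g p) : MemLp (fun x => f x * g x) p := by
  obtain ⟨B, hB⟩ := hs.exists_bound_of_continuous hf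
  refine MemLp.of_le_mul (c := B) hg (hf.aestronglyMeasurable.mul hg.aestronglyMeasurable)
    (Eventually.of_forall fun x => ?_)
  rw [norm_mul]
  exact mul_le_mul_of_nonneg_right (hB x) (norm_nonneg _)

end Cutoff

namespace LocalSystem

variable {n : ℕ} {m : Fin 2 → ℕ} {k : Fin 2 → ℝ} {q : CoeffArg n m → PVar n m}
  {w : CoeffArg n m → ZVar m} {lam Lam R : ℝ} {K K' : Set (Fin n → ℝ)} {Z : (Fin n → ℝ) → ZVar m}
  {P : (Fin n → ℝ) → PVar n m} {η : (Fin n → ℝ) → ℝ} {M : ℝ}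

/-- The test field `η² Δ_h z`. -/
theorem isTestField_diffQuot (hs : LocalSystem k q w lam Lam R K Z P) (hη : IsCutoff η K' M)
    (hK' : IsCompact K') (γ : Fin n) (h : ℝ) :
    IsTestField k K' (fun x => η x ^ 2 • diffQuot γ h Z x)
      (fun x => testGrad (η x) (partials η x) (diffQuot γ h Z x) (diffQuot γ h P x)) := by
  have hηs := hη.hasCompactSupport hK'
  have hη2 : ContDiff ℝ ∞ fun x => η x ^ 2 := hη.smooth.pow 2
  have hη2s : HasCompactSupport fun x => η x ^ 2 :=
    hηs.comp_left (g := fun t : ℝ => t ^ 2) (by norm_num)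
  have hD := hs.continuous_diffQuot γ h
  have hDc (a : Fin 2) (i : Fin (m a)) : Continuous fun x => diffQuot γ h Z x a i :=
    (continuous_apply i).comp ((continuous_apply a).comp hD)
  refine ⟨?_, fun x hx => ?_, fun x hx => ?_, fun a i α => ?_, fun a i α => ?_⟩
  · exact hη2.continuous.smul hD
  · rw [hη.zero x hx]; simp
  · ext a i α
    rw [hη.zero x hx]; simp [testGrad]
  · have := (hs.weak_diffQuot γ h a i α).smooth_mul hη2 hη2s
    convert this using 2 with x x
    · simp only [Pi.smul_apply, smul_eq_mul]; ring
    · rw [fderiv_sq_apply hη.smooth]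
      simp only [testGrad, Pi.add_apply, Pi.smul_apply, smul_eq_mul]
      ring
  · refine MemLp.add ?_ ?_
    · exact memLp_continuous_mul hη2.continuous hη2s (hs.memLp_diffQuot γ h a i α)
    · simp only [Pi.smul_apply, smul_eq_mul]
      refine Continuous.memLp_of_hasCompactSupport ?_ ?_
      · exact (continuous_const.mul hη.smooth.continuous).mul
          ((continuous_partials hη.smooth α).mul (hDc a i))
      · exact (hηs.mul_left (f := fun _ => 2)).mul_right

theorem energyDens_nonneg (γ : Fin n) (h : ℝ) (a : Fin 2) (x : Fin n → ℝ) :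
    0 ≤ energyDens k γ h η P a x := by
  have := maxWt_pos (γ := γ) (h := h) (P := P) (x := x) (a := a)
  unfold energyDens
  positivity

theorem critDens_nonneg (γ : Fin n) (h : ℝ) (a : Fin 2) (x : Fin n → ℝ) :
    0 ≤ critDens k γ h η Z P a x := by
  have := maxWt_pos (γ := γ) (h := h) (P := P) (x := x) (a := a)
  unfold critDens
  positivity

theorem lowerDens_nonneg (γ : Fin n) (h : ℝ) (x : Fin n → ℝ) :
    0 ≤ lowerDens k γ h K' Z P x := by
  refine indicator_nonneg (fun x _ => ?_) x
  have := maxWt_pos (γ := γ) (h := h) (P := P) (x := x) (a := 0)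
  have := maxWt_pos (γ := γ) (h := h) (P := P) (x := x) (a := 1)
  positivity

theorem integrable_energyDens (hs : LocalSystem k q w lam Lam R K Z P) (hη : IsCutoff η K' M)
    (hK' : IsCompact K') (γ : Fin n) (h : ℝ) (a : Fin 2) :
    Integrable (energyDens k γ h η P a) := by
  refine IntegrableOn.integrable_of_forall_notMem_eq_zero (s := K') ?_ fun x hx => by
    rw [energyDens, hη.zero x hx]; simp
  have i1 := (hs.integrableOn_maxWt γ h a hK'.measure_lt_top.ne).1
  have i2 := (hs.integrable_diffQuot_grad_rpow γ h a).integrableOn (s := K')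
  refine (i1.add i2).mono' ?_ (Eventually.of_forall fun x => ?_)
  · refine ((((hη.smooth.continuous.pow 2).aestronglyMeasurable).mul
      (hs.aestronglyMeasurable_maxWt_rpow γ h a _)).mul ?_).restrict
    exact (memLp_pVar (hs.memLp_diffQuot γ h a)).aestronglyMeasurable.norm.pow 2
  · rw [Real.norm_of_nonneg (energyDens_nonneg γ h a x)]
    have h1 := rpow_sub_two_mul_le (maxWt_pos (γ := γ) (h := h) (P := P) (x := x) (a := a)).le
      (norm_nonneg (diffQuot γ h P x a)) (hs.two_le a)
    have h2 : η x ^ 2 ≤ 1 := pow_le_one₀ (hη.nonneg x) (hη.le_one x)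
    have h3 : 0 ≤ maxWt γ h P x a ^ (k a - 2) * ‖diffQuot γ h P x a‖ ^ 2 :=
      mul_nonneg (Real.rpow_nonneg maxWt_pos.le _) (sq_nonneg _)
    rw [energyDens, mul_assoc]
    exact (mul_le_of_le_one_left h3 h2).trans h1

theorem integrable_critDens (hs : LocalSystem k q w lam Lam R K Z P) (hη : IsCutoff η K' M)
    (hK' : IsCompact K') (γ : Fin n) (h : ℝ) (a : Fin 2) :
    Integrable (critDens k γ h η Z P a) := by
  refine IntegrableOn.integrable_of_forall_notMem_eq_zero (s := K') ?_ fun x hx => by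
    rw [critDens, hη.zero x hx]; simp
  have hD := hs.continuous_diffQuot γ h
  obtain ⟨B, hB⟩ := (hs.hasCompactSupport_diffQuot γ h).exists_bound_of_continuous hD
  have i1 := (hs.integrableOn_maxWt γ h a hK'.measure_lt_top.ne).1
  have hc : Continuous fun x => η x ^ 2 * ‖diffQuot γ h Z x a‖ ^ 2 :=
    (hη.smooth.continuous.pow 2).mul (((continuous_apply a).comp hD).norm.pow 2)
  refine (i1.mul_bdd (c := B ^ 2) hc.aestronglyMeasurable
    (Eventually.of_forall fun x => ?_)).congr
    (Eventually.of_forall fun x => ?_)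
  · have h2 : η x ^ 2 ≤ 1 := pow_le_one₀ (hη.nonneg x) (hη.le_one x)
    rw [Real.norm_of_nonneg (by positivity)]
    refine (mul_le_of_le_one_left (sq_nonneg _) h2).trans ?_
    exact pow_le_pow_left₀ (norm_nonneg _) ((norm_le_pi_norm _ a).trans (hB x)) 2
  · simp only [critDens, ← maxWt_rpow_mul_sq (r := k a)]
    ring

/-- The energy inequality for difference quotients, from testing with `η² Δ_h z` and with its
translate by `-h e_γ`. -/
theorem energy_le (hs : LocalSystem k q w lam Lam R K Z P) (hη : IsCutoff η K' M)
    (hK' : IsCompact K') (γ : Fin n) {h : ℝ} (hh : 0 < h)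
    (hKK : ∀ x ∈ K', ∀ t ∈ Icc (0 : ℝ) 1, x + t • h • Pi.single γ 1 ∈ K)
    (hB : Integrable (lowerDens k γ h K' Z P)) {ε : ℝ} (hε : 0 < ε) {N : ℝ}
    (hN : N = dimConst n m ^ 2 * Lam) :
    lam * (segConst (k 0) * (∫ x, energyDens k γ h η P 0 x) +
        segConst (k 1) * ∫ x, energyDens k γ h η P 1 x) ≤
      6 * ε * ((∫ x, energyDens k γ h η P 0 x) + ∫ x, energyDens k γ h η P 1 x) +
      (2 * N ^ 2 / ε + 4 * N) *
        ((∫ x, critDens k γ h η Z P 0 x) + ∫ x, critDens k γ h η Z P 1 x) +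
      20 * ((N + N ^ 2 / ε) * (1 + 4 * M ^ 2)) * ∫ x, lowerDens k γ h K' Z P x := by
  set v : Fin n → ℝ := h • Pi.single γ 1 with hv
  have htest := hs.isTestField_diffQuot hη hK' γ h
  have hsub : K' ⊆ K := fun x hx => by
    have := hKK x hx 0 (by simp)
    simpa using this
  have htest1 := htest.mono hsub
  have htest2 := htest.translate (K' := K) (-v) (fun x hx => by
    have := hKK _ hx 1 (by simp)
    simpa using this)
  set A : (Fin n → ℝ) → PVar n m := fun x =>
    testGrad (η x) (partials η x) (diffQuot γ h Z x) (diffQuot γ h P x) with hA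
  set B : (Fin n → ℝ) → ZVar m := fun x => η x ^ 2 • diffQuot γ h Z x with hBdef
  set F : (Fin n → ℝ) → ℝ := fun x =>
    pairing (A x) (B x) (q (x, Z x, P x)) (w (x, Z x, P x)) with hF
  set G : (Fin n → ℝ) → ℝ := fun x =>
    pairing (A (x + -v)) (B (x + -v)) (q (x, Z x, P x)) (w (x, Z x, P x)) with hG
  have hFi : Integrable F := hs.integrable_pairing htest1
  have hGi : Integrable G := hs.integrable_pairing htest2
  have hF0 : ∫ x, F x = 0 := hs.eq _ _ htest1
  -- The equation at `x + v`, tested with the field at `x`.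
  have hG0 : ∫ x, G (x + v) = 0 :=
    (integral_add_right_eq_self G v).trans (hs.eq _ _ htest2)
  have hGi' : Integrable fun x => G (x + v) := integrable_comp_add hGi v
  have x0 := hs.integrable_energyDens hη hK' γ h 0
  have x1 := hs.integrable_energyDens hη hK' γ h 1
  have y0 := hs.integrable_critDens hη hK' γ h 0
  have y1 := hs.integrable_critDens hη hK' γ h 1
  set c₁ := 2 * N ^ 2 / ε + 4 * N
  set c₂ := 20 * ((N + N ^ 2 / ε) * (1 + 4 * M ^ 2))
  have i1 : Integrable fun x => lam * (segConst (k 0) * energyDens k γ h η P 0 x +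
      segConst (k 1) * energyDens k γ h η P 1 x) :=
    ((x0.const_mul _).add (x1.const_mul _)).const_mul _
  have i2 : Integrable fun x => 6 * ε * (energyDens k γ h η P 0 x + energyDens k γ h η P 1 x) :=
    (x0.add x1).const_mul _
  have i3 : Integrable fun x => c₁ * (critDens k γ h η Z P 0 x + critDens k γ h η Z P 1 x) :=
    (y0.add y1).const_mul _
  have i4 : Integrable fun x => 6 * ε * (energyDens k γ h η P 0 x + energyDens k γ h η P 1 x) +
      c₁ * (critDens k γ h η Z P 0 x + critDens k γ h η Z P 1 x) := i2.add i3
  have i5 : Integrable fun x => 6 * ε * (energyDens k γ h η P 0 x + energyDens k γ h η P 1 x) +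
      c₁ * (critDens k γ h η Z P 0 x + critDens k γ h η Z P 1 x) +
      c₂ * lowerDens k γ h K' Z P x := i4.add (hB.const_mul _)
  have i6 : Integrable fun x => h * (lam * (segConst (k 0) * energyDens k γ h η P 0 x +
      segConst (k 1) * energyDens k γ h η P 1 x) -
      (6 * ε * (energyDens k γ h η P 0 x + energyDens k γ h η P 1 x) +
      c₁ * (critDens k γ h η Z P 0 x + critDens k γ h η Z P 1 x) +
      c₂ * lowerDens k γ h K' Z P x)) := (i1.sub i5).const_mul h
  have key : ∫ x, h * (lam * (segConst (k 0) * energyDens k γ h η P 0 x +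
      segConst (k 1) * energyDens k γ h η P 1 x) -
      (6 * ε * (energyDens k γ h η P 0 x + energyDens k γ h η P 1 x) +
      c₁ * (critDens k γ h η Z P 0 x + critDens k γ h η Z P 1 x) +
      c₂ * lowerDens k γ h K' Z P x)) ≤ ∫ x, (G (x + v) - F x) := by
    refine integral_mono_ae i6 (hGi'.sub hFi) ?_
    filter_upwards [ae_ae_segment hs.cond v] with x hx
    by_cases hxK : x ∈ K'
    · have hvx : h • diffQuot γ h Z x = Z (x + v) - Z x := smul_inv_smul₀ hh.ne' _
      have hvp : h • diffQuot γ h P x = P (x + v) - P x := smul_inv_smul₀ hh.ne' _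
      have hRx (t : ℝ) (ht : t ∈ Icc (0 : ℝ) 1) : ‖Z x + t • (Z (x + v) - Z x)‖ ≤ R := by
        have b0 := hs.bound x (hsub hxK)
        have b1 := hs.bound (x + v) (by simpa using hKK x hxK 1 (by simp))
        have := (convex_closedBall (0 : ZVar m) R).add_smul_sub_mem (x := Z x) (y := Z (x + v))
          (by simpa using b0) (by simpa using b1) ht
        simpa using this
      have inc := le_pairing_increment (k := k) (lam := lam) (W := maxWt γ h P x)
        hs.lip_q hs.lip_w hs.two_le hs.lam_pos hs.Lam_pos hε hh
        (hη.nonneg x) (hη.le_one x) (hη.grad_le x) γ (diffQuot γ h Z x) (diffQuot γ h P x)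
        (y := (x, Z x, P x)) (y' := (x + v, Z (x + v), P (x + v)))
        (by
          rw [Prod.smul_mk, Prod.smul_mk, hvx, hvp, Prod.mk_add_mk, Prod.mk_add_mk]
          simp [hv])
        (by
          intro t ht
          refine mk_mem_prod ?_ (mem_univ _)
          have := hKK x hxK t ht
          simpa using this)
        (by
          have hmem : ∀ᵐ t ∂unitMeasure, t ∈ Ioc (0 : ℝ) 1 := ae_restrict_mem measurableSet_Ioc
          filter_upwards [hx, hmem] with t ht htm
          have ht' := ht (hKK x hxK t ⟨htm.1.le, htm.2⟩) _ (P x + t • (P (x + v) - P x))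
            (hRx t ⟨htm.1.le, htm.2⟩)
          have e : ((x, Z x, P x) : CoeffArg n m) +
              t • (((x + v, Z (x + v), P (x + v)) : CoeffArg n m) - (x, Z x, P x)) =
              (x + t • v, Z x + t • (Z (x + v) - Z x), P x + t • (P (x + v) - P x)) := by
            simp
          rw [e]
          exact ht')
        (fun a => rfl) hN
      have eG : G (x + v) = pairing (A x) (B x) (q (x + v, Z (x + v), P (x + v)))
          (w (x + v, Z (x + v), P (x + v))) := by
        simp [hG]
      rw [eG]
      refine le_trans (le_of_eq ?_) inc
      simp only [energyDens, critDens, lowerDens, indicator_of_mem hxK, Fin.sum_univ_two]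
      ring
    · have e1 : A x = 0 := htest.grad_zero x hxK
      have e2 : B x = 0 := htest.zero x hxK
      have eG : G (x + v) = 0 := by
        simp [hG, e1, e2, pairing]
      have eF : F x = 0 := by
        simp [hF, e1, e2, pairing]
      rw [eG, eF]
      simp only [energyDens, critDens, lowerDens, indicator_of_notMem hxK, hη.zero x hxK]
      simp
  rw [integral_sub hGi' hFi, hF0, hG0, sub_zero, integral_const_mul, integral_sub i1 i5,
    integral_const_mul, integral_add (x0.const_mul _) (x1.const_mul _),
    integral_add i4 (hB.const_mul _), integral_add i2 i3, integral_const_mul, integral_const_mul,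
    integral_const_mul, integral_const_mul, integral_const_mul, integral_add x0 x1,
    integral_add y0 y1] at key
  have := nonpos_of_mul_nonpos_right key hh
  linarith

end LocalSystem

/-! ### The critical term -/

namespace LocalSystem

variable {n : ℕ} {m : Fin 2 → ℕ} {k : Fin 2 → ℝ} {q : CoeffArg n m → PVar n m}
  {w : CoeffArg n m → ZVar m} {lam Lam R : ℝ} {K K' : Set (Fin n → ℝ)} {Z : (Fin n → ℝ) → ZVar m}
  {P : (Fin n → ℝ) → PVar n m} {η : (Fin n → ℝ) → ℝ} {M : ℝ}

/-- The function `η² |Δ_h z_a|²`. The norm is Euclidean here, unlike in the densities, so that the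
function is weakly differentiable by the product rule. -/
noncomputable def sqQuot (γ : Fin n) (h : ℝ) (η : (Fin n → ℝ) → ℝ) (Z : (Fin n → ℝ) → ZVar m)
    (a : Fin 2) (x : Fin n → ℝ) : ℝ := (∑ j, diffQuot γ h Z x a j * diffQuot γ h Z x a j) * η x ^ 2

/-- The gradient of `η² |Δ_h z_a|²`. -/
noncomputable def sqQuotGrad (γ : Fin n) (h : ℝ) (η : (Fin n → ℝ) → ℝ) (Z : (Fin n → ℝ) → ZVar m)
    (P : (Fin n → ℝ) → PVar n m) (a : Fin 2) (x : Fin n → ℝ) (α : Fin n) : ℝ :=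
  (∑ j, (diffQuot γ h P x a j α * diffQuot γ h Z x a j +
    diffQuot γ h P x a j α * diffQuot γ h Z x a j)) * η x ^ 2 +
  (∑ j, diffQuot γ h Z x a j * diffQuot γ h Z x a j) * (2 * η x * partials η x α)

theorem sqQuot_nonneg (γ : Fin n) (h : ℝ) (a : Fin 2) (x : Fin n → ℝ) :
    0 ≤ sqQuot γ h η Z a x :=
  mul_nonneg (Finset.sum_nonneg fun _ _ => mul_self_nonneg _) (sq_nonneg _)

theorem continuous_sqQuot (hs : LocalSystem k q w lam Lam R K Z P) (hη : IsCutoff η K' M)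
    (γ : Fin n) (h : ℝ) (a : Fin 2) : Continuous (sqQuot γ h η Z a) := by
  have hD := hs.continuous_diffQuot γ h
  have hDc (i : Fin (m a)) : Continuous fun x => diffQuot γ h Z x a i :=
    (continuous_apply i).comp ((continuous_apply a).comp hD)
  exact (continuous_finsetSum _ fun i _ => (hDc i).mul (hDc i)).mul (hη.smooth.continuous.pow 2)

theorem weak_sqQuot (hs : LocalSystem k q w lam Lam R K Z P) (hη : IsCutoff η K' M)
    (hK' : IsCompact K') (γ : Fin n) (h : ℝ) (a : Fin 2) (α : Fin n) :
    HasWeakPartial α (sqQuot γ h η Z a) (fun x => sqQuotGrad γ h η Z P a x α) := by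
  have hη2 : ContDiff ℝ ∞ fun x => η x ^ 2 := hη.smooth.pow 2
  have hη2s : HasCompactSupport fun x => η x ^ 2 :=
    (hη.hasCompactSupport hK').comp_left (g := fun t : ℝ => t ^ 2) (by norm_num)
  have hDc (i : Fin (m a)) : Continuous fun x => diffQuot γ h Z x a i :=
    (continuous_apply i).comp ((continuous_apply a).comp (hs.continuous_diffQuot γ h))
  have hDs (i : Fin (m a)) : HasCompactSupport fun x => diffQuot γ h Z x a i :=
    (hs.hasCompactSupport_diffQuot γ h).comp_left (g := fun z : ZVar m => z a i) rfl
  have h1 := (HasWeakPartial.sum Finset.univ fun i _ => (hs.weak_diffQuot γ h a i α).mul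
    (hs.weak_diffQuot γ h a i α) (hDc i) (hDs i) (hDc i) (hDs i)).smooth_mul hη2 hη2s
  simp only [fderiv_sq_apply hη.smooth] at h1
  exact h1

theorem memLp_sqQuotGrad (hs : LocalSystem k q w lam Lam R K Z P) (hη : IsCutoff η K' M)
    (hK' : IsCompact K') (γ : Fin n) (h : ℝ) (a : Fin 2) (α : Fin n) :
    MemLp (fun x => sqQuotGrad γ h η Z P a x α) (ENNReal.ofReal (k a)) := by
  have hηs := hη.hasCompactSupport hK'
  have hDc (i : Fin (m a)) : Continuous fun x => diffQuot γ h Z x a i :=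
    (continuous_apply i).comp ((continuous_apply a).comp (hs.continuous_diffQuot γ h))
  refine MemLp.add ?_ ?_
  · have e : (fun x => (∑ j, (diffQuot γ h P x a j α * diffQuot γ h Z x a j +
        diffQuot γ h P x a j α * diffQuot γ h Z x a j)) * η x ^ 2) =
        fun x => ∑ j, (2 * diffQuot γ h Z x a j * η x ^ 2) * diffQuot γ h P x a j α := by
      ext x
      rw [Finset.sum_mul]
      exact Finset.sum_congr rfl fun j _ => by ring
    rw [e]
    refine memLp_finsetSum _ fun j _ => ?_
    refine memLp_continuous_mul ?_ ?_ (hs.memLp_diffQuot γ h a j α)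
    · exact (continuous_const.mul (hDc j)).mul (hη.smooth.continuous.pow 2)
    · exact (hηs.comp_left (g := fun t : ℝ => t ^ 2) (by norm_num)).mul_left
  · refine Continuous.memLp_of_hasCompactSupport ?_ ?_
    · exact (continuous_finsetSum _ fun i _ => (hDc i).mul (hDc i)).mul
        ((continuous_const.mul hη.smooth.continuous).mul (continuous_partials hη.smooth α))
    · exact ((hηs.mul_left (f := fun _ => 2)).mul_right).mul_left

theorem sum_sq_le {m : Fin 2 → ℕ} (n : ℕ) (a : Fin 2) (d : Fin (m a) → ℝ) :
    ∑ j, d j * d j ≤ dimConst n m * ‖d‖ ^ 2 := by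
  have := (le_abs_self _).trans (abs_dot1_le n a d d)
  rw [sq]
  exact this

theorem sq_norm_le_sum {m : ℕ} (d : Fin m → ℝ) : ‖d‖ ^ 2 ≤ ∑ j, d j * d j := by
  have h0 : 0 ≤ ∑ j, d j * d j := Finset.sum_nonneg fun j _ => mul_self_nonneg _
  have h1 : ‖d‖ ≤ Real.sqrt (∑ j, d j * d j) := by
    refine (pi_norm_le_iff_of_nonneg (Real.sqrt_nonneg _)).2 fun i => ?_
    refine Real.le_sqrt_of_sq_le ?_
    rw [Real.norm_eq_abs, sq_abs, sq]
    exact Finset.single_le_sum (f := fun j => d j * d j) (fun j _ => mul_self_nonneg _)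
      (Finset.mem_univ i)
  calc ‖d‖ ^ 2 ≤ Real.sqrt (∑ j, d j * d j) ^ 2 := pow_le_pow_left₀ (norm_nonneg _) h1 2
    _ = _ := Real.sq_sqrt h0

theorem norm_sqQuotGrad_le (hη : IsCutoff η K' M) (γ : Fin n) (h : ℝ) (a : Fin 2)
    (x : Fin n → ℝ) : ‖sqQuotGrad γ h η Z P a x‖ ≤ 2 * dimConst n m *
      (η x ^ 2 * (‖diffQuot γ h P x a‖ * ‖diffQuot γ h Z x a‖) +
        η x * M * ‖diffQuot γ h Z x a‖ ^ 2) := by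
  have hN : 0 ≤ dimConst n m := zero_le_one.trans one_le_dimConst
  have hM : 0 ≤ M := (norm_nonneg _).trans (hη.grad_le x)
  have hη0 := hη.nonneg x
  refine (pi_norm_le_iff_of_nonneg (by positivity)).2 fun α => ?_
  have h1 : |∑ j, (diffQuot γ h P x a j α * diffQuot γ h Z x a j)| ≤
      dimConst n m * (‖diffQuot γ h P x a‖ * ‖diffQuot γ h Z x a‖) := by
    refine (abs_dot1_le n a (fun j => diffQuot γ h P x a j α) (diffQuot γ h Z x a)).trans ?_
    gcongr
    refine (pi_norm_le_iff_of_nonneg (norm_nonneg _)).2 fun j => ?_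
    exact (norm_le_pi_norm (diffQuot γ h P x a j) α).trans (norm_le_pi_norm (diffQuot γ h P x a) j)
  have h2 := sum_sq_le n a (diffQuot γ h Z x a)
  have h20 : 0 ≤ ∑ j, diffQuot γ h Z x a j * diffQuot γ h Z x a j :=
    Finset.sum_nonneg fun j _ => mul_self_nonneg _
  have h3 : |partials η x α| ≤ M := (norm_le_pi_norm (partials η x) α).trans (hη.grad_le x)
  rw [sqQuotGrad, Finset.sum_add_distrib]
  refine (norm_add_le _ _).trans ?_
  rw [norm_mul, norm_mul, norm_mul, norm_mul, Real.norm_of_nonneg (sq_nonneg (η x)),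
    Real.norm_of_nonneg h20, Real.norm_of_nonneg hη0, Real.norm_of_nonneg zero_le_two,
    Real.norm_eq_abs, Real.norm_eq_abs]
  set S := ∑ j, diffQuot γ h P x a j α * diffQuot γ h Z x a j
  have h4 : |S + S| ≤ 2 * (dimConst n m * (‖diffQuot γ h P x a‖ * ‖diffQuot γ h Z x a‖)) := by
    have := abs_add_le S S
    linarith
  have h5 := mul_le_mul_of_nonneg_right h4 (sq_nonneg (η x))
  have h6 : (∑ j, diffQuot γ h Z x a j * diffQuot γ h Z x a j) * (2 * η x * |partials η x α|) ≤
      (dimConst n m * ‖diffQuot γ h Z x a‖ ^ 2) * (2 * η x * M) := by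
    gcongr
  linarith

/-- Where `z` oscillates little, the critical term is controlled by a small multiple of the
energy. -/
theorem exists_crit_le (hk : ∀ a, 2 ≤ k a) (hlam : 0 < lam) (hLam : 0 < Lam) (n : ℕ)
    (m : Fin 2 → ℕ) (a : Fin 2) :
    ∃ C₀ > 0, ∃ osc₀ > 0, ∀ (q : CoeffArg n m → PVar n m) (w : CoeffArg n m → ZVar m) (R : ℝ)
      (K K' : Set (Fin n → ℝ)) (Z : (Fin n → ℝ) → ZVar m) (P : (Fin n → ℝ) → PVar n m)
      (η : (Fin n → ℝ) → ℝ) (M : ℝ), LocalSystem k q w lam Lam R K Z P → IsCutoff η K' M →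
      IsCompact K' → ∀ (c : ZVar m) (osc : ℝ), 0 ≤ osc → osc ≤ osc₀ →
      (∀ x ∈ K, ‖Z x - c‖ ≤ osc) → ∀ (γ : Fin n) (h : ℝ), K' ⊆ K →
      (∀ x ∈ K', x + h • Pi.single γ 1 ∈ K) → Integrable (lowerDens k γ h K' Z P) →
      ∫ x, critDens k γ h η Z P a x ≤ C₀ * osc * ((∫ x, energyDens k γ h η P a x) +
        ∫ x, critDens k γ h η Z P a x) + C₀ * (1 + osc * M ^ 2) *
          ∫ x, lowerDens k γ h K' Z P x := by
  obtain ⟨C, hC, osc₀, hosc₀, hmain⟩ := exists_oscillation hk hlam hLam n m a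
  set N := dimConst n m with hN
  have hN0 : 0 < N := zero_lt_one.trans_le one_le_dimConst
  refine ⟨8 * N * C, by positivity, osc₀, hosc₀, ?_⟩
  intro q w R K K' Z P η M hs hη hK' c osc hosc0 hosc hZ γ h hsub hKK hBi
  set v : Fin n → ℝ := h • Pi.single γ 1 with hv
  set ψ := sqQuot γ h η Z a with hψ
  set Dψ := sqQuotGrad γ h η Z P a with hDψ
  have ψ0 : ∀ x, 0 ≤ ψ x := fun x => sqQuot_nonneg γ h a x
  have ψK : ∀ x ∉ K', ψ x = 0 := fun x hx => by simp [hψ, sqQuot, hη.zero x hx]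
  have DψK : ∀ x ∉ K', Dψ x = 0 := fun x hx => by
    ext α
    simp [hDψ, sqQuotGrad, hη.zero x hx]
  have ψc := hs.continuous_sqQuot hη γ h a
  have ψw := hs.weak_sqQuot hη hK' γ h a
  have ψm := hs.memLp_sqQuotGrad hη hK' γ h a
  have hnot {x : Fin n → ℝ} (hx : x ∉ K) : x + -v ∉ K' := fun h' => hx (by
    have := hKK _ h'
    simpa using this)
  obtain ⟨a1, a2, a3, a4⟩ := hmain q w R K Z P hs c osc hosc0 hosc hZ ψ Dψ ψc ψ0
    (fun x hx => ψK x fun h' => hx (hsub h')) (fun x hx => DψK x fun h' => hx (hsub h')) ψw ψm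
  -- The same inequality for the translate of `ψ`, translated back.
  obtain ⟨b1, b2, b3, b4⟩ := hmain q w R K Z P hs c osc hosc0 hosc hZ (fun x => ψ (x + -v))
    (fun x => Dψ (x + -v)) (ψc.comp (continuous_add_const _)) (fun x => ψ0 _)
    (fun x hx => ψK _ (hnot hx)) (fun x hx => DψK _ (hnot hx)) (fun α => (ψw α).translate _)
    (fun α => (ψm α).comp_measurePreserving (measurePreserving_add_right volume (-v)))
  replace b1 := integrable_comp_add b1 v
  replace b2 := integrable_comp_add b2 v
  replace b3 := integrable_comp_add b3 v
  rw [← integral_add_right_eq_self _ v, ← integral_add_right_eq_self (fun x => ψ (x + -v) * _) v,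
    ← integral_add_right_eq_self (fun x => _ * ‖Dψ (x + -v)‖) v] at b4
  simp only [add_neg_cancel_right] at b1 b2 b3 b4
  have Xi := hs.integrable_energyDens hη hK' γ h a
  have Yi := hs.integrable_critDens hη hK' γ h a
  have hk1 : 0 ≤ k a - 1 := by linarith [hk a]
  -- Pointwise comparison of the three integrands.
  have p1 (x : Fin n → ℝ) : critDens k γ h η Z P a x ≤
      wt (P x a) ^ k a * ψ x + wt (P (x + v) a) ^ k a * ψ x := by
    rw [critDens, mul_assoc (η x ^ 2), maxWt_rpow_mul_sq, ← add_mul]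
    have h1 := maxWt_rpow_le (γ := γ) (h := h) (P := P) (x := x) (a := a) (r := k a)
    have h2 := sq_norm_le_sum (diffQuot γ h Z x a)
    have h3 := Real.rpow_nonneg (wt_pos (P x a)).le (k a)
    have h4 := Real.rpow_nonneg (wt_pos (P (x + v) a)).le (k a)
    calc η x ^ 2 * maxWt γ h P x a ^ k a * ‖diffQuot γ h Z x a‖ ^ 2
        = maxWt γ h P x a ^ k a * (‖diffQuot γ h Z x a‖ ^ 2 * η x ^ 2) := by ring
      _ ≤ _ := by
        refine mul_le_mul h1 (mul_le_mul_of_nonneg_right h2 (sq_nonneg _)) (by positivity)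
          (by positivity)
  have p2 (x : Fin n → ℝ) : ψ x * (1 + couplingTerm k (P x) a) +
      ψ x * (1 + couplingTerm k (P (x + v)) a) ≤ 2 * N * lowerDens k γ h K' Z P x := by
    by_cases hx : x ∈ K'
    · have s1 := sum_sq_le n a (diffQuot γ h Z x a)
      have s2 : η x ^ 2 ≤ 1 := pow_le_one₀ (hη.nonneg x) (hη.le_one x)
      have s3 : 0 ≤ ∑ j, diffQuot γ h Z x a j * diffQuot γ h Z x a j :=
        Finset.sum_nonneg fun j _ => mul_self_nonneg _
      have s4 : ψ x ≤ N * ‖diffQuot γ h Z x a‖ ^ 2 := (mul_le_of_le_one_right s3 s2).trans s1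
      have W0 := maxWt_pos (γ := γ) (h := h) (P := P) (x := x) (a := 0)
      have W1 := maxWt_pos (γ := γ) (h := h) (P := P) (x := x) (a := 1)
      have A1 (b : Fin 2) : 1 ≤ maxWt γ h P x b ^ (k b - 2) :=
        Real.one_le_rpow one_le_maxWt (by linarith [hk b])
      -- The coupling term is bounded by the corresponding power of the larger weight.
      have T (p : PVar n m) (hp : wt (p 1) ≤ maxWt γ h P x 1) :
          ‖diffQuot γ h Z x a‖ ^ 2 * (1 + couplingTerm k p a) ≤ lowerDens k γ h K' Z P x := by
        rw [lowerDens, indicator_of_mem hx]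
        have t1 := A1 0
        have t2 := A1 1
        have e1 : 0 ≤ maxWt γ h P x 0 ^ (k 0 - 2) * maxWt γ h P x 0 ^ 2 := by positivity
        have e2 : 0 ≤ maxWt γ h P x 1 ^ (k 1 - 2) * maxWt γ h P x 1 ^ 2 := by positivity
        have e3 := le_mul_of_one_le_left (sq_nonneg ‖diffQuot γ h Z x 0‖) t1
        have e4 := le_mul_of_one_le_left (sq_nonneg ‖diffQuot γ h Z x 1‖) t2
        have e5 : 0 ≤ maxWt γ h P x 1 ^ (k 1 - 2) * maxWt γ h P x 1 * ‖diffQuot γ h Z x 0‖ ^ 2 := by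
          positivity
        have e6 := sq_nonneg ‖diffQuot γ h Z x 0‖
        have e7 := sq_nonneg ‖diffQuot γ h Z x 1‖
        match a with
        | 0 =>
          have e8 : couplingTerm k p 0 ≤ maxWt γ h P x 1 ^ (k 1 - 2) * maxWt γ h P x 1 := by
            rw [maxWt_rpow_mul, couplingTerm, if_pos rfl]
            exact Real.rpow_le_rpow (wt_pos _).le hp (by linarith [hk 1])
          have e9 := mul_le_mul_of_nonneg_right e8 e6
          linarith
        | 1 =>
          have e8 : couplingTerm k p 1 = 0 := by simp [couplingTerm]
          rw [e8]
          linarith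
      have T1 := T (P x) (le_max_left _ _)
      have T2 := T (P (x + v)) (le_max_right _ _)
      have c1 := couplingTerm_nonneg k (P x) a
      have c2 := couplingTerm_nonneg k (P (x + v)) a
      have f1 := mul_le_mul_of_nonneg_right s4 (by linarith : 0 ≤ 1 + couplingTerm k (P x) a)
      have f2 := mul_le_mul_of_nonneg_right s4 (by linarith : 0 ≤ 1 + couplingTerm k (P (x + v)) a)
      have f3 := mul_le_mul_of_nonneg_left T1 hN0.le
      have f4 := mul_le_mul_of_nonneg_left T2 hN0.le
      linarith
    · rw [ψK x hx, lowerDens, indicator_of_notMem hx]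
      simp
  have p3 (x : Fin n → ℝ) : wt (P x a) ^ (k a - 1) * ‖Dψ x‖ +
      wt (P (x + v) a) ^ (k a - 1) * ‖Dψ x‖ ≤ 4 * N * (energyDens k γ h η P a x +
        2 * critDens k γ h η Z P a x + M ^ 2 * lowerDens k γ h K' Z P x) := by
    by_cases hx : x ∈ K'
    · have W0 := maxWt_pos (γ := γ) (h := h) (P := P) (x := x) (a := 0)
      have W1 := maxWt_pos (γ := γ) (h := h) (P := P) (x := x) (a := 1)
      have Wa := maxWt_pos (γ := γ) (h := h) (P := P) (x := x) (a := a)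
      have h1 := norm_sqQuotGrad_le (Z := Z) (P := P) hη γ h a x
      have g1 : wt (P x a) ^ (k a - 1) ≤ maxWt γ h P x a ^ (k a - 1) :=
        Real.rpow_le_rpow (wt_pos _).le (le_max_left _ _) hk1
      have g2 : wt (P (x + v) a) ^ (k a - 1) ≤ maxWt γ h P x a ^ (k a - 1) :=
        Real.rpow_le_rpow (wt_pos _).le (le_max_right _ _) hk1
      rw [← maxWt_rpow_mul] at g1 g2
      have hlow : maxWt γ h P x a ^ (k a - 2) * ‖diffQuot γ h Z x a‖ ^ 2 ≤
          lowerDens k γ h K' Z P x := by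
        rw [lowerDens, indicator_of_mem hx]
        have e1 : 0 ≤ maxWt γ h P x 0 ^ (k 0 - 2) * maxWt γ h P x 0 ^ 2 := by positivity
        have e2 : 0 ≤ maxWt γ h P x 1 ^ (k 1 - 2) * maxWt γ h P x 1 ^ 2 := by positivity
        have e3 : 0 ≤ maxWt γ h P x 0 ^ (k 0 - 2) * ‖diffQuot γ h Z x 0‖ ^ 2 := by positivity
        have e4 : 0 ≤ maxWt γ h P x 1 ^ (k 1 - 2) * ‖diffQuot γ h Z x 1‖ ^ 2 := by positivity
        have e5 : 0 ≤ maxWt γ h P x 1 ^ (k 1 - 2) * maxWt γ h P x 1 * ‖diffQuot γ h Z x 0‖ ^ 2 := by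
          positivity
        match a with
        | 0 => linarith
        | 1 => linarith
      set A := maxWt γ h P x a ^ (k a - 2)
      set W := maxWt γ h P x a
      set d := ‖diffQuot γ h Z x a‖
      set e := ‖diffQuot γ h P x a‖
      set s := η x
      have hA : 0 ≤ A := Real.rpow_nonneg Wa.le _
      have young (x y : ℝ) : A * (2 * x * y) ≤ A * (x ^ 2 + y ^ 2) :=
        mul_le_mul_of_nonneg_left (two_mul_le_add_sq x y) hA
      have t1 := young (s * e) (s * W * d)
      have t2 := young (s * W * d) (M * d)
      have t3 := mul_le_mul_of_nonneg_left hlow (sq_nonneg M)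
      have big : 2 * (A * W) * (s ^ 2 * (e * d) + s * M * d ^ 2) ≤
          energyDens k γ h η P a x + 2 * critDens k γ h η Z P a x +
            M ^ 2 * lowerDens k γ h K' Z P x := by
        have e1 : energyDens k γ h η P a x = A * (s * e) ^ 2 := by
          simp only [energyDens]; ring
        have e2 : critDens k γ h η Z P a x = A * (s * W * d) ^ 2 := by
          simp only [critDens]; ring
        rw [e1, e2]
        linarith
      have h0 : 0 ≤ ‖Dψ x‖ := norm_nonneg _
      calc wt (P x a) ^ (k a - 1) * ‖Dψ x‖ + wt (P (x + v) a) ^ (k a - 1) * ‖Dψ x‖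
          ≤ A * W * ‖Dψ x‖ + A * W * ‖Dψ x‖ := by gcongr
        _ = 2 * (A * W) * ‖Dψ x‖ := by ring
        _ ≤ 2 * (A * W) * (2 * N * (s ^ 2 * (e * d) + s * M * d ^ 2)) := by gcongr
        _ = 2 * N * (2 * (A * W) * (s ^ 2 * (e * d) + s * M * d ^ 2)) := by ring
        _ ≤ 2 * N * (energyDens k γ h η P a x + 2 * critDens k γ h η Z P a x +
            M ^ 2 * lowerDens k γ h K' Z P x) := by gcongr
        _ ≤ _ := by
          have h1 := energyDens_nonneg (k := k) (η := η) (P := P) γ h a x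
          have h2 := critDens_nonneg (k := k) (η := η) (P := P) (Z := Z) γ h a x
          have h3 := lowerDens_nonneg (k := k) (K' := K') (P := P) (Z := Z) γ h x
          gcongr
          norm_num
    · rw [DψK x hx, norm_zero, mul_zero, mul_zero, add_zero]
      have h1 := energyDens_nonneg (k := k) (η := η) (P := P) γ h a x
      have h2 := critDens_nonneg (k := k) (η := η) (P := P) (Z := Z) γ h a x
      have h3 := lowerDens_nonneg (k := k) (K' := K') (P := P) (Z := Z) γ h x
      positivity
  have q1 := integral_mono Yi (a1.add b1) p1
  have q2 := integral_mono (a2.add b2) (hBi.const_mul (2 * N)) p2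
  have r1 : Integrable fun x => energyDens k γ h η P a x + 2 * critDens k γ h η Z P a x :=
    Xi.add (Yi.const_mul 2)
  have r2 : Integrable fun x => 4 * N * (energyDens k γ h η P a x +
      2 * critDens k γ h η Z P a x + M ^ 2 * lowerDens k γ h K' Z P x) :=
    (r1.add (hBi.const_mul (M ^ 2))).const_mul (4 * N)
  have q3 := integral_mono (a3.add b3) r2 p3
  rw [integral_add' a1 b1] at q1
  rw [integral_add' a2 b2, integral_const_mul] at q2
  rw [integral_add' a3 b3, integral_const_mul, integral_add r1 (hBi.const_mul _),
    integral_add Xi (Yi.const_mul 2), integral_const_mul, integral_const_mul] at q3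
  set X := ∫ x, energyDens k γ h η P a x
  set Y := ∫ x, critDens k γ h η Z P a x
  set L := ∫ x, lowerDens k γ h K' Z P x
  have X0 : 0 ≤ X := integral_nonneg fun x => energyDens_nonneg γ h a x
  have L0 : 0 ≤ L := integral_nonneg fun x => lowerDens_nonneg γ h x
  have u1 := mul_le_mul_of_nonneg_left q2 hC.le
  have u2 := mul_le_mul_of_nonneg_left q3 (mul_nonneg hC.le hosc0)
  have u3 : 0 ≤ C * N * osc * X := by positivity
  have u4 : 0 ≤ C * N * L := by positivity
  have u5 : 0 ≤ C * N * osc * (M ^ 2 * L) := by positivity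
  linarith

end LocalSystem

/-! ### The local energy estimate -/

namespace LocalSystem

variable {n : ℕ} {m : Fin 2 → ℕ} {k : Fin 2 → ℝ} {q : CoeffArg n m → PVar n m}
  {w : CoeffArg n m → ZVar m} {lam Lam R : ℝ} {K K' : Set (Fin n → ℝ)} {Z : (Fin n → ℝ) → ZVar m}
  {P : (Fin n → ℝ) → PVar n m} {η : (Fin n → ℝ) → ℝ} {M : ℝ}

/-- The energy of the difference quotients of `∇z` is bounded uniformly in the step, provided `z`
oscillates little: then the critical term is absorbed by the energy. -/
theorem exists_energy_bound (hk : ∀ a, 2 ≤ k a) (hlam : 0 < lam) (hLam : 0 < Lam) (n : ℕ)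
    (m : Fin 2 → ℕ) :
    ∃ osc > 0, ∀ (q : CoeffArg n m → PVar n m) (w : CoeffArg n m → ZVar m) (R : ℝ)
      (K K' : Set (Fin n → ℝ)) (Z : (Fin n → ℝ) → ZVar m) (P : (Fin n → ℝ) → PVar n m)
      (η : (Fin n → ℝ) → ℝ) (M : ℝ), LocalSystem k q w lam Lam R K Z P → IsCutoff η K' M →
      IsCompact K' → ∀ c : ZVar m, (∀ x ∈ K, ‖Z x - c‖ ≤ osc) →
      ∃ C, ∀ (γ : Fin n) (h : ℝ), 0 < h →
        (∀ x ∈ K', ∀ t ∈ Icc (0 : ℝ) 1, x + t • h • Pi.single γ 1 ∈ K) →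
        (∫ x, energyDens k γ h η P 0 x) + ∫ x, energyDens k γ h η P 1 x ≤ C := by
  obtain ⟨D₀, hD₀, osc₀, hosc₀, hc₀⟩ := exists_crit_le hk hlam hLam n m 0
  obtain ⟨D₁, hD₁, osc₁, hosc₁, hc₁⟩ := exists_crit_le hk hlam hLam n m 1
  set D := max D₀ D₁ with hD
  have hD0 : 0 < D := hD₀.trans_le (le_max_left _ _)
  set σ := lam * min (segConst (k 0)) (segConst (k 1)) with hσ
  have hσ0 : 0 < σ := mul_pos hlam (lt_min (segConst_pos _) (segConst_pos _))
  set N := dimConst n m ^ 2 * Lam with hN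
  have hN0 : 0 < N := mul_pos (pow_pos (zero_lt_one.trans_le one_le_dimConst) 2) hLam
  -- With this `ε` the energy on the right of `energy_le` is at most half that on the left.
  set ε := σ / 12 with hε
  have hε0 : 0 < ε := by positivity
  set A := 2 * N ^ 2 / ε + 4 * N with hA
  have hA0 : 0 < A := by positivity
  -- The critical term is at most `2 δ` times the energy, up to lower order terms; multiplied by `A`
  -- this is a quarter of the energy on the left.
  set δ := min (1 / 2) (σ / (8 * A)) with hδ
  have hδ0 : 0 < δ := by positivity
  set osc := min (δ / D) (min osc₀ osc₁) with hosc
  have hosc0 : 0 < osc := by positivity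
  have hDosc : D * osc ≤ δ := by
    calc D * osc ≤ D * (δ / D) := by gcongr; exact min_le_left _ _
      _ = δ := by field_simp
  refine ⟨osc, hosc0, fun q w R K K' Z P η M hs hη hK' c hZ => ?_⟩
  obtain ⟨CL, hCL⟩ := hs.exists_integral_lowerDens_le hK'.measurableSet hK'.measure_lt_top.ne
  set B := 20 * ((N + N ^ 2 / ε) * (1 + 4 * M ^ 2)) with hB
  have hB0 : 0 ≤ B := by positivity
  set E := 2 * (D * (1 + osc * M ^ 2)) with hE
  have hE0 : 0 ≤ E := by positivity
  refine ⟨4 / σ * ((2 * A * E + B) * CL), fun γ h hh hKK => ?_⟩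
  obtain ⟨hLi, hLC⟩ := hCL γ h hh.ne'
  have hsub : K' ⊆ K := fun x hx => by simpa using hKK x hx 0 (by simp)
  have hone : ∀ x ∈ K', x + h • Pi.single γ 1 ∈ K := fun x hx => by
    simpa using hKK x hx 1 (by simp)
  have e1 := hs.energy_le hη hK' γ hh hKK hLi hε0 hN
  have e2 := hc₀ q w R K K' Z P η M hs hη hK' c osc hosc0.le
    ((min_le_right _ _).trans (min_le_left _ _)) hZ γ h hsub hone hLi
  have e3 := hc₁ q w R K K' Z P η M hs hη hK' c osc hosc0.le
    ((min_le_right _ _).trans (min_le_right _ _)) hZ γ h hsub hone hLi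
  set X₀ := ∫ x, energyDens k γ h η P 0 x
  set X₁ := ∫ x, energyDens k γ h η P 1 x
  set Y₀ := ∫ x, critDens k γ h η Z P 0 x
  set Y₁ := ∫ x, critDens k γ h η Z P 1 x
  set L := ∫ x, lowerDens k γ h K' Z P x
  have hX₀ : 0 ≤ X₀ := integral_nonneg fun x => energyDens_nonneg γ h 0 x
  have hX₁ : 0 ≤ X₁ := integral_nonneg fun x => energyDens_nonneg γ h 1 x
  have hY₀ : 0 ≤ Y₀ := integral_nonneg fun x => critDens_nonneg γ h 0 x
  have hY₁ : 0 ≤ Y₁ := integral_nonneg fun x => critDens_nonneg γ h 1 x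
  have hL : 0 ≤ L := integral_nonneg fun x => lowerDens_nonneg γ h x
  have f1 : σ * (X₀ + X₁) ≤ σ / 2 * (X₀ + X₁) + A * (Y₀ + Y₁) + B * L := by
    have g0 : σ * X₀ ≤ lam * (segConst (k 0) * X₀) := by
      rw [hσ, mul_assoc]
      gcongr
      exact min_le_left _ _
    have g1 : σ * X₁ ≤ lam * (segConst (k 1) * X₁) := by
      rw [hσ, mul_assoc]
      gcongr
      exact min_le_right _ _
    have g2 : 6 * ε = σ / 2 := by rw [hε]; ring
    rw [g2] at e1
    linarith
  have crit {D' X Y : ℝ} (hD' : D' ≤ D) (hX : 0 ≤ X) (hY : 0 ≤ Y)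
      (e : Y ≤ D' * osc * (X + Y) + D' * (1 + osc * M ^ 2) * L) : Y ≤ 2 * δ * X + E * L := by
    have g1 : D' * osc * (X + Y) ≤ δ * (X + Y) := by
      gcongr
      exact (mul_le_mul_of_nonneg_right hD' hosc0.le).trans hDosc
    have g2 : D' * (1 + osc * M ^ 2) * L ≤ D * (1 + osc * M ^ 2) * L := by gcongr
    have g3 : δ * Y ≤ 1 / 2 * Y := by
      gcongr
      exact min_le_left _ _
    have g4 : E * L = 2 * (D * (1 + osc * M ^ 2) * L) := by rw [hE]; ring
    linarith
  have f2 := crit (le_max_left _ _) hX₀ hY₀ e2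
  have f3 := crit (le_max_right _ _) hX₁ hY₁ e3
  have f4 : A * (2 * δ) ≤ σ / 4 := by
    calc A * (2 * δ) ≤ A * (2 * (σ / (8 * A))) := by gcongr; exact min_le_right _ _
      _ = σ / 4 := by field_simp; norm_num
  have f5 := mul_le_mul_of_nonneg_left f2 hA0.le
  have f6 := mul_le_mul_of_nonneg_left f3 hA0.le
  have f7 := mul_le_mul_of_nonneg_right f4 (add_nonneg hX₀ hX₁)
  have f8 : (2 * A * E + B) * L ≤ (2 * A * E + B) * CL := by gcongr
  rw [div_mul_eq_mul_div, le_div_iff₀ hσ0]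
  linarith

/-- Difference quotients of `∇z` are bounded in `L²` wherever the cutoff function equals one. -/
theorem lintegral_diffQuot_le (hs : LocalSystem k q w lam Lam R K Z P) (hη : IsCutoff η K' M)
    (hK' : IsCompact K') (γ : Fin n) (h : ℝ) {S : Set (Fin n → ℝ)} (hSm : MeasurableSet S)
    (hS : ∀ x ∈ S, η x = 1) (a : Fin 2) (i : Fin (m a)) (β : Fin n) :
    ∫⁻ x in S, ‖diffQuot γ h P x a i β‖ₑ ^ (2 : ℝ) ≤
      ENNReal.ofReal (∫ x, energyDens k γ h η P a x) := by
  rw [ofReal_integral_eq_lintegral_ofReal (integrable_energyDens hs hη hK' γ h a)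
    (Eventually.of_forall fun x => energyDens_nonneg γ h a x)]
  refine (setLIntegral_mono' hSm fun x hx => ?_).trans (setLIntegral_le_lintegral S _)
  rw [← ofReal_norm, ENNReal.ofReal_rpow_of_nonneg (norm_nonneg _) zero_le_two]
  refine ENNReal.ofReal_le_ofReal ?_
  rw [Real.rpow_two, energyDens, hS x hx]
  have h1 : 1 ≤ maxWt γ h P x a ^ (k a - 2) :=
    Real.one_le_rpow one_le_maxWt (by linarith [hs.two_le a])
  have h2 : ‖diffQuot γ h P x a i β‖ ≤ ‖diffQuot γ h P x a‖ :=
    (norm_le_pi_norm (diffQuot γ h P x a i) β).trans (norm_le_pi_norm (diffQuot γ h P x a) i)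
  have h3 : ‖diffQuot γ h P x a i β‖ ^ 2 ≤ ‖diffQuot γ h P x a‖ ^ 2 := by gcongr
  have h4 := mul_le_mul_of_nonneg_right h1 (sq_nonneg ‖diffQuot γ h P x a‖)
  linarith

end LocalSystem

/-! ### Localization -/

section Localization

variable {n : ℕ} {m : Fin 2 → ℕ}

theorem memLp_mul_of_tsupport_subset {Ω : Set (Fin n → ℝ)} (hΩ : MeasurableSet Ω) {r : ℝ≥0∞}
    {f φ : (Fin n → ℝ) → ℝ} (hf : MemLp f r (volume.restrict Ω)) (hφ : Continuous φ)
    (hs : HasCompactSupport φ) (hsΩ : tsupport φ ⊆ Ω) : MemLp (fun x => φ x * f x) r := by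
  obtain ⟨C, hC⟩ := hs.exists_bound_of_continuous hφ
  have h1 : MemLp φ ⊤ (volume.restrict Ω) :=
    memLp_top_of_bound hφ.aestronglyMeasurable C (Eventually.of_forall hC)
  have h2 : MemLp (φ * f) r (volume.restrict Ω) := hf.mul h1
  rw [← memLp_indicator_iff_restrict hΩ] at h2
  have e : (fun x => φ x * f x) = Ω.indicator (φ * f) := by
    funext x
    by_cases hx : x ∈ Ω
    · simp [hx]
    · simp [hx, image_eq_zero_of_notMem_tsupport fun h => hx (hsΩ h)]
  rwa [e]

/-- Near every point, a weak solution agrees with a solution of a local system. -/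
theorem exists_localSystem {Ω : Set (Fin n → ℝ)} (hΩ : IsOpen Ω) {k : Fin 2 → ℝ}
    (hk : ∀ a, 2 ≤ k a) {q : CoeffArg n m → PVar n m} {w : CoeffArg n m → ZVar m}
    (hqw : WeaklyCoupled Ω k q w) {z : (Fin n → ℝ) → ZVar m} {p : (Fin n → ℝ) → PVar n m}
    (hzc : ContinuousOn z Ω) (hp : HasSobolevGradient Ω k z p)
    (heq : ∀ (ξ : (Fin n → ℝ) → ZVar m) (Dξ : (Fin n → ℝ) → PVar n m),
      Continuous ξ → HasCompactSupport ξ → tsupport ξ ⊆ Ω → HasSobolevGradient Ω k ξ Dξ →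
      ∫ x in Ω, pairing (Dξ x) (ξ x) (q (x, z x, p x)) (w (x, z x, p x)) = 0)
    (hz1 : ∀ i, MemSobolev Ω 1 (ENNReal.ofReal (2 * k 1)) (fun x => z x 0 i))
    {x₀ : Fin n → ℝ} (hx₀ : x₀ ∈ Ω) :
    ∃ lam Lam R ρ, 0 < ρ ∧ Metric.closedBall x₀ ρ ⊆ Ω ∧
      ∃ Z P, LocalSystem k q w lam Lam R (Metric.closedBall x₀ ρ) Z P ∧
        ∀ x ∈ Metric.closedBall x₀ ρ, Z x = z x ∧ P x = p x := by
  obtain ⟨s, hs, hsΩ⟩ := Metric.nhds_basis_closedBall.mem_iff.1 (hΩ.mem_nhds hx₀)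
  set ρ := s / 3 with hρ
  have hρ0 : 0 < ρ := by positivity
  set K := Metric.closedBall x₀ ρ with hK
  have hKΩ : K ⊆ Ω := (Metric.closedBall_subset_closedBall (by linarith)).trans hsΩ
  have hKc : IsCompact K := isCompact_closedBall x₀ ρ
  let χ : ContDiffBump x₀ := ⟨2 * ρ, 3 * ρ, by positivity, by linarith⟩
  have χs : ContDiff ℝ ∞ χ := χ.contDiff
  have χc : HasCompactSupport χ := χ.hasCompactSupport
  have χΩ : tsupport χ ⊆ Ω := by
    rw [χ.tsupport_eq]
    exact (Metric.closedBall_subset_closedBall (show 3 * ρ ≤ s by linarith)).trans hsΩ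
  have χ1 : ∀ x ∈ K, χ x = 1 ∧ fderiv ℝ χ x = 0 := fun x hx => by
    have hx' : x ∈ Metric.ball x₀ (2 * ρ) := Metric.closedBall_subset_ball (by linarith) hx
    have h1 : χ =ᶠ[𝓝 x] fun _ => (1 : ℝ) := χ.eventuallyEq_one_of_mem_ball hx'
    exact ⟨h1.self_of_nhds, by rw [h1.fderiv_eq]; simp⟩
  obtain ⟨R, hR⟩ := hKc.exists_bound_of_continuousOn (hzc.mono hKΩ)
  obtain ⟨B, hB⟩ := hKc.exists_bound_of_continuousOn (f := fun x => x) continuousOn_id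
  have hx₀K : x₀ ∈ K := Metric.mem_closedBall_self hρ0.le
  have hR0 : 0 ≤ R := (norm_nonneg _).trans (hR x₀ hx₀K)
  have hB0 : 0 ≤ B := (norm_nonneg _).trans (hB x₀ hx₀K)
  obtain ⟨lam, Lam, hcond⟩ := hqw.cond
  obtain ⟨hl, hL, hae⟩ := hcond (B + R + 1) (by positivity)
  set Z : (Fin n → ℝ) → ZVar m := fun x => χ x • z x with hZ
  set P : (Fin n → ℝ) → PVar n m := fun x a i γ =>
    χ x * p x a i γ + fderiv ℝ χ x (Pi.single γ 1) * z x a i with hP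
  have hZP : ∀ x ∈ K, Z x = z x ∧ P x = p x := fun x hx => by
    obtain ⟨h1, h2⟩ := χ1 x hx
    refine ⟨by simp [hZ, h1], ?_⟩
    ext a i γ
    simp [hP, h1, h2]
  have hDχ (γ : Fin n) : tsupport (fun x => fderiv ℝ χ x (Pi.single γ 1)) ⊆ tsupport χ := by
    refine closure_minimal (fun x hx => by_contra fun h => hx ?_) (isClosed_tsupport χ)
    have h' : fderiv ℝ χ x = 0 := image_eq_zero_of_notMem_tsupport fun h'' =>
      h (tsupport_fderiv_subset ℝ h'')
    simp [h']
  have hmem {a : Fin 2} {i : Fin (m a)} {γ : Fin n} {r : ℝ≥0∞}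
      (h1 : MemLp (fun x => z x a i) r (volume.restrict Ω))
      (h2 : MemLp (fun x => p x a i γ) r (volume.restrict Ω)) :
      MemLp (fun x => P x a i γ) r :=
    (memLp_mul_of_tsupport_subset hΩ.measurableSet h2 χs.continuous χc χΩ).add
      (memLp_mul_of_tsupport_subset hΩ.measurableSet h1 (continuous_fderiv_apply χs _)
        (hasCompactSupport_fderiv_apply χc _)
        ((hDχ γ).trans χΩ))
  refine ⟨lam (B + R + 1), Lam (B + R + 1), R, ρ, hρ0, hKΩ, Z, P,
    { two_le := hk
      lam_pos := hl
      Lam_pos := hl.trans hL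
      compact := hKc
      cont := ?_
      supp := χc.smul_right
      weak := fun a i γ => ((hp a i).2 γ).1.cutoff χs χc χΩ
      memLp := fun a i γ => hmem (hp a i).1 ((hp a i).2 γ).2
      memLp_zero := fun i γ => ?_
      lip_q := hqw.lip_q.mono (prod_mono hKΩ Subset.rfl)
      lip_w := hqw.lip_w.mono (prod_mono hKΩ Subset.rfl)
      cond := ?_
      bound := fun x hx => by rw [(hZP x hx).1]; exact hR x hx
      eq := fun ξ Dξ hξ => ?_ }, hZP⟩
  · refine continuous_of_tsupport fun x hx => ?_
    have hx' : x ∈ Ω := χΩ (tsupport_smul_subset_left χ z hx)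
    exact χs.continuous.continuousAt.smul (hzc.continuousAt (hΩ.mem_nhds hx'))
  -- The weak gradient given by `hz1` is almost everywhere the one in the equation.
  · obtain ⟨h1, h2⟩ := hz1 i
    obtain ⟨v, hv, hv'⟩ := h2 γ
    exact hmem h1 (hv'.ae_eq (hv.ae_unique hΩ ((hp 0 i).2 γ).1))
  · rw [ae_restrict_iff' hΩ.measurableSet] at hae
    filter_upwards [hae] with x hx hxK y π hy
    refine hx (hKΩ hxK) y π ?_
    have h1 := hB x hxK
    have h2 := norm_nonneg x
    have h3 := norm_nonneg y
    nlinarith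
  · have hsupp : tsupport ξ ⊆ K :=
      closure_minimal (fun x hx => by_contra fun h => hx (hξ.zero x h)) hKc.isClosed
    have hξc : HasCompactSupport ξ := hKc.of_isClosed_subset (isClosed_tsupport _) hsupp
    have hcomp (a : Fin 2) (i : Fin (m a)) : Continuous fun x => ξ x a i :=
      (continuous_apply i).comp ((continuous_apply a).comp hξ.cont)
    have hcs (a : Fin 2) (i : Fin (m a)) : HasCompactSupport fun x => ξ x a i :=
      hξc.comp_left (g := fun y : ZVar m => y a i) rfl
    have := heq ξ Dξ hξ.cont hξc (hsupp.trans hKΩ) fun a i =>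
      ⟨((hcomp a i).memLp_of_hasCompactSupport (hcs a i)).restrict Ω, fun β =>
        ⟨(hξ.weak a i β).isWeakPartial Ω, (hξ.memLp a i β).restrict Ω⟩⟩
    have off {x : Fin n → ℝ} (hx : x ∉ K) (Q : PVar n m) (W : ZVar m) :
        pairing (Dξ x) (ξ x) Q W = 0 := by
      rw [hξ.zero x hx, hξ.grad_zero x hx]
      simp [pairing]
    rw [setIntegral_eq_integral_of_forall_compl_eq_zero fun x hx =>
      off (fun h => hx (hKΩ h)) _ _] at this
    rw [← this]
    congr 1
    ext x
    by_cases hx : x ∈ K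
    · rw [(hZP x hx).1, (hZP x hx).2]
    · rw [off hx, off hx]

/-- Near every point, the difference quotients of the gradient of a weak solution are bounded in
`L²`, uniformly in the step. -/
theorem exists_local_diffQuot_bound {Ω : Set (Fin n → ℝ)} (hΩ : IsOpen Ω) {k : Fin 2 → ℝ}
    (hk : ∀ a, 2 ≤ k a) {q : CoeffArg n m → PVar n m} {w : CoeffArg n m → ZVar m}
    (hqw : WeaklyCoupled Ω k q w) {z : (Fin n → ℝ) → ZVar m} {p : (Fin n → ℝ) → PVar n m}
    (hzc : ContinuousOn z Ω) (hp : HasSobolevGradient Ω k z p)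
    (heq : ∀ (ξ : (Fin n → ℝ) → ZVar m) (Dξ : (Fin n → ℝ) → PVar n m),
      Continuous ξ → HasCompactSupport ξ → tsupport ξ ⊆ Ω → HasSobolevGradient Ω k ξ Dξ →
      ∫ x in Ω, pairing (Dξ x) (ξ x) (q (x, z x, p x)) (w (x, z x, p x)) = 0)
    (hz1 : ∀ i, MemSobolev Ω 1 (ENNReal.ofReal (2 * k 1)) (fun x => z x 0 i))
    {x₀ : Fin n → ℝ} (hx₀ : x₀ ∈ Ω) :
    ∃ r > 0, Metric.ball x₀ (2 * r) ⊆ Ω ∧ ∃ C : ℝ≥0∞, C ≠ ⊤ ∧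
      ∀ (γ : Fin n), ∀ h ∈ Ioo 0 r, ∀ (a : Fin 2) (i : Fin (m a)) (β : Fin n),
        ∫⁻ x in Metric.ball x₀ r,
          ‖h⁻¹ * (p (x + h • Pi.single γ 1) a i β - p x a i β)‖ₑ ^ (2 : ℝ) ≤ C := by
  obtain ⟨lam, Lam, R, ρ, hρ, hρΩ, Z, P, hs, hZP⟩ :=
    exists_localSystem hΩ hk hqw hzc hp heq hz1 hx₀
  obtain ⟨osc, hosc, hmain⟩ := LocalSystem.exists_energy_bound hk hs.lam_pos hs.Lam_pos n m
  obtain ⟨s, hs0, hsZ⟩ := Metric.continuousAt_iff.1 (hs.cont.continuousAt (x := x₀)) osc hosc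
  set r := min (ρ / 3) (s / 4) with hr
  have hr0 : 0 < r := by positivity
  have hrρ : 3 * r ≤ ρ := by linarith [min_le_left (ρ / 3) (s / 4)]
  have hrs : 3 * r < s := by linarith [min_le_right (ρ / 3) (s / 4)]
  have hsub : Metric.closedBall x₀ (3 * r) ⊆ Metric.closedBall x₀ ρ :=
    Metric.closedBall_subset_closedBall hrρ
  have hs' := hs.mono (isCompact_closedBall x₀ (3 * r)) hsub
  let η : ContDiffBump x₀ := ⟨r, 2 * r, hr0, by linarith⟩
  have ηs : ContDiff ℝ ∞ η := η.contDiff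
  obtain ⟨M, hM⟩ : ∃ M, ∀ x, ‖partials η x‖ ≤ M := by
    refine HasCompactSupport.exists_bound_of_continuous (f := partials η) ?_ ?_
    · exact η.hasCompactSupport.mono' fun x hx => by
        by_contra h
        refine hx ?_
        have h' : fderiv ℝ η x = 0 := image_eq_zero_of_notMem_tsupport fun h'' =>
          h (tsupport_fderiv_subset ℝ h'')
        ext α
        simp [partials, h']
    · exact continuous_pi fun α => continuous_fderiv_apply ηs _
  have hη : IsCutoff η (Metric.closedBall x₀ (2 * r)) M :=
    ⟨ηs, fun x => η.nonneg, fun x => η.le_one, fun x hx =>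
      image_eq_zero_of_notMem_tsupport (by rwa [η.tsupport_eq]), hM⟩
  have hK' := isCompact_closedBall x₀ (2 * r)
  obtain ⟨C, hC⟩ := hmain q w R _ _ Z P η M hs' hη hK' (Z x₀) fun x hx => by
    rw [← dist_eq_norm]
    exact (hsZ ((Metric.mem_closedBall.1 hx).trans_lt hrs)).le
  have hstep {h : ℝ} (hh : h ∈ Ioo 0 r) {t : ℝ} (ht : t ∈ Icc (0 : ℝ) 1) {u : ℝ}
      {x : Fin n → ℝ} (γ : Fin n) (hx : dist x x₀ ≤ u) :
      dist (x + t • h • Pi.single γ 1) x₀ ≤ u + r := by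
    have e1 : ‖t • h • (Pi.single γ 1 : Fin n → ℝ)‖ ≤ r := by
      rw [norm_smul, norm_smul, Pi.norm_single, norm_one, mul_one, Real.norm_of_nonneg ht.1,
        Real.norm_of_nonneg hh.1.le]
      calc t * h ≤ 1 * h := mul_le_mul_of_nonneg_right ht.2 hh.1.le
        _ ≤ r := by linarith [hh.2]
    rw [dist_eq_norm] at hx ⊢
    rw [add_sub_right_comm]
    exact (norm_add_le _ _).trans (add_le_add hx e1)
  refine ⟨r, hr0, (Metric.ball_subset_closedBall.trans (Metric.closedBall_subset_closedBall
    (by linarith))).trans hρΩ, ENNReal.ofReal C, ENNReal.ofReal_ne_top, fun γ h hh a i β => ?_⟩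
  have h1 := hC γ h hh.1 fun x hx t ht => by
    have := hstep hh ht γ (Metric.mem_closedBall.1 hx)
    exact Metric.mem_closedBall.2 (by linarith)
  have h2 := hs'.lintegral_diffQuot_le hη hK' γ h (measurableSet_ball (x := x₀) (ε := r))
    (fun x hx => η.one_of_mem_closedBall (Metric.ball_subset_closedBall hx)) a i β
  have h3 : ∫ x, energyDens k γ h η P a x ≤ C := by
    have n0 : 0 ≤ ∫ x, energyDens k γ h η P 0 x :=
      integral_nonneg fun x => LocalSystem.energyDens_nonneg γ h 0 x
    have n1 : 0 ≤ ∫ x, energyDens k γ h η P 1 x :=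
      integral_nonneg fun x => LocalSystem.energyDens_nonneg γ h 1 x
    match a with
    | 0 => linarith
    | 1 => linarith
  refine le_trans (le_of_eq (setLIntegral_congr_fun measurableSet_ball fun x hx => ?_))
    (h2.trans (ENNReal.ofReal_le_ofReal h3))
  have hx' : dist x x₀ ≤ r := (Metric.mem_ball.1 hx).le
  have e1 := (hZP x (Metric.mem_closedBall.2 (by linarith))).2
  have e2 := (hZP (x + h • Pi.single γ 1) (Metric.mem_closedBall.2 (by
    have := hstep hh (t := 1) (by simp) γ hx'
    rw [one_smul] at this
    linarith))).2
  simp only [diffQuot, Pi.smul_apply, Pi.sub_apply, smul_eq_mul, e1, e2]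

end Localization

/-! ### Square integrable second derivatives -/

theorem IsWeakPartial.congr {n : ℕ} {γ : Fin n} {Ω : Set (Fin n → ℝ)} {u u' v : (Fin n → ℝ) → ℝ}
    (h : IsWeakPartial Ω γ u v) (hΩ : MeasurableSet Ω) (hu : EqOn u u' Ω) :
    IsWeakPartial Ω γ u' v where
  locInt := h.locInt.congr ((ae_restrict_iff' hΩ).2 (Eventually.of_forall hu))
  locInt' := h.locInt'
  eq φ h1 h2 h3 := by
    rw [← h.eq φ h1 h2 h3]
    exact setIntegral_congr_fun hΩ fun x hx => by simp only [hu hx]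

theorem lintegral_biUnion_finset_le {α β : Type*} [MeasurableSpace α] {μ : Measure α} (t : Finset β)
    (s : β → Set α) (f : α → ℝ≥0∞) :
    ∫⁻ x in ⋃ y ∈ t, s y, f x ∂μ ≤ ∑ y ∈ t, ∫⁻ x in s y, f x ∂μ := by
  classical
  induction t using Finset.induction_on with
  | empty => simp
  | insert y t hy ih =>
    rw [Finset.set_biUnion_insert, Finset.sum_insert hy]
    exact (lintegral_union_le f _ _).trans (add_le_add le_rfl ih)

/-- Local uniform bounds for the difference quotients in `L²` give weak derivatives in `L²`. -/
theorem exists_isWeakPartial_of_local_bound {n : ℕ} {γ : Fin n} {Ω Ω' : Set (Fin n → ℝ)}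
    {u : (Fin n → ℝ) → ℝ} (hΩ : MeasurableSet Ω) (hΩb : Bornology.IsBounded Ω)
    (hu : MemLp u 2 (volume.restrict Ω))
    (hb : ∀ x₀ ∈ Ω, ∃ r > 0, Metric.ball x₀ (2 * r) ⊆ Ω ∧ ∃ C : ℝ≥0∞, C ≠ ⊤ ∧ ∀ h ∈ Ioo 0 r,
      ∫⁻ x in Metric.ball x₀ r, ‖h⁻¹ * (u (x + h • Pi.single γ 1) - u x)‖ₑ ^ (2 : ℝ) ≤ C)
    (hΩ' : IsOpen Ω') (hc : IsCompact (closure Ω')) (hcΩ : closure Ω' ⊆ Ω) :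
    ∃ v, IsWeakPartial Ω' γ u v ∧ MemLp v 2 (volume.restrict Ω') := by
  choose! r hr hrΩ C hC hCb using hb
  obtain ⟨t, ht, htc⟩ := hc.elim_nhds_subcover (fun x => Metric.ball x (r x)) fun x hx =>
    Metric.ball_mem_nhds x (hr x (hcΩ hx))
  have htΩ : ∀ x ∈ t, x ∈ Ω := fun x hx => hcΩ (ht x hx)
  obtain ⟨h₀, hh₀, hh₀r⟩ : ∃ h₀ > 0, ∀ x ∈ t, h₀ ≤ r x := by
    rcases t.eq_empty_or_nonempty with rfl | hne
    · exact ⟨1, one_pos, by simp⟩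
    · obtain ⟨y, hy, hmin⟩ := t.exists_min_image r hne
      exact ⟨r y, hr y (htΩ y hy), hmin⟩
  set u' := Ω.indicator u with hu'
  have hu2 : MemLp u' 2 := (memLp_indicator_iff_restrict hΩ).2 hu
  -- As `Ω` has finite measure, `u` is also integrable.
  have hfin : IsFiniteMeasure (volume.restrict Ω) :=
    ⟨by rw [Measure.restrict_apply_univ]; exact hΩb.measure_lt_top⟩
  have hu1 : Integrable u' := by
    rw [← memLp_one_iff_integrable, hu', memLp_indicator_iff_restrict hΩ]
    exact hu.mono_exponent (by norm_num)
  have hΩ'Ω : Ω' ⊆ Ω := subset_closure.trans hcΩ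
  obtain ⟨v, hv, hv2⟩ := exists_isWeakPartial_of_difference_quotient_bounded (γ := γ) hΩ' hu1 hu2
    (C := ∑ x ∈ t, C x) (ENNReal.sum_ne_top.2 fun x hx => hC x (htΩ x hx)) hh₀ fun h hh => by
      calc ∫⁻ x in Ω', ‖h⁻¹ * (u' (x + h • Pi.single γ 1) - u' x)‖ₑ ^ (2 : ℝ)
          ≤ ∫⁻ x in ⋃ y ∈ t, Metric.ball y (r y),
              ‖h⁻¹ * (u' (x + h • Pi.single γ 1) - u' x)‖ₑ ^ (2 : ℝ) :=
            lintegral_mono_set (subset_closure.trans htc)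
        _ ≤ ∑ y ∈ t, ∫⁻ x in Metric.ball y (r y),
              ‖h⁻¹ * (u' (x + h • Pi.single γ 1) - u' x)‖ₑ ^ (2 : ℝ) :=
            lintegral_biUnion_finset_le t _ _
        _ ≤ ∑ y ∈ t, C y := by
          refine Finset.sum_le_sum fun y hy => ?_
          have hy' := htΩ y hy
          refine le_trans (le_of_eq (setLIntegral_congr_fun measurableSet_ball fun x hx => ?_))
            (hCb y hy' h ⟨hh.1, hh.2.trans_le (hh₀r y hy)⟩)
          have hxd : dist x y < r y := Metric.mem_ball.1 hx
          have h1 : x ∈ Ω := hrΩ y hy' (Metric.mem_ball.2 (by linarith [hr y hy']))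
          have h2 : x + h • Pi.single γ 1 ∈ Ω := by
            refine hrΩ y hy' (Metric.mem_ball.2 ?_)
            have e1 : ‖h • (Pi.single γ 1 : Fin n → ℝ)‖ < r y := by
              rw [norm_smul, Pi.norm_single, norm_one, mul_one, Real.norm_of_nonneg hh.1.le]
              exact hh.2.trans_le (hh₀r y hy)
            rw [dist_eq_norm] at hxd ⊢
            rw [add_sub_right_comm]
            exact (norm_add_le _ _).trans_lt (by linarith)
          simp only [hu', indicator_of_mem h1, indicator_of_mem h2]
  exact ⟨v, hv.congr hΩ'.measurableSet fun x hx => indicator_of_mem (hΩ'Ω hx) u, hv2⟩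

theorem mainTheorem1 {n : ℕ} {m : Fin 2 → ℕ} (Ω : Set (Fin n → ℝ))
    (hΩ : IsOpen Ω) (hΩc : IsConnected Ω) (hΩb : Bornology.IsBounded Ω)
    (k : Fin 2 → ℝ) (hk : ∀ a, 2 ≤ k a)
    (q : CoeffArg n m → PVar n m) (w : CoeffArg n m → ZVar m)
    (hqw : WeaklyCoupled Ω k q w)
    (z : (Fin n → ℝ) → ZVar m) (hz : IsWeakSolution Ω k q w z)
    (hz1 : ∀ i, MemSobolev Ω 1 (ENNReal.ofReal (2 * k 1)) (fun x => z x 0 i)) :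
    ContinuousOn z Ω ∧ ∀ a i, MemSobolevLoc Ω 2 2 (fun x => z x a i) := by
  obtain ⟨hzc, p, hp, heq⟩ := hz
  refine ⟨hzc, fun a i Ω' hΩ' hc hcΩ => ?_⟩
  have hfin : IsFiniteMeasure (volume.restrict Ω) :=
    ⟨by rw [Measure.restrict_apply_univ]; exact hΩb.measure_lt_top⟩
  have h2 : (2 : ℝ≥0∞) ≤ ENNReal.ofReal (k a) := by
    simpa using ENNReal.ofReal_le_ofReal (hk a)
  have hΩ'Ω : Ω' ⊆ Ω := subset_closure.trans hcΩ
  have hle : volume.restrict Ω' ≤ volume.restrict Ω := Measure.restrict_mono hΩ'Ω le_rfl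
  refine ⟨((hp a i).1.mono_exponent h2).mono_measure hle, fun β =>
    ⟨fun x => p x a i β, ((hp a i).2 β).1.mono hΩ'Ω,
      (((hp a i).2 β).2.mono_exponent h2).mono_measure hle, fun γ =>
      exists_isWeakPartial_of_local_bound hΩ.measurableSet hΩb
        (((hp a i).2 β).2.mono_exponent h2) (fun x₀ hx₀ => ?_) hΩ' hc hcΩ⟩⟩
  obtain ⟨r, hr, hrΩ, C, hC, hb⟩ := exists_local_diffQuot_bound hΩ hk hqw hzc hp heq hz1 hx₀
  exact ⟨r, hr, hrΩ, C, hC, fun h hh => hb γ h hh a i β⟩
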